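/- All graphs are simple and undirected. For a connected input graph $G$ let $n$ be its number of vertices, $m$ its number of edges, and $\kappa$ its degeneracy, i.e. the least integer $d$ such that every nonempty subgraph of $G$ has a vertex of degree at most $d$. A copy of a graph $H$ in $G$ is a (not necessarily induced) subgraph of $G$ that is isomorphic to $H$. For $k \ge 1$, the problem $\mathrm{SUB\text{-}CNT}_k$ asks, given a connected graph $G$, for the number of copies of $H$ in $G$ for every connected graph $H$ on $k$ vertices (one for each isomorphism class). Algorithms are Las Vegas randomized algorithms on a word RAM with unit-cost operations on words of $O(\log n)$ bits (a sufficiently large constant times $\log n$ suffices) that can draw uniformly random words: on every input they halt with the correct output with probability one, and the expected number of steps is measured. The input graph is given by $n$, $m$ and a list of its edges. **Theorem.** (1) For every connected graph $H$ on $5$ vertices there is an algorithm that computes the number of copies of $H$ in a connected input graph $G$ in expected time $O(m\kappa^{3})$. (2) For every $k$ with $1 \le k \le 5$ there is an algorithm that solves $\mathrm{SUB\text{-}CNT}_k$ in expected time $O(m\kappa^{k-2})$; in particular, for every fixed $d$, its expected running time is $O(m)$ on connected graphs $G$ of degeneracy at most $d$. Here the constant in $O(m\kappa^{3})$ and $O(m\kappa^{k-2})$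 is absolute (it depends only on $H$, respectively $k$), the constant in $O(m)$ depends only on $k$ and $d$, and a bound $O(T)$ means at most a constant times $\max(1,T)$, which only matters for trivial inputs such as the one-vertex graph, where $T$ may be below $1$. -/

import Mathlib

open MeasureTheory
open scoped ENNReal NNReal

/-! # A randomized word RAM with a step count -/

namespace WordRAM

/-- The arithmetic operations of the machine on `w`-bit words. Sums, differences and products are
taken modulo `2 ^ w`; `div` and `mod` are quotient and remainder of unsigned words. -/
inductive Op where
  | add
  | sub
  | mul
  | div
  | mod

/-- The value of an operation on two words. -/
def Op.eval {w : ℕ} : Op → BitVec w → BitVec w → BitVec w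
  | .add, x, y => x + y
  | .sub, x, y => x - y
  | .mul, x, y => x * y
  | .div, x, y => x / y
  | .mod, x, y => x % y

/-- The tests of the machine: comparison of two registers. -/
inductive Test where
  | eq (a b : ℕ)
  | lt (a b : ℕ)

/-- The value of a test in a given register file (words are compared as unsigned numbers). -/
def Test.eval {w : ℕ} (reg : ℕ → BitVec w) : Test → Bool
  | .eq a b => decide ((reg a).toNat = (reg b).toNat)
  | .lt a b => decide ((reg a).toNat < (reg b).toNat)

/-- The instructions. Registers are denoted by their numbers; a program is a finite text and so
uses finitely many registers. -/
inductive Instr where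
  /-- `r := v` for a constant `v` -/
  | const (r v : ℕ)
  /-- `r := a ∘ b` for an arithmetic operation `∘` on registers -/
  | arith (o : Op) (r a b : ℕ)
  /-- `r := mem[a]` -/
  | load (r a : ℕ)
  /-- `mem[a] := b` -/
  | store (a b : ℕ)
  /-- `r :=` a fresh uniformly random word -/
  | rand (r : ℕ)
  /-- branching -/
  | ite (t : Test) (P Q : List Instr)
  /-- iteration as long as the test is true -/
  | loop (t : Test) (P : List Instr)

/-- Programs are finite sequences of instructions. They do not depend on the word length. -/
abbrev Program := List Instr

/-- A configuration of the machine with words of `w` bits: the instructions still to be executed,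
the registers, the memory (one word for each of the `2 ^ w` addresses), and the number of random
words that have been consumed. -/
structure Config (w : ℕ) where
  code : Program
  reg : ℕ → BitVec w
  mem : BitVec w → BitVec w
  used : ℕ

/-- The source of randomness: an infinite sequence of words. -/
abbrev Tape (w : ℕ) := ℕ → Fin (2 ^ w)

/-- The law of the source of randomness: independent uniformly distributed words. -/
noncomputable def tapeMeasure (w : ℕ) : Measure (Tape w) :=
  Measure.infinitePi fun _ : ℕ => (PMF.uniformOfFintype (Fin (2 ^ w))).toMeasure

/-- One step of the machine: it executes one elementary instruction or evaluates one test.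
The machine has halted when no instruction is left. -/
def step {w : ℕ} (ω : Tape w) (s : Config w) : Config w :=
  match s.code with
  | [] => s
  | .const r v :: K => { s with code := K, reg := Function.update s.reg r (BitVec.ofNat w v) }
  | .arith o r a b :: K =>
      { s with code := K, reg := Function.update s.reg r (o.eval (s.reg a) (s.reg b)) }
  | .load r a :: K => { s with code := K, reg := Function.update s.reg r (s.mem (s.reg a)) }
  | .store a b :: K => { s with code := K, mem := Function.update s.mem (s.reg a) (s.reg b) }
  | .rand r :: K =>
      { s with
        code := K
        reg := Function.update s.reg r (BitVec.ofFin (ω s.used))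
        used := s.used + 1 }
  | .ite t P Q :: K => { s with code := (if t.eval s.reg then P else Q) ++ K }
  | .loop t P :: K => { s with code := if t.eval s.reg then P ++ .loop t P :: K else K }

/-- The initial configuration of program `P` on an input, which is a list of numbers: the input is
stored from address `0` on; all other memory cells and all registers are `0`. -/
def init (w : ℕ) (P : Program) (input : List ℕ) : Config w where
  code := P
  reg := fun _ => 0
  mem := fun a => BitVec.ofNat w (input.getD a.toNat 0)
  used := 0

/-- The configuration after `t` steps. -/
def run {w : ℕ} (ω : Tape w) (P : Program) (input : List ℕ) (t : ℕ) : Config w :=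
  (step ω)^[t] (init w P input)

/-- The number of steps until the machine halts (`∞` if it does not halt). -/
noncomputable def runTime {w : ℕ} (ω : Tape w) (P : Program) (input : List ℕ) : ℝ≥0∞ :=
  ⨅ (t : ℕ) (_ : (run ω P input t).code = []), (t : ℝ≥0∞)

/-- The expected number of steps until the machine halts. -/
noncomputable def expectedTime (w : ℕ) (P : Program) (input : List ℕ) : ℝ≥0∞ :=
  ∫⁻ ω, runTime ω P input ∂tapeMeasure w

/-- On the random sequence `ω`, program `P` halts and leaves the numbers `out` in the memory cells
`0, 1, 2, …`. -/
def Outputs {w : ℕ} (ω : Tape w) (P : Program) (input out : List ℕ) : Prop :=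
  ∃ t : ℕ, (run ω P input t).code = [] ∧
    ∀ i : Fin out.length, ((run ω P input t).mem (BitVec.ofNat w i)).toNat = out.get i

end WordRAM

/-! # Degeneracy and the subgraph counting problem -/

namespace SubgraphCounting

/-- `G` is `d`-degenerate: every (nonempty) subgraph of `G` has a vertex of degree at most `d`. -/
def IsDegenerate {V : Type*} [Finite V] (G : SimpleGraph V) (d : ℕ) : Prop :=
  ∀ G' : G.Subgraph, G'.verts.Nonempty → ∃ v ∈ G'.verts, (G'.neighborSet v).ncard ≤ d

/-- The degeneracy of `G`: the least `d` such that `G` is `d`-degenerate. -/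
noncomputable def degeneracy {V : Type*} [Finite V] (G : SimpleGraph V) : ℕ :=
  sInf {d | IsDegenerate G d}

/-- `es` lists every edge of `G` exactly once, in any order, with its ends in any order. -/
def IsEdgeList {n : ℕ} (G : SimpleGraph (Fin n)) (es : List (Fin n × Fin n)) : Prop :=
  (es.map fun p => s(p.1, p.2)).Nodup ∧
    ∀ e : Sym2 (Fin n), e ∈ (es.map fun p => s(p.1, p.2)) ↔ e ∈ G.edgeSet

/-- The input of the machine that describes a graph on `{0, …, n - 1}` with edge list `es`:
the number of vertices, the number of edges, then the two ends of each edge. -/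
def encode (n : ℕ) (es : List (Fin n × Fin n)) : List ℕ :=
  n :: es.length :: es.flatMap fun p => [(p.1 : ℕ), (p.2 : ℕ)]

/-- `Hs` lists all connected graphs with `k` vertices, one for each isomorphism class. -/
def IsPatternList {k : ℕ} (Hs : List (SimpleGraph (Fin k))) : Prop :=
  (∀ H ∈ Hs, H.Connected) ∧
  Hs.Pairwise (fun H H' => ¬ Nonempty (H ≃g H')) ∧
  ∀ H : SimpleGraph (Fin k), H.Connected → ∃ H' ∈ Hs, Nonempty (H ≃g H')

/-- Such lists exist for every `k`. -/
theorem exists_isPatternList (k : ℕ) : ∃ Hs : List (SimpleGraph (Fin k)), IsPatternList Hs := by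
  classical
  let S : Setoid (SimpleGraph (Fin k)) :=
    { r := fun H H' => Nonempty (H ≃g H')
      iseqv :=
        { refl := fun _ => ⟨SimpleGraph.Iso.refl⟩
          symm := fun ⟨e⟩ => ⟨e.symm⟩
          trans := fun ⟨e⟩ ⟨f⟩ => ⟨f.comp e⟩ } }
  let A : Finset (Quotient S) :=
    (Finset.univ.filter fun H : SimpleGraph (Fin k) => H.Connected).image (Quotient.mk S)
  refine ⟨A.toList.map Quotient.out, ?_, ?_, ?_⟩
  · intro H hH
    obtain ⟨q, hq, rfl⟩ := List.mem_map.1 hH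
    obtain ⟨H, hHc, rfl⟩ := Finset.mem_image.1 (Finset.mem_toList.1 hq)
    obtain ⟨e⟩ : Nonempty ((Quotient.mk S H).out ≃g H) := Quotient.mk_out (s := S) H
    exact e.symm.connected_iff.1 (Finset.mem_filter.1 hHc).2
  · rw [List.pairwise_map]
    refine (Finset.nodup_toList A).imp ?_
    intro q q' hne h
    apply hne
    rw [← Quotient.out_eq q, ← Quotient.out_eq q']
    exact Quotient.sound h
  · intro H hH
    refine ⟨(Quotient.mk S H).out, List.mem_map.2 ⟨_, Finset.mem_toList.2 (Finset.mem_image.2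
      ⟨H, Finset.mem_filter.2 ⟨Finset.mem_univ _, hH⟩, rfl⟩), rfl⟩, ?_⟩
    obtain ⟨e⟩ : Nonempty ((Quotient.mk S H).out ≃g H) := Quotient.mk_out (s := S) H
    exact ⟨e.symm⟩

/-- The randomized program `P` solves the problem of counting the copies of the patterns `Hs` (the
subgraphs of the input graph that are isomorphic to the pattern, induced or not) in connected
graphs `G`, on every machine whose word length `w` is at least `c` times the number of binary
digits of the number of vertices: with probability one it halts with all the counts in memory. -/
def Solves (P : WordRAM.Program) (c : ℕ) {k : ℕ} (Hs : List (SimpleGraph (Fin k))) : Prop :=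
  ∀ (n : ℕ) (G : SimpleGraph (Fin n)) (es : List (Fin n × Fin n)) (w : ℕ),
    G.Connected → IsEdgeList G es → c * n.size ≤ w →
    ∀ᵐ ω ∂WordRAM.tapeMeasure w,
      WordRAM.Outputs ω P (encode n es) (Hs.map fun H => G.copyCount H)

/-- The expected running time of `P` on connected graphs `G` with `m` edges and degeneracy `κ ∈ D`
is at most `T m κ`, under the same convention on the word length. -/
def RunsInExpectedTime (P : WordRAM.Program) (c : ℕ) (D : Set ℕ) (T : ℕ → ℕ → ℝ) : Prop :=
  ∀ (n : ℕ) (G : SimpleGraph (Fin n)) (es : List (Fin n × Fin n)) (w : ℕ),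
    G.Connected → IsEdgeList G es → c * n.size ≤ w → degeneracy G ∈ D →
    WordRAM.expectedTime w P (encode n es) ≤
      ENNReal.ofReal (T G.edgeSet.ncard (degeneracy G))

end SubgraphCounting

/-! No randomness is needed: the program is deterministic, and correctness and expected time follow
from one step count that is the same on every random tape (`Computes`).

Preparation. Vertices are peeled off with increasing degree thresholds, and each edge is directed
from the end processed first to the other one. Every out-list then has length at most κ, because
whenever threshold `d` still has work to do, the unprocessed vertices induce a subgraph of minimum
degree at least `d` (`le_of_seenCount_le`, `Tri.peel`). This costs O(m + nκ), which is O(mκ) in a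
connected graph with an edge.

Reduction to constraint systems. The number of copies of H is the number of injective homomorphisms
divided by |Aut H| (`SimpleGraph.copyCount_mul_card_iso`). The indicator of an injective
homomorphism is a product over pairs of vertices of H: an edge contributes [u→v] + [v→u], a non-edge
contributes 1 − [u = v]. Expanding the product (`signedSum_expand`) gives a signed sum, whose length
depends on H only, of numbers of solutions of systems in which each constraint says that one
variable lies in a short list attached to another: an out-list, or the one-element list that encodes
equality. For connected H every system is connected as a digraph on the k variables.

Counting solutions. Choose one variable, a source, in each strongly connected class that is not
reached from another class. The variables reached from a source are enumerated along a spanning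
tree. The source together with the first tree constraint costs only a sum of list lengths, at most
2m, and each of the at most k − 2 further variables costs a factor κ (`sum_levelTime_le`). If there
is a root source r whose reach contains the overlap of any two other reaches, then fixing the values
on the reach of r makes the remaining parts independent. So for each other source a table is filled,
indexed by the values on the overlap with the reach of r, and the products of the table entries are
summed over the reach of r (`sumOff_root_eq_solutions`).

Such a root exists on at most five variables (`exists_root`), and this is where k ≤ 5 is essential:
the 6-cycle with alternating sources and sinks has none. The tables are addressed directly in
zero-initialised memory, with a separate block for every system, so nothing ever has to be cleared.

For k ≤ 2 the answers are n and m, which are read from the input, since O(mκ) preparation would be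
too slow. -/

namespace WordRAM

/-! ## Straight-line execution -/

/-- The code `P` takes registers `ρ` and memory `μ` to `ρ'` and `μ'` in exactly `t` steps, without
consuming randomness. -/
def Steps {w : ℕ} (P : Program) (ρ : ℕ → BitVec w) (μ : BitVec w → BitVec w) (t : ℕ)
    (ρ' : ℕ → BitVec w) (μ' : BitVec w → BitVec w) : Prop :=
  ∀ (ω : Tape w) (K : Program) (u : ℕ), (step ω)^[t] ⟨P ++ K, ρ, μ, u⟩ = ⟨K, ρ', μ', u⟩

namespace Steps

variable {w : ℕ} {P Q : Program} {ρ ρ' ρ'' : ℕ → BitVec w} {μ μ' μ'' : BitVec w → BitVec w}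
  {t t' : ℕ}

theorem nil : Steps [] ρ μ 0 ρ μ := fun _ _ _ => rfl

theorem append (h : Steps P ρ μ t ρ' μ') (h' : Steps Q ρ' μ' t' ρ'' μ'') :
    Steps (P ++ Q) ρ μ (t + t') ρ'' μ'' := by
  intro ω K u
  rw [Nat.add_comm, Function.iterate_add_apply, List.append_assoc, h, h']

theorem cons {i : Instr} (h : Steps [i] ρ μ 1 ρ' μ') (h' : Steps Q ρ' μ' t' ρ'' μ'') :
    Steps (i :: Q) ρ μ (1 + t') ρ'' μ'' := append h h'

theorem const (r v : ℕ) :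
    Steps [.const r v] ρ μ 1 (Function.update ρ r (BitVec.ofNat w v)) μ := fun _ _ _ => rfl

theorem arith (o : Op) (r a b : ℕ) :
    Steps [.arith o r a b] ρ μ 1 (Function.update ρ r (o.eval (ρ a) (ρ b))) μ := fun _ _ _ => rfl

theorem load (r a : ℕ) :
    Steps [.load r a] ρ μ 1 (Function.update ρ r (μ (ρ a))) μ := fun _ _ _ => rfl

theorem store (a b : ℕ) :
    Steps [.store a b] ρ μ 1 ρ (Function.update μ (ρ a) (ρ b)) := fun _ _ _ => rfl

theorem ite {c : Test} (h : Steps (if c.eval ρ then P else Q) ρ μ t ρ' μ') :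
    Steps [.ite c P Q] ρ μ (t + 1) ρ' μ' := by
  intro ω K u
  rw [Function.iterate_succ_apply]
  exact h ω K u

theorem loop_done {c : Test} (h : c.eval ρ = false) : Steps [.loop c P] ρ μ 1 ρ μ := by
  intro ω K u
  simp [step, h]

theorem loop_next {c : Test} (h : c.eval ρ = true) (h₁ : Steps P ρ μ t ρ' μ')
    (h₂ : Steps [.loop c P] ρ' μ' t' ρ'' μ'') :
    Steps [.loop c P] ρ μ (t + t' + 1) ρ'' μ'' := by
  intro ω K u
  have h₃ := (h₁.append h₂) ω K u
  rw [Function.iterate_succ_apply]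
  simpa [step, h] using h₃

end Steps

/-! ## Layout of the memory in arrays -/

/-- The parameters of the representation of arrays and variables: the word length `w`, the number
`nv` of variables (kept in the registers below `nv`), the number `K` of arrays and their common
length `B` (kept in register `nv`). -/
structure Layout where
  w : ℕ
  nv : ℕ
  B : ℕ
  K : ℕ
  fits : K * B ≤ 2 ^ w
  len_lt : B < 2 ^ w
  one_lt : 1 < 2 ^ w

/-- The values of the variables and the contents of the arrays. -/
structure Store where
  v : ℕ → ℕ
  a : ℕ → ℕ → ℕ

namespace Store

/-- Assignment to a variable. -/
def setV (s : Store) (x v : ℕ) : Store := ⟨Function.update s.v x v, s.a⟩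

/-- Assignment to an array cell. -/
def setA (s : Store) (a i v : ℕ) : Store :=
  ⟨s.v, Function.update s.a a (Function.update (s.a a) i v)⟩

@[simp] theorem setV_a (s : Store) (x v : ℕ) : (s.setV x v).a = s.a := rfl
@[simp] theorem setA_v (s : Store) (a i v : ℕ) : (s.setA a i v).v = s.v := rfl
@[simp] theorem setV_v_self (s : Store) (x v : ℕ) : (s.setV x v).v x = v := by simp [setV]
theorem setV_v_of_ne (s : Store) {x y : ℕ} (v : ℕ) (h : y ≠ x) : (s.setV x v).v y = s.v y := by
  simp [setV, h]
theorem setA_a_of_ne (s : Store) {a b : ℕ} (i v : ℕ) (h : b ≠ a) : (s.setA a i v).a b = s.a b := by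
  simp [setA, h]
theorem setA_a_self (s : Store) (a i v : ℕ) :
    (s.setA a i v).a a = Function.update (s.a a) i v := by
  simp [setA]

end Store

variable {L : Layout}

/-- Registers `ρ` and memory `μ` represent the store `s`. -/
structure Rep (L : Layout) (s : Store) (ρ : ℕ → BitVec L.w) (μ : BitVec L.w → BitVec L.w) :
    Prop where
  var : ∀ r < L.nv, (ρ r).toNat = s.v r
  len : (ρ L.nv).toNat = L.B
  cell : ∀ a < L.K, ∀ i < L.B, (μ (BitVec.ofNat L.w (a * L.B + i))).toNat = s.a a i

theorem Layout.address_lt (L : Layout) {a i : ℕ} (ha : a < L.K) (hi : i < L.B) :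
    a * L.B + i < 2 ^ L.w := by
  have h : (a + 1) * L.B ≤ L.K * L.B := Nat.mul_le_mul_right _ ha
  have := L.fits
  rw [Nat.add_mul, Nat.one_mul] at h
  omega

theorem Layout.address_inj (L : Layout) {a i b j : ℕ} (hi : i < L.B) (hj : j < L.B)
    (h : a * L.B + i = b * L.B + j) : a = b ∧ i = j := by
  have hB : 0 < L.B := by omega
  have h1 : (a * L.B + i) / L.B = a := by
    rw [Nat.add_comm, Nat.add_mul_div_right _ _ hB, Nat.div_eq_of_lt hi, Nat.zero_add]
  have h2 : (b * L.B + j) / L.B = b := by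
    rw [Nat.add_comm, Nat.add_mul_div_right _ _ hB, Nat.div_eq_of_lt hj, Nat.zero_add]
  have hab : a = b := by rw [← h1, h, h2]
  subst hab
  exact ⟨rfl, by omega⟩

namespace Rep

variable {s : Store} {ρ ρ' : ℕ → BitVec L.w} {μ : BitVec L.w → BitVec L.w}

theorem congr (h : Rep L s ρ μ) (hρ : ∀ r ≤ L.nv, ρ' r = ρ r) : Rep L s ρ' μ where
  var r hr := by rw [hρ r hr.le, h.var r hr]
  len := by rw [hρ _ le_rfl, h.len]
  cell := h.cell

theorem setV (h : Rep L s ρ μ) {x v : ℕ} (hx : x < L.nv) (hρ : ∀ r ≤ L.nv, r ≠ x → ρ' r = ρ r)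
    (hv : (ρ' x).toNat = v) : Rep L (s.setV x v) ρ' μ where
  var r hr := by
    by_cases hrx : r = x
    · subst hrx; simp [hv]
    · rw [hρ r hr.le hrx, h.var r hr, s.setV_v_of_ne _ hrx]
  len := by rw [hρ _ le_rfl (by omega), h.len]
  cell := h.cell

theorem setA (h : Rep L s ρ μ) {a i v : ℕ} {y : BitVec L.w} (ha : a < L.K) (hi : i < L.B)
    (hy : y.toNat = v) :
    Rep L (s.setA a i v) ρ (Function.update μ (BitVec.ofNat L.w (a * L.B + i)) y) where
  var := h.var
  len := h.len
  cell b hb j hj := by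
    -- Distinct cells have distinct machine addresses: all arrays together fit below `2 ^ w`, so
    -- reduction modulo `2 ^ w` identifies nothing.
    have key : BitVec.ofNat L.w (b * L.B + j) = BitVec.ofNat L.w (a * L.B + i) ↔ b = a ∧ j = i := by
      constructor
      · intro e
        have e' := congrArg BitVec.toNat e
        rw [BitVec.toNat_ofNat, BitVec.toNat_ofNat, Nat.mod_eq_of_lt (L.address_lt hb hj),
          Nat.mod_eq_of_lt (L.address_lt ha hi)] at e'
        exact L.address_inj hj hi e'
      · rintro ⟨rfl, rfl⟩; rfl
    by_cases hba : b = a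
    · subst hba
      rw [s.setA_a_self]
      by_cases hji : j = i
      · subst hji; simp [hy]
      · rw [Function.update_of_ne (by rw [Ne, key]; tauto), Function.update_of_ne hji,
          h.cell b hb j hj]
    · rw [s.setA_a_of_ne _ _ hba, Function.update_of_ne (by rw [Ne, key]; tauto), h.cell b hb j hj]

theorem v_lt (h : Rep L s ρ μ) {x : ℕ} (hx : x < L.nv) : s.v x < 2 ^ L.w := by
  rw [← h.var x hx]; exact BitVec.isLt _

end Rep

/-! ## Expressions -/

/-- Arithmetic expressions over variables and array cells. -/
inductive Ex where
  | num (v : ℕ)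
  | var (x : ℕ)
  | add (e f : Ex)
  | sub (e f : Ex)
  | mul (e f : Ex)
  | div (e f : Ex)
  | get (a : ℕ) (e : Ex)

namespace Ex

/-- The value of an expression. -/
def eval (s : Store) : Ex → ℕ
  | num v => v
  | var x => s.v x
  | add e f => e.eval s + f.eval s
  | sub e f => e.eval s - f.eval s
  | mul e f => e.eval s * f.eval s
  | div e f => e.eval s / f.eval s
  | get a e => s.a a (e.eval s)

/-- The evaluation neither overflows nor leaves the bounds of an array. -/
def Ok (L : Layout) (s : Store) : Ex → Prop
  | num v => v < 2 ^ L.w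
  | var x => x < L.nv
  | add e f => e.Ok L s ∧ f.Ok L s ∧ e.eval s + f.eval s < 2 ^ L.w
  | sub e f => e.Ok L s ∧ f.Ok L s ∧ f.eval s ≤ e.eval s
  | mul e f => e.Ok L s ∧ f.Ok L s ∧ e.eval s * f.eval s < 2 ^ L.w
  | div e f => e.Ok L s ∧ f.Ok L s
  | get a e => e.Ok L s ∧ a < L.K ∧ e.eval s < L.B

/-- The number of steps of the evaluation. -/
def cost : Ex → ℕ
  | num _ => 1
  | var _ => 2
  | add e f => e.cost + (f.cost + 1)
  | sub e f => e.cost + (f.cost + 1)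
  | mul e f => e.cost + (f.cost + 1)
  | div e f => e.cost + (f.cost + 1)
  | get _ e => e.cost + 4

/-- The code that evaluates an expression into register `b`, with `nv` variables. -/
def code (nv : ℕ) : Ex → ℕ → Program
  | num v, b => [.const b v]
  | var x, b => [.const b 0, .arith .add b b x]
  | add e f, b => e.code nv b ++ (f.code nv (b + 1) ++ [.arith .add b b (b + 1)])
  | sub e f, b => e.code nv b ++ (f.code nv (b + 1) ++ [.arith .sub b b (b + 1)])
  | mul e f, b => e.code nv b ++ (f.code nv (b + 1) ++ [.arith .mul b b (b + 1)])
  | div e f, b => e.code nv b ++ (f.code nv (b + 1) ++ [.arith .div b b (b + 1)])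
  | get a e, b => e.code nv b ++
      [.const (b + 1) a, .arith .mul (b + 1) (b + 1) nv, .arith .add b b (b + 1), .load b b]

theorem eval_lt {s : Store} {ρ : ℕ → BitVec L.w} {μ : BitVec L.w → BitVec L.w} (h : Rep L s ρ μ) :
    ∀ e : Ex, e.Ok L s → e.eval s < 2 ^ L.w
  | num _, ok => ok
  | var _, ok => h.v_lt ok
  | add _ _, ok => ok.2.2
  | sub e _, ok => lt_of_le_of_lt (Nat.sub_le _ _) (eval_lt h e ok.1)
  | mul _ _, ok => ok.2.2
  | div e _, ok => lt_of_le_of_lt (Nat.div_le_self _ _) (eval_lt h e ok.1)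
  | get a e, ok => by
      rw [eval, ← h.cell a ok.2.1 _ ok.2.2]; exact BitVec.isLt _

/-- The address computation: the sum of register `b` and `a` times the array length. -/
theorem steps_address {s : Store} {ρ : ℕ → BitVec L.w} {μ : BitVec L.w → BitVec L.w}
    (h : Rep L s ρ μ) {a i b r : ℕ} (hb : L.nv < b) (hr : b < r) (ha : a < L.K) (hi : i < L.B)
    (hρ : (ρ b).toNat = i) :
    ∃ ρ', Steps [.const r a, .arith .mul r r L.nv, .arith .add b b r] ρ μ 3 ρ' μ ∧
      (∀ q, q ≠ b → q ≠ r → ρ' q = ρ q) ∧ ρ' b = BitVec.ofNat L.w (a * L.B + i) := by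
  refine ⟨_, (Steps.const _ _).cons ((Steps.arith _ _ _ _).cons (Steps.arith _ _ _ _)), ?_, ?_⟩
  · intro q hq hq'
    rw [Function.update_of_ne hq, Function.update_of_ne hq', Function.update_of_ne hq']
  · have h1 : L.nv ≠ r := by omega
    have h2 : b ≠ r := by omega
    have h3 := L.address_lt ha hi
    apply BitVec.eq_of_toNat_eq
    simp only [Op.eval, Function.update_self, Function.update_of_ne h1, Function.update_of_ne h2,
      BitVec.toNat_add, BitVec.toNat_mul, BitVec.toNat_ofNat, h.len, hρ, Nat.add_mod_mod,
      Nat.mod_mul_mod]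
    rw [Nat.add_comm]

/-- The auxiliary registers act as a stack. Evaluation into register `b` leaves all registers below
`b` alone, so a left operand survives in `b` while the right one is evaluated into `b + 1`. -/
theorem steps_code {s : Store} {μ : BitVec L.w → BitVec L.w} :
    ∀ (e : Ex) (b : ℕ) (ρ : ℕ → BitVec L.w), L.nv < b → Rep L s ρ μ → e.Ok L s →
      ∃ ρ', Steps (e.code L.nv b) ρ μ e.cost ρ' μ ∧ (∀ r < b, ρ' r = ρ r) ∧
        (ρ' b).toNat = e.eval s := by
  have bin : ∀ (o : Op) (e f : Ex) (val : ℕ),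
      (∀ (b : ℕ) (ρ : ℕ → BitVec L.w), L.nv < b → Rep L s ρ μ →
        ∃ ρ', Steps (e.code L.nv b) ρ μ e.cost ρ' μ ∧ (∀ r < b, ρ' r = ρ r) ∧
        (ρ' b).toNat = e.eval s) →
      (∀ (b : ℕ) (ρ : ℕ → BitVec L.w), L.nv < b → Rep L s ρ μ →
        ∃ ρ', Steps (f.code L.nv b) ρ μ f.cost ρ' μ ∧ (∀ r < b, ρ' r = ρ r) ∧
        (ρ' b).toNat = f.eval s) →
      (∀ x y : BitVec L.w, x.toNat = e.eval s → y.toNat = f.eval s → (o.eval x y).toNat = val) →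
      ∀ (b : ℕ) (ρ : ℕ → BitVec L.w), L.nv < b → Rep L s ρ μ →
        ∃ ρ', Steps (e.code L.nv b ++ (f.code L.nv (b + 1) ++ [.arith o b b (b + 1)])) ρ μ
          (e.cost + (f.cost + 1)) ρ' μ ∧ (∀ r < b, ρ' r = ρ r) ∧ (ρ' b).toNat = val := by
    intro o e f val he hf hval b ρ hb h
    obtain ⟨ρ₁, s₁, k₁, v₁⟩ := he b ρ hb h
    obtain ⟨ρ₂, s₂, k₂, v₂⟩ := hf (b + 1) ρ₁ (by omega) (h.congr fun r hr => k₁ r (by omega))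
    refine ⟨_, s₁.append (s₂.append (Steps.arith _ _ _ _)), ?_, ?_⟩
    · intro r hr
      rw [Function.update_of_ne (by omega), k₂ r (by omega), k₁ r hr]
    · rw [Function.update_self]
      exact hval _ _ (by rw [k₂ b (by omega), v₁]) v₂
  intro e
  induction e with
  | num v =>
    intro b ρ hb h ok
    refine ⟨_, Steps.const _ _, fun r hr => by rw [Function.update_of_ne (by omega)], ?_⟩
    rw [Function.update_self, BitVec.toNat_ofNat, Nat.mod_eq_of_lt ok, eval]
  | var x =>
    intro b ρ hb h ok
    have hx : x < L.nv := ok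
    refine ⟨_, (Steps.const _ _).cons (Steps.arith _ _ _ _), fun r hr => ?_, ?_⟩
    · rw [Function.update_of_ne (by omega), Function.update_of_ne (by omega)]
    · rw [Function.update_self, Function.update_self, Function.update_of_ne (by omega)]
      simp [Op.eval, eval, h.var x hx]
  | add e f he hf =>
    intro b ρ hb h ok
    refine bin .add e f _ (fun b ρ hb h => he b ρ hb h ok.1) (fun b ρ hb h => hf b ρ hb h ok.2.1)
      (fun x y hx hy => ?_) b ρ hb h
    rw [Op.eval, BitVec.toNat_add, hx, hy, Nat.mod_eq_of_lt ok.2.2, eval]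
  | sub e f he hf =>
    intro b ρ hb h ok
    refine bin .sub e f _ (fun b ρ hb h => he b ρ hb h ok.1) (fun b ρ hb h => hf b ρ hb h ok.2.1)
      (fun x y hx hy => ?_) b ρ hb h
    have h1 : y ≤ x := by rw [BitVec.le_def, hx, hy]; exact ok.2.2
    rw [Op.eval, BitVec.toNat_sub_of_le h1, hx, hy, eval]
  | mul e f he hf =>
    intro b ρ hb h ok
    refine bin .mul e f _ (fun b ρ hb h => he b ρ hb h ok.1) (fun b ρ hb h => hf b ρ hb h ok.2.1)
      (fun x y hx hy => ?_) b ρ hb h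
    rw [Op.eval, BitVec.toNat_mul, hx, hy, Nat.mod_eq_of_lt ok.2.2, eval]
  | div e f he hf =>
    intro b ρ hb h ok
    refine bin .div e f _ (fun b ρ hb h => he b ρ hb h ok.1) (fun b ρ hb h => hf b ρ hb h ok.2)
      (fun x y hx hy => ?_) b ρ hb h
    rw [Op.eval, BitVec.toNat_udiv, hx, hy, eval]
  | get a e he =>
    intro b ρ hb h ok
    obtain ⟨ρ₁, s₁, k₁, v₁⟩ := he b ρ hb h ok.1
    have h₁ := h.congr fun r hr => k₁ r (by omega)
    obtain ⟨ρ₂, s₂, k₂, v₂⟩ := steps_address h₁ hb (Nat.lt_succ_self b) ok.2.1 ok.2.2 v₁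
    refine ⟨_, s₁.append (s₂.append (Steps.load _ _)), fun r hr => ?_, ?_⟩
    · rw [Function.update_of_ne (by omega), k₂ r (by omega) (by omega), k₁ r hr]
    · rw [Function.update_self, v₂, h.cell a ok.2.1 _ ok.2.2, eval]

end Ex

/-! ## Commands -/

/-- A command is a piece of code that depends on the first free auxiliary register. -/
abbrev Cmd := ℕ → Program

/-- Total correctness with an exact step count: started in a representation of `s`, the command
halts after some number `t` of steps in a representation of some `s'` with `Q t s'`. -/
def Tri (L : Layout) (c : Cmd) (s : Store) (Q : ℕ → Store → Prop) : Prop :=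
  ∀ b, L.nv < b → ∀ (ρ : ℕ → BitVec L.w) (μ : BitVec L.w → BitVec L.w), Rep L s ρ μ →
    ∃ t s' ρ' μ', Steps (c b) ρ μ t ρ' μ' ∧ (∀ r, L.nv < r → r < b → ρ' r = ρ r) ∧
      Rep L s' ρ' μ' ∧ Q t s'

namespace Cmd

/-- No operation. -/
def skip : Cmd := fun _ => []

/-- Assignment to a variable. -/
def set (nv x : ℕ) (e : Ex) : Cmd := fun b =>
  e.code nv b ++ [.const (b + 1) 0, .arith .add x b (b + 1)]

/-- Assignment to an array cell. -/
def put (nv a : ℕ) (i e : Ex) : Cmd := fun b =>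
  i.code nv b ++ (e.code nv (b + 1) ++
    ([.const (b + 2) a, .arith .mul (b + 2) (b + 2) nv, .arith .add b b (b + 2)] ++
      [.store b (b + 1)]))

/-- Sequential composition. -/
def seq (c d : Cmd) : Cmd := fun b => c b ++ d b

/-- Branching on a comparison. -/
def ifLt (nv : ℕ) (e f : Ex) (c d : Cmd) : Cmd := fun b =>
  e.code nv b ++ (f.code nv (b + 1) ++ [.ite (.lt b (b + 1)) (c b) (d b)])

/-- The command `c` for each value of the variable `x` from `0` below the value of `e`. -/
def loop (nv x : ℕ) (e : Ex) (c : Cmd) : Cmd := fun b =>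
  e.code nv b ++ (.const (b + 1) 0 :: [.loop (.lt (b + 1) b)
    (.const (b + 2) 0 :: .arith .add x (b + 1) (b + 2) :: (c (b + 2) ++
      [.const (b + 2) 1, .arith .add (b + 1) (b + 1) (b + 2)]))])

end Cmd

namespace Tri

variable {s : Store} {c d : Cmd} {Q Q' : ℕ → Store → Prop}

theorem mono (h : Tri L c s Q) (hQ : ∀ t s', Q t s' → Q' t s') : Tri L c s Q' := by
  intro b hb ρ μ hr
  obtain ⟨t, s', ρ', μ', h1, h2, h3, h4⟩ := h b hb ρ μ hr
  exact ⟨t, s', ρ', μ', h1, h2, h3, hQ _ _ h4⟩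

theorem skip (h : Q 0 s) : Tri L Cmd.skip s Q := fun _ _ _ _ hr =>
  ⟨0, s, _, _, Steps.nil, fun _ _ _ => rfl, hr, h⟩

/-- There is no move instruction, so the value is copied by adding a register that holds zero; hence
the two extra steps. -/
theorem set {x : ℕ} {e : Ex} (hx : x < L.nv) (ok : e.Ok L s)
    (h : Q (e.cost + 2) (s.setV x (e.eval s))) : Tri L (Cmd.set L.nv x e) s Q := by
  intro b hb ρ μ hr
  obtain ⟨ρ₁, s₁, k₁, v₁⟩ := e.steps_code b ρ hb hr ok
  refine ⟨_, _, _, _, s₁.append ((Steps.const _ _).cons (Steps.arith _ _ _ _)), ?_, ?_, h⟩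
  · intro r hr1 hr2
    rw [Function.update_of_ne (by omega), Function.update_of_ne (by omega), k₁ r hr2]
  · refine hr.setV hx (fun r hr1 hr2 => ?_) ?_
    · rw [Function.update_of_ne hr2, Function.update_of_ne (by omega), k₁ r (by omega)]
    · rw [Function.update_self, Function.update_self, Function.update_of_ne (by omega)]
      simp [Op.eval, v₁]

theorem put {a : ℕ} {i e : Ex} (ha : a < L.K) (hi : i.eval s < L.B) (oki : i.Ok L s)
    (ok : e.Ok L s) (h : Q (i.cost + (e.cost + 4)) (s.setA a (i.eval s) (e.eval s))) :
    Tri L (Cmd.put L.nv a i e) s Q := by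
  intro b hb ρ μ hr
  obtain ⟨ρ₁, s₁, k₁, v₁⟩ := i.steps_code b ρ hb hr oki
  have hr₁ := hr.congr fun r hr => k₁ r (by omega)
  obtain ⟨ρ₂, s₂, k₂, v₂⟩ := e.steps_code (b + 1) ρ₁ (by omega) hr₁ ok
  have hr₂ := hr₁.congr fun r hr => k₂ r (by omega)
  obtain ⟨ρ₃, s₃, k₃, v₃⟩ := Ex.steps_address hr₂ hb (show b < b + 2 by omega) ha hi
    (by rw [k₂ b (by omega), v₁])
  refine ⟨_, _, _, _, s₁.append (s₂.append (s₃.append (Steps.store _ _))), ?_, ?_, h⟩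
  · intro r hr1 hr2
    rw [k₃ r (by omega) (by omega), k₂ r (by omega), k₁ r hr2]
  · rw [v₃]
    have hr₃ := hr₂.congr fun r hr => k₃ r (by omega) (by omega)
    exact hr₃.setA ha hi (by rw [k₃ _ (by omega) (by omega), v₂])

theorem seq (h : Tri L c s fun t s' => Tri L d s' fun t' s'' => Q (t + t') s'') :
    Tri L (Cmd.seq c d) s Q := by
  intro b hb ρ μ hr
  obtain ⟨t, s₁, ρ₁, μ₁, h1, h2, h3, h4⟩ := h b hb ρ μ hr
  obtain ⟨t', s₂, ρ₂, μ₂, g1, g2, g3, g4⟩ := h4 b hb ρ₁ μ₁ h3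
  exact ⟨_, s₂, ρ₂, μ₂, h1.append g1, fun r hr1 hr2 => by rw [g2 r hr1 hr2, h2 r hr1 hr2], g3, g4⟩

theorem ifLt {e f : Ex} (oke : e.Ok L s) (okf : f.Ok L s)
    (ht : e.eval s < f.eval s → Tri L c s fun t s' => Q (e.cost + (f.cost + (t + 1))) s')
    (hf : ¬ e.eval s < f.eval s → Tri L d s fun t s' => Q (e.cost + (f.cost + (t + 1))) s') :
    Tri L (Cmd.ifLt L.nv e f c d) s Q := by
  intro b hb ρ μ hr
  obtain ⟨ρ₁, s₁, k₁, v₁⟩ := e.steps_code b ρ hb hr oke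
  have hr₁ := hr.congr fun r hr => k₁ r (by omega)
  obtain ⟨ρ₂, s₂, k₂, v₂⟩ := f.steps_code (b + 1) ρ₁ (by omega) hr₁ okf
  have hr₂ := hr₁.congr fun r hr => k₂ r (by omega)
  have hv : (ρ₂ b).toNat = e.eval s := by rw [k₂ b (by omega), v₁]
  have key : Tri L (if (Test.lt b (b + 1)).eval ρ₂ then c else d) s
      fun t s' => Q (e.cost + (f.cost + (t + 1))) s' := by
    simp only [Test.eval, hv, v₂, decide_eq_true_eq]
    split_ifs with h
    exacts [ht h, hf h]
  obtain ⟨t, s', ρ₃, μ₃, h1, h2, h3, h4⟩ := key b hb ρ₂ μ hr₂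
  refine ⟨_, s', ρ₃, μ₃, s₁.append (s₂.append (Steps.ite (t := t) ?_)), ?_, h3, h4⟩
  · split_ifs at h1 ⊢ <;> exact h1
  · intro r hr1 hr2
    rw [h2 r hr1 hr2, k₂ r (by omega), k₁ r hr2]

/-- The rule for loops; the invariant depends on the number of iterations and of steps so far. -/
theorem loop {x : ℕ} {e : Ex} (Inv : ℕ → ℕ → Store → Prop) (hx : x < L.nv) (ok : e.Ok L s)
    (h0 : Inv 0 0 s)
    (hstep : ∀ i < e.eval s, ∀ t s', Inv i t s' →
      Tri L c (s'.setV x i) fun t' s'' => Inv (i + 1) (t + t' + 5) s'')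
    (hQ : ∀ t s', Inv (e.eval s) t s' → Q (e.cost + 2 + t) s') :
    Tri L (Cmd.loop L.nv x e c) s Q := by
  intro b hb ρ μ hr
  have hlt := e.eval_lt hr ok
  obtain ⟨ρ₁, s₁, k₁, v₁⟩ := e.steps_code b ρ hb hr ok
  have hr₁ := hr.congr fun r hr => k₁ r (by omega)
  set N := e.eval s with hN
  set body : Program := .const (b + 2) 0 :: .arith .add x (b + 1) (b + 2) :: (c (b + 2) ++
      [.const (b + 2) 1, .arith .add (b + 1) (b + 1) (b + 2)]) with hbody
  -- Induction on the number `j` of remaining iterations. Bound and counter live in `b` and `b + 1`,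
  -- which the body, started at `b + 2`, cannot touch; `x` is only a copy of the counter. The test
  -- and the four instructions around the body are the 5 steps per round in the invariant.
  have main : ∀ j i, i + j = N → ∀ t s' (ρ' : ℕ → BitVec L.w) μ', Inv i t s' → Rep L s' ρ' μ' →
      (ρ' b).toNat = N → (ρ' (b + 1)).toNat = i →
      ∃ t' s'' ρ'' μ'', Steps [.loop (.lt (b + 1) b) body] ρ' μ' (t' + 1) ρ'' μ'' ∧
        (∀ r, L.nv < r → r < b → ρ'' r = ρ' r) ∧ Rep L s'' ρ'' μ'' ∧ Inv N (t + t') s'' := by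
    intro j
    induction j with
    | zero =>
      intro i hi t s' ρ' μ' hI hR hbN hbi
      refine ⟨0, s', ρ', μ', Steps.loop_done ?_, fun _ _ _ => rfl, hR, ?_⟩
      · simp [Test.eval, hbN, hbi, ← hi]
      · rw [← hi]; exact hI
    | succ j ih =>
      intro i hi t s' ρ' μ' hI hR hbN hbi
      have hcond : (Test.lt (b + 1) b).eval ρ' = true := by
        simp only [Test.eval, hbN, hbi, decide_eq_true_eq]; omega
      let ρ₂ := Function.update (Function.update ρ' (b + 2) (BitVec.ofNat L.w 0)) x
        (Op.add.eval (Function.update ρ' (b + 2) (BitVec.ofNat L.w 0) (b + 1))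
          (Function.update ρ' (b + 2) (BitVec.ofNat L.w 0) (b + 2)))
      have e₂ : Steps [.const (b + 2) 0, .arith .add x (b + 1) (b + 2)] ρ' μ' 2 ρ₂ μ' :=
        (Steps.const _ _).cons (Steps.arith _ _ _ _)
      have hR₂ : Rep L (s'.setV x i) ρ₂ μ' := by
        refine hR.setV hx (fun r hr1 hr2 => ?_) ?_
        · simp only [ρ₂]
          rw [Function.update_of_ne hr2, Function.update_of_ne (by omega)]
        · simp only [ρ₂]
          rw [Function.update_self, Function.update_self, Function.update_of_ne (by omega)]
          simp [Op.eval, hbi]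
      obtain ⟨t₁, s₃, ρ₃, μ₃, a1, a2, a3, a4⟩ :=
        hstep i (by omega) t s' hI (b + 2) (by omega) ρ₂ μ' hR₂
      let ρ₄ := Function.update (Function.update ρ₃ (b + 2) (BitVec.ofNat L.w 1)) (b + 1)
        (Op.add.eval (Function.update ρ₃ (b + 2) (BitVec.ofNat L.w 1) (b + 1))
          (Function.update ρ₃ (b + 2) (BitVec.ofNat L.w 1) (b + 2)))
      have e₄ : Steps [.const (b + 2) 1, .arith .add (b + 1) (b + 1) (b + 2)] ρ₃ μ₃ 2 ρ₄ μ₃ :=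
        (Steps.const _ _).cons (Steps.arith _ _ _ _)
      have hR₄ : Rep L s₃ ρ₄ μ₃ := a3.congr fun r hr => by
        simp only [ρ₄]
        rw [Function.update_of_ne (by omega), Function.update_of_ne (by omega)]
      have f₃ : ∀ r, L.nv < r → r < b + 2 → ρ₃ r = ρ' r := by
        intro r hr1 hr2
        rw [a2 r hr1 hr2]
        simp only [ρ₂]
        rw [Function.update_of_ne (by omega), Function.update_of_ne (by omega)]
      have hb4 : (ρ₄ b).toNat = N := by
        simp only [ρ₄]
        rw [Function.update_of_ne (by omega), Function.update_of_ne (by omega), f₃ b hb (by omega),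
          hbN]
      have hb4' : (ρ₄ (b + 1)).toNat = i + 1 := by
        simp only [ρ₄]
        rw [Function.update_self, Function.update_self, Function.update_of_ne (by omega),
          f₃ (b + 1) (by omega) (by omega)]
        rw [Op.eval, BitVec.toNat_add, hbi, BitVec.toNat_ofNat, Nat.mod_eq_of_lt L.one_lt,
          Nat.mod_eq_of_lt (by omega)]
      obtain ⟨t', s₅, ρ₅, μ₅, b1, b2, b3, b4⟩ := ih (i + 1) (by omega) _ s₃ ρ₄ μ₃ a4 hR₄ hb4 hb4'
      refine ⟨2 + (t₁ + 2) + (t' + 1), s₅, ρ₅, μ₅, ?_, ?_, b3, ?_⟩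
      · exact Steps.loop_next hcond (e₂.append (a1.append e₄)) b1
      · intro r hr1 hr2
        rw [b2 r hr1 hr2]
        simp only [ρ₄]
        rw [Function.update_of_ne (by omega), Function.update_of_ne (by omega),
          f₃ r hr1 (by omega)]
      · have : t + (2 + (t₁ + 2) + (t' + 1)) = t + t₁ + 5 + t' := by omega
        rw [this]; exact b4
  have e₀ := Steps.const (ρ := ρ₁) (μ := μ) (b + 1) 0
  obtain ⟨t', s', ρ', μ', c1, c2, c3, c4⟩ := main N 0 (by omega) 0 s
    (Function.update ρ₁ (b + 1) (BitVec.ofNat L.w 0)) μ h0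
    (hr₁.congr fun r hr => by rw [Function.update_of_ne (by omega)])
    (by rw [Function.update_of_ne (by omega), v₁]) (by simp)
  refine ⟨_, s', ρ', μ', s₁.append (e₀.cons c1), ?_, c3, ?_⟩
  · intro r hr1 hr2
    rw [c2 r hr1 hr2, Function.update_of_ne (by omega), k₁ r hr2]
  · have h := hQ _ _ c4
    rw [Nat.zero_add] at h
    have : e.cost + (1 + (t' + 1)) = e.cost + 2 + t' := by omega
    rw [this]; exact h

end Tri

end WordRAM

namespace WordRAM

variable {L : Layout} {n : ℕ}

/-! ## Lists of vertices stored in two-dimensional arrays -/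

/-- The layout has room for the variables and the arrays used on graphs with `n` vertices. -/
structure Room (L : Layout) (n : ℕ) : Prop where
  sq_le : (n + 1) * (n + 1) ≤ L.B
  arrays : 14 ≤ L.K
  vars : 50 ≤ L.nv
  word : 16 ≤ 2 ^ L.w

/-- The index of the pair of the values of `e` and `f`. -/
def Ex.pair (e f : Ex) : Ex := .add e (.mul (.var 1) f)

theorem Room.lt_len (hL : Room L n) {i : ℕ} (hi : i ≤ n) : i < L.B := by
  have := hL.sq_le; nlinarith

theorem Room.pair_lt (hL : Room L n) {i j : ℕ} (hi : i ≤ n) (hj : j ≤ n) :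
    i + (n + 1) * j < L.B := by
  have := hL.sq_le; nlinarith

theorem Ex.pair_ok (hL : Room L n) {s : Store} {e f : Ex} (h1 : s.v 1 = n + 1) (he : e.Ok L s)
    (hf : f.Ok L s) (hen : e.eval s ≤ n) (hfn : f.eval s ≤ n) : (e.pair f).Ok L s := by
  have h := hL.pair_lt hen hfn
  have h2 := L.len_lt
  have h3 := hL.vars
  refine ⟨he, ⟨?_, hf, ?_⟩, ?_⟩
  · show 1 < L.nv; omega
  · simp only [Ex.eval, h1]; omega
  · simp only [Ex.eval, h1]; omega

theorem Ex.pair_eval {s : Store} {e f : Ex} (h1 : s.v 1 = n + 1) :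
    (e.pair f).eval s = e.eval s + (n + 1) * f.eval s := by
  simp only [Ex.pair, Ex.eval, h1]

theorem pair_inj {M i j i' j' : ℕ} (hi : i < M) (hi' : i' < M) (h : i + M * j = i' + M * j') :
    i = i' ∧ j = j' := by
  have h1 : i = i' := by
    have := congrArg (· % M) h
    simpa [Nat.add_mul_mod_self_left, Nat.mod_eq_of_lt hi, Nat.mod_eq_of_lt hi'] using this
  subst h1
  have h2 : M * j = M * j' := by omega
  exact ⟨rfl, Nat.eq_of_mul_eq_mul_left (by omega) h2⟩

/-- Row `u` of the arrays `A` (entries) and `C` (lengths) holds the list `l`. -/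
def ListAt (M : ℕ) (A C : ℕ → ℕ) (u : ℕ) (l : List (Fin n)) : Prop :=
  C u = l.length ∧ ∀ j (hj : j < l.length), A (u + M * j) = (l[j] : ℕ)

theorem ListAt.congr {M : ℕ} {A C A' C' : ℕ → ℕ} {u : ℕ} {l : List (Fin n)}
    (h : ListAt M A C u l) (hA : A' = A) (hC : C' = C) : ListAt M A' C' u l := by
  subst hA hC; exact h

namespace Cmd

/-- Append the value of `e` to row `u` of the lists in `A` and `C`. -/
def push (nv A C : ℕ) (u e : Ex) : Cmd :=
  seq (put nv A (u.pair (.get C u)) e) (put nv C u (.add (.get C u) (.num 1)))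

end Cmd

/-- The number of steps of `push`. -/
def pushCost (u e : Ex) : ℕ := 4 * u.cost + e.cost + 25

/-- Rows interleave with stride `n + 1`, so by `pair_inj` a write to one row leaves every other row
intact. The hypothesis `hu` speaks of all stores with the same variables because `u` is evaluated
again after the first write. -/
theorem Tri.push (hL : Room L n) {s : Store} {A C a : ℕ} {u e : Ex} {l : List (Fin n)}
    {Q : ℕ → Store → Prop}
    (h1 : s.v 1 = n + 1) (hAC : A ≠ C) (hA : A < L.K) (hC : C < L.K) (ha : a ≤ n)
    (hl : l.length ≤ n) (hu : ∀ s' : Store, s'.v = s.v → u.Ok L s' ∧ u.eval s' = a)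
    (ok : e.Ok L s) {y : Fin n} (hy : e.eval s = y) (hs : ListAt (n + 1) (s.a A) (s.a C) a l)
    (hQ : ∀ t s', t ≤ pushCost u e → s'.v = s.v → (∀ b, b ≠ A → b ≠ C → s'.a b = s.a b) →
      ListAt (n + 1) (s'.a A) (s'.a C) a (l ++ [y]) →
      (∀ b ≤ n, b ≠ a → ∀ l' : List (Fin n), ListAt (n + 1) (s.a A) (s.a C) b l' →
        ListAt (n + 1) (s'.a A) (s'.a C) b l') → Q t s') :
    Tri L (Cmd.push L.nv A C u e) s Q := by
  obtain ⟨hu1, hu2⟩ := hu s rfl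
  have hlB := L.len_lt
  have ok1 : (Ex.get C u).Ok L s := ⟨hu1, hC, by rw [hu2]; exact hL.lt_len ha⟩
  have ev1 : (Ex.get C u).eval s = l.length := by rw [Ex.eval, hu2, hs.1]
  have evp : (u.pair (.get C u)).eval s = a + (n + 1) * l.length := by
    rw [Ex.pair_eval h1, ev1, hu2]
  refine Tri.seq (Tri.put hA ?_ ?_ ok ?_)
  · rw [evp]; exact hL.pair_lt ha hl
  · exact Ex.pair_ok hL h1 hu1 ok1 (by omega) (by omega)
  rw [evp, hy]
  set s₁ := s.setA A (a + (n + 1) * l.length) y with hs₁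
  obtain ⟨hu1', hu2'⟩ := hu s₁ rfl
  have hC1 : s₁.a C = s.a C := Store.setA_a_of_ne _ _ _ hAC.symm
  have ev2 : (Ex.get C u).eval s₁ = l.length := by rw [Ex.eval, hu2', hC1, hs.1]
  refine Tri.put hC (by rw [hu2']; exact hL.lt_len ha) hu1' ⟨⟨hu1', hC, ?_⟩, ?_, ?_⟩ ?_
  · rw [hu2']; exact hL.lt_len ha
  · show 1 < _; have := hL.word; omega
  · rw [ev2]; have := hL.lt_len (Nat.le_refl n); simp only [Ex.eval]; omega
  have evl : (Ex.add (.get C u) (.num 1)).eval s₁ = l.length + 1 := by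
    rw [Ex.eval, ev2, Ex.eval]
  rw [hu2', evl]
  have eC : (s₁.setA C a (l.length + 1)).a C = Function.update (s.a C) a (l.length + 1) := by
    rw [Store.setA_a_self, hC1]
  have eA : (s₁.setA C a (l.length + 1)).a A =
      Function.update (s.a A) (a + (n + 1) * l.length) y := by
    rw [Store.setA_a_of_ne _ _ _ hAC, Store.setA_a_self]
  refine hQ _ _ ?_ rfl ?_ ?_ ?_
  · simp only [Ex.pair, Ex.cost, pushCost]; omega
  · intro b hbA hbC
    rw [Store.setA_a_of_ne _ _ _ hbC, Store.setA_a_of_ne _ _ _ hbA]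
  · rw [eC, eA]
    refine ⟨by simp, fun j hj => ?_⟩
    rw [List.length_append, List.length_singleton] at hj
    by_cases hjl : j = l.length
    · subst hjl; simp
    · rw [Function.update_of_ne, hs.2 j (by omega), List.getElem_append_left]
      intro h
      exact hjl (pair_inj (by omega) (by omega) h).2
  · intro b hb hba l' hl'
    rw [eC, eA]
    refine ⟨by rw [Function.update_of_ne hba, hl'.1], fun j hj => ?_⟩
    rw [Function.update_of_ne, hl'.2 j hj]
    intro h
    exact hba (pair_inj (by omega) (by omega) h).1

/-! ## Adjacency lists -/

/-- The neighbours of `u` in the order of the list of edges. -/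
def neighborList (es : List (Fin n × Fin n)) (u : Fin n) : List (Fin n) :=
  es.flatMap fun e => (if u = e.1 then [e.2] else []) ++ (if u = e.2 then [e.1] else [])

theorem mem_neighborList {es : List (Fin n × Fin n)} {u v : Fin n} :
    v ∈ neighborList es u ↔ s(u, v) ∈ es.map fun p => s(p.1, p.2) := by
  simp only [neighborList, List.mem_flatMap, List.mem_append, List.mem_map, Sym2.eq_iff]
  refine exists_congr fun e => and_congr_right fun _ => ?_
  constructor
  · rintro (h | h) <;> split_ifs at h with h' <;> simp_all
  · rintro (⟨rfl, rfl⟩ | ⟨rfl, rfl⟩) <;> simp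

/-- A neighbour that occurs twice would come from an edge that is listed twice or from a loop. -/
theorem nodup_neighborList (u : Fin n) : ∀ {es : List (Fin n × Fin n)},
    (es.map fun p => s(p.1, p.2)).Nodup → (∀ e ∈ es, e.1 ≠ e.2) → (neighborList es u).Nodup
  | [], _, _ => List.nodup_nil
  | e :: es, h, hne => by
    rw [List.map_cons, List.nodup_cons] at h
    have ih := nodup_neighborList u h.2 fun e he => hne e (List.mem_cons_of_mem _ he)
    have he := hne e List.mem_cons_self
    rw [neighborList, List.flatMap_cons, ← neighborList]
    by_cases h1 : u = e.1
    · subst h1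
      rw [if_pos rfl, if_neg he, List.append_nil, List.singleton_append, List.nodup_cons,
        mem_neighborList]
      exact ⟨h.1, ih⟩
    · by_cases h2 : u = e.2
      · subst h2
        rw [if_neg h1, if_pos rfl, List.nil_append, List.singleton_append, List.nodup_cons,
          mem_neighborList, Sym2.eq_swap]
        exact ⟨h.1, ih⟩
      · simpa [h1, h2] using ih

namespace Cmd

/-- Build the adjacency lists in arrays `1` and `2` from the list of edges in array `0`. -/
def adjacency (nv : ℕ) : Cmd :=
  loop nv 3 (.var 2)
    (seq (set nv 4 (.get 0 (.add (.num 2) (.mul (.num 2) (.var 3)))))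
    (seq (set nv 5 (.get 0 (.add (.num 3) (.mul (.num 2) (.var 3)))))
    (seq (push nv 1 2 (.var 4) (.var 5)) (push nv 1 2 (.var 5) (.var 4)))))

end Cmd

theorem getD_flatMap_pair {α : Type*} (f g : α → ℕ) : ∀ (l : List α) (i : ℕ) (hi : i < l.length),
    (l.flatMap fun p => [f p, g p]).getD (2 * i) 0 = f l[i] ∧
    (l.flatMap fun p => [f p, g p]).getD (2 * i + 1) 0 = g l[i]
  | [], i, hi => by simp at hi
  | a :: l, 0, _ => by simp
  | a :: l, i + 1, hi => by
    have := getD_flatMap_pair f g l i (by simpa using hi)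
    simp only [List.flatMap_cons, List.getElem_cons_succ]
    have e1 : 2 * (i + 1) = 2 * i + 1 + 1 := by omega
    rw [e1]
    simpa using this

theorem Tri.adjacency (hL : Room L n) {s : Store} {es : List (Fin n × Fin n)}
    {Q : ℕ → Store → Prop} (hnd : (es.map fun p => s(p.1, p.2)).Nodup)
    (hne : ∀ e ∈ es, e.1 ≠ e.2) (h1 : s.v 1 = n + 1) (h2 : s.v 2 = es.length)
    (hlen : 2 * es.length + 2 ≤ L.B) (hin : ∀ i < L.B,
      s.a 0 i = (SubgraphCounting.encode n es).getD i 0)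
    (hz : ∀ a, 1 ≤ a → s.a a = 0)
    (hQ : ∀ t s', t ≤ 120 * es.length + 4 → s'.v 0 = s.v 0 → s'.v 1 = s.v 1 → s'.v 2 = s.v 2 →
      (∀ a, 3 ≤ a → s'.a a = 0) →
      (∀ u : Fin n, ListAt (n + 1) (s'.a 1) (s'.a 2) u (neighborList es u)) → Q t s') :
    Tri L (Cmd.adjacency L.nv) s Q := by
  have hK := hL.arrays
  have hnv := hL.vars
  have hw := hL.word
  have hBw := L.len_lt
  -- The lists under construction never exceed their rows, because they are free of duplicates.
  have hln : ∀ (i : ℕ) (u : Fin n), (neighborList (es.take i) u).length ≤ n := by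
    intro i u
    have h := nodup_neighborList u (es := es.take i)
      ((List.Sublist.map _ (List.take_sublist i es)).nodup hnd)
      fun e he => hne e (List.mem_of_mem_take he)
    simpa using h.length_le_card
  refine Tri.loop (fun i t s' => t ≤ 120 * i ∧ s'.v 0 = s.v 0 ∧ s'.v 1 = s.v 1 ∧
    s'.v 2 = s.v 2 ∧ s'.a 0 = s.a 0 ∧ (∀ a, 3 ≤ a → s'.a a = 0) ∧
    ∀ u : Fin n, ListAt (n + 1) (s'.a 1) (s'.a 2) u (neighborList (es.take i) u))
    (by omega) (show 2 < L.nv by omega) ?_ ?_ ?_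
  · refine ⟨le_rfl, rfl, rfl, rfl, rfl, fun a ha => hz a (by omega), fun u => ?_⟩
    rw [hz 1 (by omega), hz 2 (by omega)]
    simp [neighborList, ListAt]
  · intro i hi t s' ⟨ht, e0, e1, e2, ea0, ha, hlist⟩
    have hi' : i < es.length := by rw [← h2]; exact hi
    set e := es[i] with he
    have hmem : e ∈ es := List.getElem_mem hi'
    have hen := hne e hmem
    -- The offsets 2 and 3 skip the two leading numbers of the encoding.
    have henc1 : (SubgraphCounting.encode n es).getD (2 + 2 * i) 0 = e.1 := by
      have := (getD_flatMap_pair (fun p : Fin n × Fin n => (p.1 : ℕ)) (fun p => (p.2 : ℕ)) es i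
        hi').1
      rw [Nat.add_comm, SubgraphCounting.encode]; simpa using this
    have henc2 : (SubgraphCounting.encode n es).getD (3 + 2 * i) 0 = e.2 := by
      have := (getD_flatMap_pair (fun p : Fin n × Fin n => (p.1 : ℕ)) (fun p => (p.2 : ℕ)) es i
        hi').2
      have e3 : 3 + 2 * i = 2 * i + 1 + 1 + 1 := by omega
      rw [e3, SubgraphCounting.encode]; simpa using this
    refine Tri.seq (Tri.set (by omega) ?_ (Tri.seq (Tri.set (by omega) ?_ ?_)))
    · simp only [Ex.Ok, Ex.eval, Store.setV_v_self]; omega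
    · simp only [Ex.Ok, Ex.eval, Store.setV_v_of_ne _ _ (show 3 ≠ 4 by decide),
        Store.setV_v_self]; omega
    set s₂ := ((s'.setV 3 i).setV 4 ((Ex.get 0 (.add (.num 2) (.mul (.num 2) (.var 3)))).eval
      (s'.setV 3 i))) with hs₂
    have v4 : s₂.v 4 = e.1 := by
      rw [hs₂, Store.setV_v_self]
      simp only [Ex.eval, Store.setV_v_self, Store.setV_a, ea0]
      rw [hin _ (by omega), henc1]
    set s₃ := s₂.setV 5 ((Ex.get 0 (.add (.num 3) (.mul (.num 2) (.var 3)))).eval s₂) with hs₃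
    have w3 : s₂.v 3 = i := by
      rw [hs₂, Store.setV_v_of_ne _ _ (by decide), Store.setV_v_self]
    have v5 : s₃.v 5 = e.2 := by
      rw [hs₃, Store.setV_v_self]
      simp only [Ex.eval, w3]
      rw [show s₂.a 0 = s.a 0 from ea0, hin _ (by omega), henc2]
    have v4' : s₃.v 4 = e.1 := by rw [hs₃, Store.setV_v_of_ne _ _ (by decide), v4]
    have vlow : ∀ x < 3, s₃.v x = s'.v x := by
      intro x hx
      rw [hs₃, hs₂, Store.setV_v_of_ne _ _ (by omega), Store.setV_v_of_ne _ _ (by omega),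
        Store.setV_v_of_ne _ _ (by omega)]
    have hl3 : ∀ u : Fin n, ListAt (n + 1) (s₃.a 1) (s₃.a 2) u (neighborList (es.take i) u) := hlist
    refine Tri.seq (Tri.push hL (a := e.1) (l := neighborList (es.take i) e.1) (y := e.2)
      (by rw [vlow 1 (by omega), e1, h1]) (by decide) (by omega) (by omega) (by omega) (hln _ _)
      (fun st hst => ⟨show 4 < L.nv by omega, by rw [Ex.eval, hst, v4']⟩) (show 5 < L.nv by omega)
      (by rw [Ex.eval, v5]) (hl3 _) ?_)
    intro t₁ s₄ ht₁ hv₄ ha₄ hl₄ hl₄'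
    refine Tri.push hL (a := e.2) (l := neighborList (es.take i) e.2) (y := e.1)
      (by rw [hv₄, vlow 1 (by omega), e1, h1]) (by decide) (by omega) (by omega) (by omega)
      (hln _ _)
      (fun st hst => ⟨show 5 < L.nv by omega, by rw [Ex.eval, hst, hv₄, v5]⟩)
      (show 4 < L.nv by omega) (by rw [Ex.eval, hv₄, v4'])
      (hl₄' _ (by omega) (fun h => hen (Fin.ext h.symm)) _ (hl3 _)) ?_
    intro t₂ s₅ ht₂ hv₅ ha₅ hl₅ hl₅'
    refine ⟨?_, ?_, ?_, ?_, ?_, ?_, ?_⟩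
    · simp only [pushCost, Ex.cost] at ht₁ ht₂ ⊢; omega
    · rw [hv₅, hv₄, vlow 0 (by omega), e0]
    · rw [hv₅, hv₄, vlow 1 (by omega), e1]
    · rw [hv₅, hv₄, vlow 2 (by omega), e2]
    · rw [ha₅ 0 (by decide) (by decide), ha₄ 0 (by decide) (by decide)]; exact ea0
    · intro a ha'
      rw [ha₅ a (by omega) (by omega), ha₄ a (by omega) (by omega)]
      exact ha a ha'
    · intro u
      have hsplit : neighborList (es.take (i + 1)) u = neighborList (es.take i) u ++
          ((if u = e.1 then [e.2] else []) ++ (if u = e.2 then [e.1] else [])) := by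
        rw [List.take_add_one, List.getElem?_eq_getElem hi', neighborList, List.flatMap_append]
        simp [neighborList, he]
      rw [hsplit]
      by_cases hu1 : u = e.1
      · subst hu1
        rw [if_pos rfl, if_neg hen, List.append_nil]
        exact hl₅' _ (by omega) (fun h => hen (Fin.ext h)) _ hl₄
      · by_cases hu2 : u = e.2
        · subst hu2
          rw [if_neg hu1, if_pos rfl, List.nil_append]
          exact hl₅
        · rw [if_neg hu1, if_neg hu2, List.append_nil, List.append_nil]
          exact hl₅' _ (by omega) (fun h => hu2 (Fin.ext h)) _
            (hl₄' _ (by omega) (fun h => hu1 (Fin.ext h)) _ (hl3 _))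
  · intro t s' ⟨ht, e0, e1, e2, ea0, ha, hlist⟩
    rw [Ex.eval, h2] at ht hlist
    rw [List.take_length] at hlist
    exact hQ _ _ (by rw [Ex.cost]; omega) e0 e1 e2 ha hlist

end WordRAM

namespace WordRAM

variable {L : Layout} {n : ℕ}

/-! ## Peeling off vertices of small degree -/

/-- The store during the peeling: `Q` is the queue of vertices, `D` the set of the processed ones,
`dn` counts processed neighbours, `out` collects the out-neighbours. -/
structure PeelRep (nb : Fin n → List (Fin n)) (s : Store) (Q : List (Fin n)) (D : Finset (Fin n))
    (dn : Fin n → ℕ) (out : Fin n → List (Fin n)) : Prop where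
  v0 : s.v 0 = n
  v1 : s.v 1 = n + 1
  adj : ∀ u : Fin n, ListAt (n + 1) (s.a 1) (s.a 2) u (nb u)
  queue : ListAt (n + 1) (s.a 3) (s.a 4) 0 Q
  queued : ∀ u : Fin n, s.a 5 u = if u ∈ Q then 1 else 0
  done : ∀ u : Fin n, s.a 6 u = if u ∈ D then 1 else 0
  seen : ∀ u : Fin n, s.a 7 u = dn u
  outs : ∀ u : Fin n, ListAt (n + 1) (s.a 8) (s.a 9) u (out u)
  mat : ∀ u v : Fin n, s.a 10 (u + (n + 1) * v) = if v ∈ out u then 1 else 0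
  rest : ∀ a, 11 ≤ a → s.a a = 0

theorem PeelRep.congr {nb : Fin n → List (Fin n)} {s s' : Store} {Q : List (Fin n)}
    {D : Finset (Fin n)} {dn : Fin n → ℕ} {out : Fin n → List (Fin n)}
    (h : PeelRep nb s Q D dn out) (h0 : s'.v 0 = s.v 0) (h1 : s'.v 1 = s.v 1) (ha : s'.a = s.a) :
    PeelRep nb s' Q D dn out := by
  obtain ⟨a0, a1, a2, a3, a4, a5, a6, a7, a8, a9⟩ := h
  constructor <;> simpa only [ha, h0, h1]

namespace Cmd

/-- Enqueue the vertex in variable `5` if it is not queued and has at most as many unprocessed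
neighbours as the value of variable `6`. -/
def tryEnqueue (nv : ℕ) : Cmd :=
  ifLt nv (.get 5 (.var 5)) (.num 1)
    (ifLt nv (.get 2 (.var 5)) (.add (.add (.get 7 (.var 5)) (.var 6)) (.num 1))
      (seq (push nv 3 4 (.num 0) (.var 5)) (put nv 5 (.var 5) (.num 1))) skip) skip

/-- Handle the vertex in variable `4`. -/
def process (nv : ℕ) : Cmd :=
  seq (put nv 6 (.var 4) (.num 1)) (loop nv 8 (.get 2 (.var 4))
    (seq (set nv 5 (.get 1 (.pair (.var 4) (.var 8))))
    (seq (ifLt nv (.get 6 (.var 5)) (.num 1)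
      (seq (push nv 8 9 (.var 4) (.var 5)) (put nv 10 (.pair (.var 4) (.var 5)) (.num 1))) skip)
    (seq (put nv 7 (.var 5) (.add (.get 7 (.var 5)) (.num 1))) (tryEnqueue nv)))))

/-- Handle all queued vertices, including those queued meanwhile. -/
def drain (nv : ℕ) : Cmd :=
  loop nv 7 (.var 0) (ifLt nv (.var 7) (.get 4 (.num 0))
    (seq (set nv 4 (.get 3 (.pair (.num 0) (.var 7))))
      (ifLt nv (.get 6 (.var 4)) (.num 1) (process nv) skip)) skip)

/-- Try to enqueue each vertex. -/
def scan (nv : ℕ) : Cmd := loop nv 7 (.var 0) (seq (set nv 5 (.var 7)) (tryEnqueue nv))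

/-- Peel off the vertices with increasing thresholds for the degree. -/
def peel (nv : ℕ) : Cmd :=
  loop nv 6 (.var 0) (ifLt nv (.get 4 (.num 0)) (.var 0) (seq (scan nv) (drain nv)) skip)

end Cmd

section
variable {nb : Fin n → List (Fin n)} {s : Store} {Q : List (Fin n)} {D : Finset (Fin n)}
  {dn : Fin n → ℕ} {out : Fin n → List (Fin n)} {R : ℕ → Store → Prop}

/-- The tests amount to `deg u ≤ dn u + d`, that is, at most `d` unprocessed neighbours; the
additive form avoids subtraction. The bound `n + 1` on `dn` leaves room for a counter that has been
increased in the middle of `process`. -/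
theorem Tri.tryEnqueue (hL : Room L n) (h : PeelRep nb s Q D dn out) {u : Fin n} {d : ℕ}
    (hu : s.v 5 = u) (hd : s.v 6 = d) (hdn : d ≤ n) (hdnn : ∀ w, dn w ≤ n + 1) (hnd : Q.Nodup)
    (hR : ∀ t s' Q', t ≤ 100 → s'.v = s.v → PeelRep nb s' Q' D dn out → Q <+: Q' → Q'.Nodup →
      (∀ w ∈ Q', w ∈ Q ∨ (nb w).length ≤ dn w + d) → (u ∉ Q' → dn u + d < (nb u).length) →
      R t s') :
    Tri L (Cmd.tryEnqueue L.nv) s R := by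
  have hK := hL.arrays
  have hnv := hL.vars
  have hw := hL.word
  have hBw := L.len_lt
  have hsq := hL.sq_le
  have hun := u.isLt
  have huB := hL.lt_len hun.le
  have h2n : 2 * n + 2 < 2 ^ L.w := by nlinarith
  have hok5 : (Ex.var 5).Ok L s := show 5 < L.nv by omega
  have hev : (Ex.var 5).eval s = u := hu
  have okg : ∀ a, a < L.K → (Ex.get a (.var 5)).Ok L s := fun a ha => ⟨hok5, ha, by rwa [hev]⟩
  have evg : ∀ a, (Ex.get a (.var 5)).eval s = s.a a u := fun a => by rw [Ex.eval, hev]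
  have hone : (Ex.num 1).Ok L s := show 1 < _ by omega
  have hdu := hdnn u
  have ev7 : (Ex.add (.add (.get 7 (.var 5)) (.var 6)) (.num 1)).eval s = dn u + d + 1 := by
    simp only [Ex.eval, hu, hd, h.seen]
  refine Tri.ifLt (okg 5 (by omega)) hone ?_ ?_
  · intro hq
    rw [evg, h.queued, Ex.eval] at hq
    have hq' : u ∉ Q := by intro hmem; simp [hmem] at hq
    refine Tri.ifLt (okg 2 (by omega)) ⟨⟨okg 7 (by omega), show 6 < L.nv by omega, ?_⟩, hone, ?_⟩
      ?_ ?_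
    · rw [evg, h.seen, Ex.eval, hd]; omega
    -- `Ex.eval.eq_3` is the equation for `add`; read backwards it restores the form to which `ev7`
    -- applies.
    · rw [← Ex.eval.eq_3, ev7]; omega
    · intro hlt
      rw [evg, (h.adj u).1, ev7] at hlt
      have hql : Q.length ≤ n := by simpa using hnd.length_le_card
      refine Tri.seq (Tri.push hL (a := 0) (l := Q) (y := u) h.v1 (by decide) (by omega) (by omega)
        (by omega) hql (fun _ _ => ⟨show 0 < 2 ^ L.w by omega, rfl⟩) hok5 hev h.queue ?_)
      intro t s' ht hv ha hl _
      refine Tri.put (by omega) (by rw [Ex.eval, hv, hu]; exact huB) hok5 hone ?_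
      have e5 : (Ex.var 5).eval s' = u := by rw [Ex.eval, hv, hu]
      rw [e5]
      refine hR _ _ (Q ++ [u]) ?_ hv ?_ (List.prefix_append _ _) ?_ ?_ ?_
      · simp only [pushCost, Ex.cost] at ht ⊢; omega
      · have hb : ∀ b, b ≠ 3 → b ≠ 4 → b ≠ 5 → (s'.setA 5 u ((Ex.num 1).eval s')).a b = s.a b := by
          intro b h3 h4 h5
          rw [Store.setA_a_of_ne _ _ _ h5, ha b h3 h4]
        refine ⟨by rw [Store.setA_v, hv, h.v0], by rw [Store.setA_v, hv, h.v1], ?_, ?_, ?_, ?_,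
          ?_, ?_, ?_, ?_⟩
        · rw [hb 1 (by decide) (by decide) (by decide), hb 2 (by decide) (by decide) (by decide)]
          exact h.adj
        · exact hl
        · intro w
          rw [Store.setA_a_self, ha 5 (by decide) (by decide)]
          by_cases hwu : w = u
          · subst hwu; simp [Ex.eval]
          · rw [Function.update_of_ne (fun hh => hwu (Fin.ext hh)), h.queued]
            simp [hwu]
        · rw [hb 6 (by decide) (by decide) (by decide)]; exact h.done
        · rw [hb 7 (by decide) (by decide) (by decide)]; exact h.seen
        · rw [hb 8 (by decide) (by decide) (by decide), hb 9 (by decide) (by decide) (by decide)]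
          exact h.outs
        · rw [hb 10 (by decide) (by decide) (by decide)]; exact h.mat
        · intro a ha'; rw [hb a (by omega) (by omega) (by omega)]; exact h.rest a ha'
      · exact List.nodup_append.2 ⟨hnd, List.nodup_singleton _, fun a ha b hb => by
          rw [List.mem_singleton] at hb; rintro rfl; exact hq' (hb ▸ ha)⟩
      · intro w hw
        rw [List.mem_append, List.mem_singleton] at hw
        rcases hw with hw | rfl
        · exact Or.inl hw
        · right; omega
      · intro hu'; simp at hu'
    · intro hlt
      rw [evg, (h.adj u).1, ev7] at hlt
      refine Tri.skip (hR _ _ Q ?_ rfl h (List.prefix_refl _) hnd (fun w hw => Or.inl hw) fun _ => ?_)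
      · simp only [Ex.cost]; omega
      · omega
  · intro hq
    rw [evg, h.queued, Ex.eval] at hq
    have hq' : u ∈ Q := by by_contra hmem; simp [hmem] at hq
    refine Tri.skip (hR _ _ Q ?_ rfl h (List.prefix_refl _) hnd (fun w hw => Or.inl hw) fun hh =>
      absurd hq' hh)
    simp only [Ex.cost]; omega

-- The loop invariant replaces the list of `v` by its first `i` entries, both in the counters of
-- processed neighbours and in the out-list of `v`. One round raises the counter of a single vertex,
-- so retrying that vertex alone restores the property that every unqueued vertex has more than `d`
-- unprocessed neighbours. New queue entries obey the bound with κ because `d ≤ κ`.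
open Classical in
theorem Tri.process (hL : Room L n) (hnb : ∀ u, (nb u).Nodup) (h : PeelRep nb s Q D dn out)
    {v : Fin n} {d κ : ℕ} (hv : s.v 4 = v) (hd : s.v 6 = d) (hdn : d ≤ n) (hdκ : d ≤ κ)
    (hdnn : ∀ w, dn w ≤ n) (hnd : Q.Nodup) (hout : out v = [])
    (hq : ∀ w ∈ Q, (nb w).length ≤ dn w + κ) (hnq : ∀ w, w ∉ Q → dn w + d < (nb w).length)
    (hR : ∀ t s' Q', t ≤ 400 * (nb v).length + 20 → s'.v 6 = d →
      PeelRep nb s' Q' (insert v D) (fun w => dn w + if w ∈ nb v then 1 else 0)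
        (Function.update out v ((nb v).filter fun w => w ∉ insert v D)) →
      Q <+: Q' → Q'.Nodup → (∀ w ∈ Q', (nb w).length ≤ dn w + (if w ∈ nb v then 1 else 0) + κ) →
      (∀ w, w ∉ Q' → dn w + (if w ∈ nb v then 1 else 0) + d < (nb w).length) → R t s') :
    Tri L (Cmd.process L.nv) s R := by
  have hK := hL.arrays
  have hnv := hL.vars
  have hw := hL.word
  have hBw := L.len_lt
  have hsq := hL.sq_le
  have hun := v.isLt
  have huB := hL.lt_len hun.le
  have h2n : 2 * n + 2 < 2 ^ L.w := by nlinarith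
  have hone : ∀ s, (Ex.num 1).Ok L s := fun s => show 1 < _ by omega
  have hev : (Ex.var 4).eval s = v := hv
  have hnl : ∀ u, (nb u).length ≤ n := fun u => by simpa using (hnb u).length_le_card
  refine Tri.seq (Tri.put (by omega) (by rw [hev]; exact huB) (show 4 < L.nv by omega) (hone _) ?_)
  rw [hev]
  set s₁ := s.setA 6 v ((Ex.num 1).eval s) with hs₁
  have h₁ : PeelRep nb s₁ Q (insert v D) dn out := by
    have hb : ∀ b, b ≠ 6 → s₁.a b = s.a b := fun b hb => Store.setA_a_of_ne _ _ _ hb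
    refine ⟨h.v0, h.v1, ?_, ?_, ?_, ?_, ?_, ?_, ?_, ?_⟩
    · rw [hb 1 (by decide), hb 2 (by decide)]; exact h.adj
    · rw [hb 3 (by decide), hb 4 (by decide)]; exact h.queue
    · rw [hb 5 (by decide)]; exact h.queued
    · intro w
      rw [hs₁, Store.setA_a_self]
      by_cases hwu : w = v
      · subst hwu; simp [Ex.eval]
      · rw [Function.update_of_ne (fun hh => hwu (Fin.ext hh)), h.done]
        simp [hwu]
    · rw [hb 7 (by decide)]; exact h.seen
    · rw [hb 8 (by decide), hb 9 (by decide)]; exact h.outs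
    · rw [hb 10 (by decide)]; exact h.mat
    · intro a ha; rw [hb a (by omega)]; exact h.rest a ha
  have hev₁ : (Ex.get 2 (.var 4)).eval s₁ = (nb v).length := by
    rw [Ex.eval, show (Ex.var 4).eval s₁ = v from hv, (h₁.adj v).1]
  refine Tri.loop (fun i t s' => t ≤ 400 * i ∧ s'.v 4 = v ∧ s'.v 6 = d ∧ ∃ Q',
      PeelRep nb s' Q' (insert v D) (fun w => dn w + if w ∈ (nb v).take i then 1 else 0)
        (Function.update out v (((nb v).take i).filter fun w => w ∉ insert v D)) ∧
      Q <+: Q' ∧ Q'.Nodup ∧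
      (∀ w ∈ Q', (nb w).length ≤ dn w + (if w ∈ (nb v).take i then 1 else 0) + κ) ∧
      (∀ w, w ∉ Q' → dn w + (if w ∈ (nb v).take i then 1 else 0) + d < (nb w).length))
    (by omega) ⟨show 4 < L.nv by omega, by omega, by rw [Ex.eval, hs₁, Store.setA_v, hv]; exact huB⟩
    ?_ ?_ ?_
  · refine ⟨le_rfl, hv, hd, Q, ?_, List.prefix_refl _, hnd, ?_, ?_⟩
    · have e : Function.update out v [] = out := by rw [← hout, Function.update_eq_self]
      simpa [e] using h₁
    · simpa using hq
    · simpa using hnq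
  · intro i hi t s' ⟨ht, hv', hd', Q', hP, hpre, hnd', ha, hb⟩
    rw [hev₁] at hi
    set u := (nb v)[i] with hu
    have hun := u.isLt
    have huB := hL.lt_len hun.le
    -- The list has no repetitions, so the counter of `u` has not yet been raised on account of `v`.
    have hunot : u ∉ (nb v).take i := by
      intro hm
      rw [List.mem_take_iff_getElem] at hm
      obtain ⟨j, hj, hj'⟩ := hm
      have := (hnb v).getElem_inj_iff.1 hj'
      omega
    have htake : (nb v).take (i + 1) = (nb v).take i ++ [u] := by
      rw [List.take_add_one, List.getElem?_eq_getElem hi]; rfl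
    have hin : i < n := lt_of_lt_of_le hi (hnl v)
    have hs8 : (s'.setV 8 i).v 4 = v := by rw [Store.setV_v_of_ne _ _ (by decide), hv']
    have hp1 : (s'.setV 8 i).v 1 = n + 1 := by rw [Store.setV_v_of_ne _ _ (by decide), hP.v1]
    have ev48 : (Ex.pair (.var 4) (.var 8)).eval (s'.setV 8 i) = v + (n + 1) * i := by
      rw [Ex.pair_eval hp1, Ex.eval, Ex.eval, hs8, Store.setV_v_self]
    refine Tri.seq (Tri.set (by omega) ⟨Ex.pair_ok hL hp1 (show 4 < L.nv by omega)
      (show 8 < L.nv by omega) (by rw [Ex.eval, hs8]; omega)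
      (by rw [Ex.eval, Store.setV_v_self]; omega), by omega, ?_⟩ ?_)
    · rw [ev48]; exact hL.pair_lt (by omega) (by omega)
    have evu : (Ex.get 1 (.pair (.var 4) (.var 8))).eval (s'.setV 8 i) = u := by
      rw [Ex.eval, ev48, Store.setV_a, (hP.adj v).2 i hi]
    rw [evu]
    set s₂ := (s'.setV 8 i).setV 5 u with hs₂
    have vne : ∀ x, x ≠ 8 → x ≠ 5 → s₂.v x = s'.v x := fun x h1 h2 => by
      rw [hs₂, Store.setV_v_of_ne _ _ h2, Store.setV_v_of_ne _ _ h1]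
    have hP₂ := hP.congr (vne 0 (by decide) (by decide)) (vne 1 (by decide) (by decide))
      (show s₂.a = s'.a from rfl)
    have v5 : s₂.v 5 = u := Store.setV_v_self _ _ _
    have v4 : s₂.v 4 = v := by rw [vne 4 (by decide) (by decide), hv']
    have v6 : s₂.v 6 = d := by rw [vne 6 (by decide) (by decide), hd']
    clear_value s₂
    -- The rest of the round, common to the cases where `u` is and is not appended to the out-list.
    have key : ∀ t₁ s₃, t₁ ≤ 100 → s₃.v = s₂.v → PeelRep nb s₃ Q' (insert v D)
        (fun w => dn w + if w ∈ (nb v).take i then 1 else 0)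
        (Function.update out v (((nb v).take (i + 1)).filter fun w => w ∉ insert v D)) →
        Tri L (Cmd.seq (Cmd.put L.nv 7 (.var 5) (.add (.get 7 (.var 5)) (.num 1)))
          (Cmd.tryEnqueue L.nv)) s₃ fun t' s'' =>
          t + ((Ex.get 1 (.pair (.var 4) (.var 8))).cost + 2 + (t₁ + t')) + 5 ≤ 400 * (i + 1) ∧
          s''.v 4 = v ∧ s''.v 6 = d ∧ ∃ Q',
          PeelRep nb s'' Q' (insert v D) (fun w => dn w + if w ∈ (nb v).take (i + 1) then 1 else 0)
          (Function.update out v (((nb v).take (i + 1)).filter fun w => w ∉ insert v D)) ∧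
          Q <+: Q' ∧ Q'.Nodup ∧
          (∀ w ∈ Q', (nb w).length ≤ dn w + (if w ∈ (nb v).take (i + 1) then 1 else 0) + κ) ∧
          (∀ w, w ∉ Q' →
            dn w + (if w ∈ (nb v).take (i + 1) then 1 else 0) + d < (nb w).length) := by
      intro t₁ s₃ ht₁ hv₃ hP₃
      have e5 : (Ex.var 5).eval s₃ = u := by rw [Ex.eval, hv₃, v5]
      have o5 : (Ex.var 5).Ok L s₃ := show 5 < L.nv by omega
      have e7 : (Ex.add (.get 7 (.var 5)) (.num 1)).eval s₃ = dn u + 1 := by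
        simp only [Ex.eval, hv₃, v5, hP₃.seen, if_neg hunot]
      have hdu := hdnn u
      refine Tri.seq (Tri.put (by omega) (by rw [e5]; exact huB) o5
        ⟨⟨o5, by omega, by rw [e5]; exact huB⟩, hone _, ?_⟩ ?_)
      · rw [← Ex.eval.eq_3, e7]; omega
      rw [e5, e7]
      set s₄ := s₃.setA 7 u (dn u + 1) with hs₄
      have hdi : ∀ w, (if w ∈ (nb v).take (i + 1) then 1 else 0) =
          (if w ∈ (nb v).take i then 1 else 0) + if w = u then 1 else 0 := by
        intro w
        rw [htake]
        by_cases hwu : w = u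
        · subst hwu; simp [hunot]
        · simp [hwu]
      have hP₄ : PeelRep nb s₄ Q' (insert v D)
          (fun w => dn w + if w ∈ (nb v).take (i + 1) then 1 else 0)
          (Function.update out v (((nb v).take (i + 1)).filter fun w => w ∉ insert v D)) := by
        have hb : ∀ b, b ≠ 7 → s₄.a b = s₃.a b := fun b hb => Store.setA_a_of_ne _ _ _ hb
        refine ⟨hP₃.v0, hP₃.v1, ?_, ?_, ?_, ?_, ?_, ?_, ?_, ?_⟩
        · rw [hb 1 (by decide), hb 2 (by decide)]; exact hP₃.adj
        · rw [hb 3 (by decide), hb 4 (by decide)]; exact hP₃.queue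
        · rw [hb 5 (by decide)]; exact hP₃.queued
        · rw [hb 6 (by decide)]; exact hP₃.done
        · intro w
          rw [hs₄, Store.setA_a_self, hdi]
          by_cases hwu : w = u
          · subst hwu; simp [hunot]
          · rw [Function.update_of_ne (fun hh => hwu (Fin.ext hh)), hP₃.seen]
            simp [hwu]
        · rw [hb 8 (by decide), hb 9 (by decide)]; exact hP₃.outs
        · rw [hb 10 (by decide)]; exact hP₃.mat
        · intro a ha; rw [hb a (by omega)]; exact hP₃.rest a ha
      refine Tri.tryEnqueue hL hP₄ (u := u) (d := d) (by rw [hs₄, Store.setA_v, hv₃, v5])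
        (by rw [hs₄, Store.setA_v, hv₃, v6]) hdn ?_ hnd' ?_
      · intro w
        have := hdnn w
        split_ifs <;> omega
      intro t₂ s₅ Q'' ht₂ hv₅ hP₅ hpre₂ hnd₂ hq₂ hu₂
      refine ⟨?_, ?_, ?_, Q'', hP₅, hpre.trans hpre₂, hnd₂, ?_, ?_⟩
      · simp only [Ex.pair, Ex.cost]; omega
      · rw [hv₅, hs₄, Store.setA_v, hv₃, v4]
      · rw [hv₅, hs₄, Store.setA_v, hv₃, v6]
      · intro w hw
        rcases hq₂ w hw with h1 | h1
        · have := ha w h1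
          rw [hdi]; omega
        · omega
      · intro w hw
        by_cases hwu : w = u
        · subst hwu; exact hu₂ hw
        · have := hb w fun h1 => hw (hpre₂.subset h1)
          rw [hdi, if_neg hwu]; omega
    have e5 : (Ex.var 5).eval s₂ = u := v5
    have o5 : (Ex.var 5).Ok L s₂ := show 5 < L.nv by omega
    have o4 : (Ex.var 4).Ok L s₂ := show 4 < L.nv by omega
    have e6 : (Ex.get 6 (.var 5)).eval s₂ = if u ∈ insert v D then 1 else 0 := by
      rw [Ex.eval, e5, hP₂.done]
    refine Tri.seq (Tri.ifLt ⟨o5, by omega, by rw [e5]; exact huB⟩ (hone _) ?_ ?_)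
    · intro hlt
      rw [e6, Ex.eval] at hlt
      have hud : u ∉ insert v D := by intro hm; simp [hm] at hlt
      have hfil : ((nb v).take (i + 1)).filter (fun w => w ∉ insert v D) =
          ((nb v).take i).filter (fun w => w ∉ insert v D) ++ [u] := by
        rw [htake, List.filter_append, List.filter_singleton, decide_eq_true hud]; rfl
      refine Tri.seq (Tri.push hL (a := v) (y := u)
        (l := ((nb v).take i).filter fun w => w ∉ insert v D) hP₂.v1
        (by decide) (by omega) (by omega) (by omega) ?_
        (fun st hst => ⟨show 4 < L.nv by omega, by rw [Ex.eval, hst, v4]⟩) o5 e5 ?_ ?_)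
      · refine (List.length_filter_le _ _).trans ?_
        rw [List.length_take]; omega
      · have := hP₂.outs v
        rwa [Function.update_self] at this
      intro t₁ s₃ ht₁ hv₃ ha₃ hl₃ hl₃'
      have e45 : (Ex.pair (.var 4) (.var 5)).eval s₃ = v + (n + 1) * u := by
        rw [Ex.pair_eval (by rw [hv₃, hP₂.v1]), Ex.eval, Ex.eval, hv₃, v4, v5]
      refine Tri.put (by omega) (by rw [e45]; exact hL.pair_lt (by omega) (by omega))
        (Ex.pair_ok hL (by rw [hv₃, hP₂.v1]) o4 o5 (by rw [Ex.eval, hv₃, v4]; omega)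
          (by rw [Ex.eval, hv₃, v5]; omega)) (hone _) ?_
      rw [e45]
      refine key _ _ ?_ hv₃ ?_
      · simp only [pushCost, Ex.cost, Ex.pair] at ht₁ ⊢; omega
      · set s₄ := s₃.setA 10 (v + (n + 1) * u) ((Ex.num 1).eval s₃) with hs₄
        have hb : ∀ b, b ≠ 8 → b ≠ 9 → b ≠ 10 → s₄.a b = s₂.a b := fun b h8 h9 h10 => by
          rw [hs₄, Store.setA_a_of_ne _ _ _ h10, ha₃ b h8 h9]
        refine ⟨by rw [hs₄, Store.setA_v, hv₃, hP₂.v0], by rw [hs₄, Store.setA_v, hv₃, hP₂.v1],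
          ?_, ?_, ?_, ?_, ?_, ?_, ?_, ?_⟩
        · rw [hb 1 (by decide) (by decide) (by decide), hb 2 (by decide) (by decide) (by decide)]
          exact hP₂.adj
        · rw [hb 3 (by decide) (by decide) (by decide), hb 4 (by decide) (by decide) (by decide)]
          exact hP₂.queue
        · rw [hb 5 (by decide) (by decide) (by decide)]; exact hP₂.queued
        · rw [hb 6 (by decide) (by decide) (by decide)]; exact hP₂.done
        · rw [hb 7 (by decide) (by decide) (by decide)]; exact hP₂.seen
        · intro w
          have e8 : s₄.a 8 = s₃.a 8 := Store.setA_a_of_ne _ _ _ (by decide)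
          have e9 : s₄.a 9 = s₃.a 9 := Store.setA_a_of_ne _ _ _ (by decide)
          rw [e8, e9]
          by_cases hwv : w = v
          · subst hwv
            rw [Function.update_self, hfil]; exact hl₃
          · have := hP₂.outs w
            rw [Function.update_of_ne hwv] at this ⊢
            exact hl₃' w (by omega) (fun hh => hwv (Fin.ext hh)) _ this
        · intro x y
          rw [hs₄, Store.setA_a_self, ha₃ 10 (by decide) (by decide)]
          by_cases hxy : x = v ∧ y = u
          · obtain ⟨rfl, rfl⟩ := hxy
            rw [Function.update_self, Function.update_self, hfil]
            simp [Ex.eval]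
          · rw [Function.update_of_ne, hP₂.mat]
            · by_cases hxv : x = v
              · subst hxv
                have hyu : y ≠ u := fun hh => hxy ⟨rfl, hh⟩
                rw [Function.update_self, Function.update_self, hfil]
                simp [hyu]
              · rw [Function.update_of_ne hxv, Function.update_of_ne hxv]
            · intro hh
              have := pair_inj (by omega) (by omega) hh
              exact hxy ⟨Fin.ext this.1, Fin.ext this.2⟩
        · intro a ha'; rw [hb a (by omega) (by omega) (by omega)]; exact hP₂.rest a ha'
    · intro hlt
      rw [e6, Ex.eval] at hlt
      have hud : u ∈ insert v D := by by_contra hm; simp [hm] at hlt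
      have hfil : ((nb v).take (i + 1)).filter (fun w => w ∉ insert v D) =
          ((nb v).take i).filter (fun w => w ∉ insert v D) := by
        rw [htake, List.filter_append, List.filter_singleton]
        simp [hud]
      refine Tri.skip (key _ _ ?_ rfl ?_)
      · simp only [Ex.cost]; omega
      · rw [hfil]; exact hP₂
  · intro t s' ⟨ht, _, hd', Q', hP, hpre, hnd', ha, hb⟩
    rw [hev₁] at ht hP ha hb
    rw [List.take_length] at hP ha hb
    exact hR _ _ Q' (by simp only [Ex.cost]; omega) hd' hP hpre hnd' ha hb

end

end WordRAM

namespace WordRAM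

variable {L : Layout} {n : ℕ}

/-! ## The orientation found by the peeling -/

/-- The number of entries of the list of `w` that belong to `D`. -/
def seenCount (nb : Fin n → List (Fin n)) (D : Finset (Fin n)) (w : Fin n) : ℕ :=
  (nb w).countP fun u => u ∈ D

theorem countP_mem_insert {α : Type*} [DecidableEq α] {D : Finset α} {v : α} (hv : v ∉ D) :
    ∀ {l : List α}, l.Nodup →
      l.countP (fun u => u ∈ insert v D) = l.countP (fun u => u ∈ D) + if v ∈ l then 1 else 0
  | [], _ => by simp
  | a :: l, h => by
    rw [List.nodup_cons] at h
    have ih := countP_mem_insert hv h.2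
    rw [List.countP_cons, List.countP_cons, ih]
    by_cases ha : a = v
    · subst ha; simp [h.1, hv]
    · have hva : ¬ v = a := fun h => ha h.symm
      by_cases hD : a ∈ D
      · simp only [Finset.mem_insert, ha, hD, or_true, decide_true, if_true, List.mem_cons, hva,
          false_or]
        omega
      · simp [ha, hva, hD]

/-- What is known about the queue `Q`, the set `D` of processed vertices and the lists `out` of
out-neighbours between the processing of vertices. -/
structure PeelInv (nb : Fin n → List (Fin n)) (κ : ℕ) (Q : List (Fin n)) (D : Finset (Fin n))
    (out : Fin n → List (Fin n)) : Prop where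
  nodup : Q.Nodup
  sub : ∀ w ∈ D, w ∈ Q
  bound : ∀ w ∈ Q, (nb w).length ≤ seenCount nb D w + κ
  fresh : ∀ v ∉ D, out v = []
  outNodup : ∀ v, (out v).Nodup
  outSub : ∀ v, ∀ w ∈ out v, w ∈ nb v
  outLen : ∀ v, (out v).length ≤ κ
  orient : ∀ u v, v ∈ nb u → (u ∈ D ∨ v ∈ D) → (v ∈ out u ↔ u ∉ out v)

/-- The cost of processing the vertices in `D`. -/
def potential (nb : Fin n → List (Fin n)) (D : Finset (Fin n)) : ℕ :=
  ∑ v ∈ D, ((nb v).length + 1)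

/-- `nb` describes the neighbours in a simple graph. -/
structure NeighborLists (nb : Fin n → List (Fin n)) : Prop where
  nodup : ∀ u, (nb u).Nodup
  symm : ∀ u v, v ∈ nb u → u ∈ nb v
  irrefl : ∀ u, u ∉ nb u

section
variable {nb : Fin n → List (Fin n)} {s : Store} {Q : List (Fin n)} {D : Finset (Fin n)}
  {out : Fin n → List (Fin n)} {R : ℕ → Store → Prop}

theorem NeighborLists.length_lt (hnb : NeighborLists nb) (u : Fin n) : (nb u).length < n := by
  have h : (u :: nb u).Nodup := List.nodup_cons.2 ⟨hnb.irrefl u, hnb.nodup u⟩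
  have := h.length_le_card
  simpa using this

theorem NeighborLists.seenCount_insert (hnb : NeighborLists nb) {v : Fin n} (hv : v ∉ D) :
    seenCount nb (insert v D) = fun w => seenCount nb D w + if w ∈ nb v then 1 else 0 := by
  funext w
  rw [seenCount, countP_mem_insert hv (hnb.nodup w), seenCount]
  have : v ∈ nb w ↔ w ∈ nb v := ⟨hnb.symm _ _, hnb.symm _ _⟩
  simp only [this]

/-- The processed vertex points to all its neighbours that are still unprocessed, so each edge gets
its direction when its first end is processed. -/
theorem PeelInv.process (hnb : NeighborLists nb) {κ : ℕ} (h : PeelInv nb κ Q D out) {v : Fin n}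
    (hvQ : v ∈ Q) (hvD : v ∉ D) {Q' : List (Fin n)} (hpre : Q <+: Q') (hnd : Q'.Nodup)
    (hb : ∀ w ∈ Q', (nb w).length ≤ seenCount nb (insert v D) w + κ) :
    PeelInv nb κ Q' (insert v D)
      (Function.update out v ((nb v).filter fun w => w ∉ insert v D)) := by
  refine ⟨hnd, ?_, hb, ?_, ?_, ?_, ?_, ?_⟩
  · intro w hw
    rcases Finset.mem_insert.1 hw with rfl | hw
    · exact hpre.subset hvQ
    · exact hpre.subset (h.sub w hw)
  · intro w hw
    rw [Finset.mem_insert, not_or] at hw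
    rw [Function.update_of_ne hw.1, h.fresh w hw.2]
  · intro w
    by_cases hw : w = v
    · subst hw; rw [Function.update_self]; exact (hnb.nodup _).filter _
    · rw [Function.update_of_ne hw]; exact h.outNodup w
  · intro w
    by_cases hw : w = v
    · subst hw; rw [Function.update_self]; exact fun x hx => (List.mem_filter.1 hx).1
    · rw [Function.update_of_ne hw]; exact h.outSub w
  · intro w
    by_cases hw : w = v
    · subst hw
      rw [Function.update_self]
      -- The neighbours split into processed and unprocessed ones, and the queue bound leaves at
      -- most κ of the latter. Marking the vertex itself does not change its own count, since there
      -- are no loops.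
      have h1 := h.bound w hvQ
      have h2 := List.length_eq_countP_add_countP (fun u => decide (u ∈ insert w D)) (l := nb w)
      have h3 : seenCount nb (insert w D) w = seenCount nb D w := by
        rw [hnb.seenCount_insert hvD]; simp [hnb.irrefl]
      rw [← seenCount, h3] at h2
      have h4 : ((nb w).filter fun u => u ∉ insert w D).length =
          (nb w).countP (fun u => !decide (u ∈ insert w D)) := by
        rw [List.countP_eq_length_filter]
        congr 1
        refine List.filter_congr fun x _ => ?_
        simp
      rw [h4]
      have h5 : (nb w).countP (fun u => !decide (u ∈ insert w D)) =
        List.countP (fun a => decide ¬decide (a ∈ insert w D) = true) (nb w) := by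
        refine List.countP_congr fun x _ => ?_
        simp
      omega
    · rw [Function.update_of_ne hw]; exact h.outLen w
  -- An already processed neighbour `u` has `v` in its out-list, by `orient` and because the list of
  -- `v` was empty so far. An unprocessed neighbour still has an empty out-list and now enters that
  -- of `v`.
  · have key : ∀ u, u ∈ nb v → (u ∈ Function.update out v
        ((nb v).filter fun w => w ∉ insert v D) v ↔ v ∉ out u) := by
      intro u hu
      have huv : u ≠ v := by rintro rfl; exact hnb.irrefl _ hu
      rw [Function.update_self, List.mem_filter]
      by_cases huD : u ∈ D
      · have h1 := h.orient u v (hnb.symm _ _ hu) (Or.inl huD)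
        rw [h.fresh v hvD] at h1
        have : v ∈ out u := h1.2 List.not_mem_nil
        simp [huD, this]
      · simp [h.fresh u huD, huD, hu, huv]
    intro a b hab hD
    have hne : a ≠ b := by rintro rfl; exact hnb.irrefl _ hab
    by_cases ha : a = v
    · subst ha
      rw [key b hab, Function.update_of_ne hne.symm]
    · by_cases hbv : b = v
      · subst hbv
        have := key a (hnb.symm _ _ hab)
        rw [this, Function.update_of_ne ha, not_not]
      · rw [Function.update_of_ne ha, Function.update_of_ne hbv]
        simp only [Finset.mem_insert, ha, hbv, false_or] at hD
        exact h.orient a b hab hD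

theorem seenCount_le (hnb : NeighborLists nb) (D : Finset (Fin n)) (w : Fin n) :
    seenCount nb D w ≤ n :=
  (List.countP_le_length).trans (hnb.length_lt w).le

theorem potential_insert {v : Fin n} (hv : v ∉ D) :
    potential nb (insert v D) = potential nb D + ((nb v).length + 1) := by
  rw [potential, Finset.sum_insert hv, potential, Nat.add_comm]

/-- The queue grows while it is read, but as it has no repetitions its length stays at most `n`, so
`n` guarded rounds reach every entry. Entries left over from earlier thresholds are recognised as
done at constant cost. The increase of `potential` pays for the vertices that are really processed.
-/
theorem Tri.drain (hL : Room L n) (hnb : NeighborLists nb) {κ d : ℕ}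
    (h : PeelRep nb s Q D (seenCount nb D) out) (hI : PeelInv nb κ Q D out)
    (hd : s.v 6 = d) (hdn : d ≤ n) (hdκ : d ≤ κ)
    (hnq : ∀ w, w ∉ Q → seenCount nb D w + d < (nb w).length)
    (hR : ∀ t s' Q' D' out', t + 500 * potential nb D ≤ 100 * n + 500 * potential nb D' + 4 →
      PeelRep nb s' Q' D' (seenCount nb D') out' → PeelInv nb κ Q' D' out' → (∀ w ∈ Q', w ∈ D') →
      (∀ w, w ∉ Q' → seenCount nb D' w + d < (nb w).length) → R t s') :
    Tri L (Cmd.drain L.nv) s R := by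
  have hK := hL.arrays
  have hnv := hL.vars
  have hw := hL.word
  have hBw := L.len_lt
  refine Tri.loop (fun i t s' => s'.v 6 = d ∧ ∃ Q' D' out',
      t + 500 * potential nb D ≤ 100 * i + 500 * potential nb D' ∧
      PeelRep nb s' Q' D' (seenCount nb D') out' ∧ PeelInv nb κ Q' D' out' ∧
      (∀ w, w ∉ Q' → seenCount nb D' w + d < (nb w).length) ∧
      ∀ j (hj : j < Q'.length), j < i → Q'[j] ∈ D') (by omega) (show 0 < L.nv by omega)
      ⟨hd, Q, D, out, by omega, h, hI, hnq, by omega⟩ ?_ ?_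
  · intro i hi t s' ⟨hd', Q', D', out', ht, hP, hI', hnq', hj'⟩
    rw [Ex.eval, h.v0] at hi
    have hiB := hL.lt_len hi.le
    have e1 : (s'.setV 7 i).v 1 = n + 1 := by rw [Store.setV_v_of_ne _ _ (by decide), hP.v1]
    have e7 : (Ex.var 7).eval (s'.setV 7 i) = i := Store.setV_v_self _ _ _
    have e4 : (Ex.get 4 (.num 0)).eval (s'.setV 7 i) = Q'.length := by
      rw [Ex.eval, Store.setV_a, Ex.eval, hP.queue.1]
    have o0 : (Ex.num 0).Ok L (s'.setV 7 i) := show 0 < _ by omega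
    have o7 : (Ex.var 7).Ok L (s'.setV 7 i) := show 7 < L.nv by omega
    refine Tri.ifLt o7 ⟨o0, by omega, hL.lt_len (Nat.zero_le n)⟩ ?_ ?_
    · intro hlt
      rw [e7, e4] at hlt
      have e07 : (Ex.pair (.num 0) (.var 7)).eval (s'.setV 7 i) = 0 + (n + 1) * i := by
        rw [Ex.pair_eval e1, e7, Ex.eval]
      have ev : (Ex.get 3 (.pair (.num 0) (.var 7))).eval (s'.setV 7 i) = Q'[i] := by
        rw [Ex.eval, e07, Store.setV_a, hP.queue.2 i hlt]
      set v := Q'[i] with hv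
      refine Tri.seq (Tri.set (by omega) ⟨Ex.pair_ok hL e1 o0 o7 (Nat.zero_le n)
        (by rw [e7]; omega), by omega, by rw [e07]; exact hL.pair_lt (by omega) (by omega)⟩ ?_)
      rw [ev]
      set s₂ := (s'.setV 7 i).setV 4 v with hs₂
      have vne : ∀ x, x ≠ 7 → x ≠ 4 → s₂.v x = s'.v x := fun x h1 h2 => by
        rw [hs₂, Store.setV_v_of_ne _ _ h2, Store.setV_v_of_ne _ _ h1]
      have hP₂ := hP.congr (vne 0 (by decide) (by decide)) (vne 1 (by decide) (by decide))
        (show s₂.a = s'.a from rfl)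
      have v4 : s₂.v 4 = v := Store.setV_v_self _ _ _
      have v6 : s₂.v 6 = d := by rw [vne 6 (by decide) (by decide), hd']
      clear_value s₂
      have evd : (Ex.get 6 (.var 4)).eval s₂ = if v ∈ D' then 1 else 0 := by
        rw [Ex.eval, Ex.eval, v4, hP₂.done]
      have hvQ : v ∈ Q' := List.getElem_mem hlt
      refine Tri.ifLt ⟨show 4 < L.nv by omega, by omega, ?_⟩ (show 1 < _ by omega) ?_ ?_
      · rw [Ex.eval, v4]; exact hL.lt_len v.isLt.le
      · intro hlt'
        rw [evd, Ex.eval] at hlt'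
        have hvD : v ∉ D' := by intro hm; simp [hm] at hlt'
        refine Tri.process hL hnb.nodup hP₂ v4 v6 hdn hdκ (seenCount_le hnb D') hI'.nodup
          (hI'.fresh v hvD) hI'.bound hnq' ?_
        intro t₁ s₃ Q'' ht₁ hv₃ hP₃ hpre hnd hb hnb'
        rw [← hnb.seenCount_insert hvD] at hP₃
        have eqs := hnb.seenCount_insert hvD
        refine ⟨hv₃, Q'', insert v D', _, ?_, hP₃,
          hI'.process hnb hvQ hvD hpre hnd ?_, ?_, ?_⟩
        · rw [potential_insert hvD]
          simp only [Ex.cost, Ex.pair]; omega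
        · intro w hw; rw [eqs]; exact hb w hw
        · intro w hw; rw [eqs]; exact hnb' w hw
        · intro j hj hji
          have hjl : j < Q'.length := by omega
          have : Q''[j] = Q'[j] := (hpre.getElem hjl).symm
          rw [this]
          by_cases hje : j = i
          · subst hje; exact Finset.mem_insert_self _ _
          · exact Finset.mem_insert_of_mem (hj' j hjl (by omega))
      · intro hlt'
        rw [evd, Ex.eval] at hlt'
        have hvD : v ∈ D' := by by_contra hm; simp [hm] at hlt'
        refine Tri.skip ⟨v6, Q', D', out', ?_, hP₂, hI', hnq', ?_⟩
        · simp only [Ex.cost, Ex.pair]; omega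
        · intro j hj hji
          by_cases hje : j = i
          · subst hje; exact hvD
          · exact hj' j hj (by omega)
    · intro hlt
      rw [e7, e4] at hlt
      refine Tri.skip ⟨?_, Q', D', out', ?_, ?_, hI', hnq', ?_⟩
      · rw [Store.setV_v_of_ne _ _ (by decide), hd']
      · simp only [Ex.cost]; omega
      · exact hP.congr (Store.setV_v_of_ne _ _ (by decide)) (Store.setV_v_of_ne _ _ (by decide)) rfl
      · intro j hj hji
        exact hj' j hj (by omega)
  · intro t s' ⟨hd', Q', D', out', ht, hP, hI', hnq', hj'⟩
    rw [Ex.eval, h.v0] at ht hj'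
    refine hR _ _ Q' D' out' (by simp only [Ex.cost]; omega) hP hI' ?_ hnq'
    intro w hw
    obtain ⟨j, hj, rfl⟩ := List.getElem_of_mem hw
    have hl : Q'.length ≤ n := by simpa using hI'.nodup.length_le_card
    exact hj' j hj (by omega)

theorem Tri.scan (hL : Room L n) (hnb : NeighborLists nb) {κ d : ℕ}
    (h : PeelRep nb s Q D (seenCount nb D) out) (hI : PeelInv nb κ Q D out)
    (hd : s.v 6 = d) (hdn : d ≤ n) (hdκ : d ≤ κ)
    (hR : ∀ t s' Q', t ≤ 150 * n + 4 → s'.v 6 = d →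
      PeelRep nb s' Q' D (seenCount nb D) out → PeelInv nb κ Q' D out →
      (∀ w, w ∉ Q' → seenCount nb D w + d < (nb w).length) → R t s') :
    Tri L (Cmd.scan L.nv) s R := by
  have hnv := hL.vars
  refine Tri.loop (fun i t s' => t ≤ 150 * i ∧ s'.v 6 = d ∧ ∃ Q',
      PeelRep nb s' Q' D (seenCount nb D) out ∧ PeelInv nb κ Q' D out ∧
      (∀ w : Fin n, w < i → w ∉ Q' → seenCount nb D w + d < (nb w).length)) (by omega)
      (show 0 < L.nv by omega) ⟨by omega, hd, Q, h, hI, fun _ hw => absurd hw (Nat.not_lt_zero _)⟩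
      ?_ ?_
  · intro i hi t s' ⟨ht, hd', Q', hP, hI', hq⟩
    rw [Ex.eval, h.v0] at hi
    refine Tri.seq (Tri.set (by omega) (show 7 < L.nv by omega) ?_)
    have e7 : (Ex.var 7).eval (s'.setV 7 i) = i := Store.setV_v_self _ _ _
    rw [e7]
    have vne : ∀ x, x ≠ 7 → x ≠ 5 → ((s'.setV 7 i).setV 5 i).v x = s'.v x := fun x h1 h2 => by
      rw [Store.setV_v_of_ne _ _ h2, Store.setV_v_of_ne _ _ h1]
    have hP₂ := hP.congr (s' := (s'.setV 7 i).setV 5 i) (vne 0 (by decide) (by decide))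
      (vne 1 (by decide) (by decide)) rfl
    refine Tri.tryEnqueue hL hP₂ (u := ⟨i, hi⟩) (d := d) (Store.setV_v_self _ _ _)
      (by rw [vne 6 (by decide) (by decide), hd']) hdn
      (fun w => (seenCount_le hnb D w).trans (Nat.le_succ n)) hI'.nodup ?_
    intro t₁ s₃ Q'' ht₁ hv₃ hP₃ hpre hnd hb hu
    refine ⟨by simp only [Ex.cost]; omega, ?_, Q'', hP₃, ?_, ?_⟩
    · rw [hv₃, vne 6 (by decide) (by decide), hd']
    · refine { hI' with nodup := hnd, sub := fun w hw => hpre.subset (hI'.sub w hw), bound := ?_ }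
      intro w hw
      rcases hb w hw with h1 | h1
      · exact hI'.bound w h1
      · omega
    · intro w hwi hw
      by_cases hwe : (w : ℕ) = i
      · have : w = ⟨i, hi⟩ := Fin.ext hwe
        subst this
        exact hu hw
      · exact hq w (by omega) fun h1 => hw (hpre.subset h1)
  · intro t s' ⟨ht, hd', Q', hP, hI', hq⟩
    rw [Ex.eval, h.v0] at ht hq
    exact hR _ _ Q' (by simp only [Ex.cost]; omega) hd' hP hI' fun w => hq w w.isLt

/-- While a vertex is unprocessed at threshold `d`, all unprocessed vertices have at least `d`
unprocessed neighbours, so `hκ` gives `d ≤ κ`. Hence at most `κ + 1` thresholds trigger a scan and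
the others cost a constant, which is the role of `min d (κ + 1)` in the invariant. After all
thresholds nothing is left, because no vertex has `n` neighbours. -/
theorem Tri.peel (hL : Room L n) (hnb : NeighborLists nb) {κ : ℕ}
    (h : PeelRep nb s [] ∅ (seenCount nb ∅) fun _ => [])
    (hκ : ∀ (D : Finset (Fin n)) (d : ℕ), (∃ w, w ∉ D) →
      (∀ w, w ∉ D → seenCount nb D w + d ≤ (nb w).length) → d ≤ κ)
    (hR : ∀ t s' Q' out', t ≤ 60 * n + 300 * n * (κ + 1) + 500 * potential nb Finset.univ + 4 →
      PeelRep nb s' Q' Finset.univ (seenCount nb Finset.univ) out' →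
      PeelInv nb κ Q' Finset.univ out' → R t s') :
    Tri L (Cmd.peel L.nv) s R := by
  have hK := hL.arrays
  have hnv := hL.vars
  have hw := hL.word
  refine Tri.loop (fun d t s' => ∃ Q' D' out',
      t ≤ 60 * d + 300 * n * min d (κ + 1) + 500 * potential nb D' ∧
      PeelRep nb s' Q' D' (seenCount nb D') out' ∧ PeelInv nb κ Q' D' out' ∧
      (∀ w ∈ Q', w ∈ D') ∧ (∀ w, w ∉ D' → seenCount nb D' w + d ≤ (nb w).length)) (by omega)
      (show 0 < L.nv by omega) ?_ ?_ ?_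
  · refine ⟨[], ∅, _, by omega, h, ?_, by simp, ?_⟩
    · constructor <;> simp
    · intro w _; simp [seenCount]
  · intro d hd t s' ⟨Q', D', out', ht, hP, hI, hQD, hD⟩
    rw [Ex.eval, h.v0] at hd
    have e0 : (Ex.var 0).eval (s'.setV 6 d) = n := by
      rw [Ex.eval, Store.setV_v_of_ne _ _ (by decide), hP.v0]
    have e4 : (Ex.get 4 (.num 0)).eval (s'.setV 6 d) = Q'.length := by
      rw [Ex.eval, Store.setV_a, Ex.eval, hP.queue.1]
    have o0 : (Ex.num 0).Ok L (s'.setV 6 d) := show 0 < _ by omega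
    have hP₂ := hP.congr (s' := s'.setV 6 d) (Store.setV_v_of_ne _ _ (by decide))
      (Store.setV_v_of_ne _ _ (by decide)) rfl
    refine Tri.ifLt ⟨o0, by omega, hL.lt_len (Nat.zero_le n)⟩ (show 0 < L.nv by omega) ?_ ?_
    · intro hlt
      rw [e4, e0] at hlt
      -- If everything were processed, the queue would contain all `n` vertices, against the test
      -- just passed.
      have hex : ∃ w, w ∉ D' := by
        by_contra hall
        push Not at hall
        have h1 : (Finset.univ : Finset (Fin n)) ⊆ Q'.toFinset := fun w _ =>
          List.mem_toFinset.2 (hI.sub w (hall w))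
        have h2 := Finset.card_le_card h1
        have h3 := Q'.toFinset_card_le
        simp at h2
        omega
      have hdκ := hκ D' d hex hD
      refine Tri.seq (Tri.scan hL hnb hP₂ hI (Store.setV_v_self _ _ _) hd.le hdκ ?_)
      intro t₁ s₁ Q₁ ht₁ hv₁ hP₁ hI₁ hq₁
      refine Tri.drain hL hnb hP₁ hI₁ hv₁ hd.le hdκ hq₁ ?_
      intro t₂ s₂ Q₂ D₂ out₂ ht₂ hP₂ hI₂ hQD₂ hq₂
      refine ⟨Q₂, D₂, out₂, ?_, hP₂, hI₂, hQD₂, ?_⟩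
      · have hmin : min (d + 1) (κ + 1) = d + 1 := by omega
        have hmin' : min d (κ + 1) = d := by omega
        rw [hmin]
        rw [hmin'] at ht
        have hsucc : 300 * n * (d + 1) = 300 * n * d + 300 * n := Nat.mul_succ _ _
        simp only [Ex.cost]
        omega
      · intro w hw
        have := hq₂ w fun h1 => hw (hQD₂ w h1)
        omega
    · intro hlt
      rw [e4, e0] at hlt
      refine Tri.skip ⟨Q', D', out', ?_, hP₂, hI, hQD, ?_⟩
      · have : 300 * n * min d (κ + 1) ≤ 300 * n * min (d + 1) (κ + 1) :=
          Nat.mul_le_mul_left _ (min_le_min_right _ (Nat.le_succ d))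
        simp only [Ex.cost]; omega
      · intro w hw
        exfalso
        have h1 : Q'.toFinset.card = n := by
          rw [List.toFinset_card_of_nodup hI.nodup]
          have : Q'.length ≤ n := by simpa using hI.nodup.length_le_card
          omega
        have h2 : Q'.toFinset = Finset.univ := (Finset.card_eq_iff_eq_univ _).1 (by simpa using h1)
        exact hw (hQD w (List.mem_toFinset.1 (h2 ▸ Finset.mem_univ w)))
  · intro t s' ⟨Q', D', out', ht, hP, hI, hQD, hD⟩
    rw [Ex.eval, h.v0] at ht hD
    have hu : D' = Finset.univ := by
      rw [Finset.eq_univ_iff_forall]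
      intro w
      by_contra hw
      have h1 := hD w hw
      have h2 := hnb.length_lt w
      omega
    subst hu
    refine hR _ _ Q' out' ?_ hP hI
    have : 300 * n * min n (κ + 1) ≤ 300 * n * (κ + 1) :=
      Nat.mul_le_mul_left _ (min_le_right _ _)
    simp only [Ex.cost]; omega

end

/-! ## The store after the preparation -/

/-- The array with the lists of out-neighbours. -/
def outArr : Bool → ℕ | true => 8 | false => 11
/-- The array with the lengths of the lists of out-neighbours. -/
def lenArr : Bool → ℕ | true => 9 | false => 12
/-- The array with the matrix of the out-neighbours. -/
def matArr : Bool → ℕ | true => 10 | false => 13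

/-- The store holds lists and matrices for the relations `v ∈ O b u`. -/
structure Ready (O : Bool → Fin n → List (Fin n)) (s : Store) : Prop where
  v0 : s.v 0 = n
  v1 : s.v 1 = n + 1
  outs : ∀ b (u : Fin n), ListAt (n + 1) (s.a (outArr b)) (s.a (lenArr b)) u (O b u)
  mat : ∀ b (u v : Fin n), s.a (matArr b) (u + (n + 1) * v) = if v ∈ O b u then 1 else 0

/-- The relations given by an orientation of a graph and by equality. -/
def relLists (out : Fin n → List (Fin n)) : Bool → Fin n → List (Fin n)
  | true, u => out u
  | false, u => [u]

namespace Cmd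

/-- Store the relation of equality. -/
def equality (nv : ℕ) : Cmd :=
  loop nv 4 (.var 0) (seq (push nv 11 12 (.var 4) (.var 4))
    (put nv 13 (.pair (.var 4) (.var 4)) (.num 1)))

/-- Build adjacency lists, an orientation, and the relation of equality. -/
def prepare (nv : ℕ) : Cmd := seq (adjacency nv) (seq (peel nv) (equality nv))

end Cmd

/-- Equality is stored in the format of the out-lists, with one-element lists, so that arcs and
coincidences of variables are treated alike by the enumeration. -/
theorem Tri.equality (hL : Room L n) {s : Store} {R : ℕ → Store → Prop} (h0 : s.v 0 = n)
    (h1 : s.v 1 = n + 1) (hz : ∀ a, 11 ≤ a → s.a a = 0)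
    (hR : ∀ t s', t ≤ 100 * n + 4 → s'.v 0 = n → s'.v 1 = n + 1 →
      (∀ a, a ≤ 10 → s'.a a = s.a a) → (∀ a, 14 ≤ a → s'.a a = 0) →
      (∀ u : Fin n, ListAt (n + 1) (s'.a 11) (s'.a 12) u [u]) →
      (∀ u v : Fin n, s'.a 13 (u + (n + 1) * v) = if v ∈ [u] then 1 else 0) → R t s') :
    Tri L (Cmd.equality L.nv) s R := by
  have hK := hL.arrays
  have hnv := hL.vars
  have hw := hL.word
  refine Tri.loop (fun i t s' => t ≤ 100 * i ∧ s'.v 0 = n ∧ s'.v 1 = n + 1 ∧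
      (∀ a, a ≤ 10 → s'.a a = s.a a) ∧ (∀ a, 14 ≤ a → s'.a a = 0) ∧
      (∀ u : Fin n, ListAt (n + 1) (s'.a 11) (s'.a 12) u (if (u : ℕ) < i then [u] else [])) ∧
      (∀ u v : Fin n, s'.a 13 (u + (n + 1) * v) = if u = v ∧ (u : ℕ) < i then 1 else 0)) (by omega)
      (show 0 < L.nv by omega) ?_ ?_ ?_
  · refine ⟨le_rfl, h0, h1, fun _ _ => rfl, fun a ha => hz a (by omega), ?_, ?_⟩
    · intro u
      rw [hz 11 (by omega), hz 12 (by omega)]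
      simp [ListAt]
    · intro u v
      rw [hz 13 (by omega)]
      simp
  · intro i hi t s' ⟨ht, e0, e1, ha, hb, hl, hm⟩
    rw [Ex.eval, h0] at hi
    have v1 : (s'.setV 4 i).v 1 = n + 1 := by rw [Store.setV_v_of_ne _ _ (by decide), e1]
    have v0 : (s'.setV 4 i).v 0 = n := by rw [Store.setV_v_of_ne _ _ (by decide), e0]
    have v4 : (s'.setV 4 i).v 4 = i := Store.setV_v_self _ _ _
    have hli := hl ⟨i, hi⟩
    rw [if_neg (lt_irrefl i)] at hli
    refine Tri.seq (Tri.push hL (a := i) (l := []) (y := ⟨i, hi⟩) v1 (by decide) (by omega)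
      (by omega) (by omega) (Nat.zero_le _)
      (fun st hst => ⟨show 4 < L.nv by omega, by rw [Ex.eval, hst, v4]⟩) (show 4 < L.nv by omega)
      v4 hli ?_)
    intro t₁ s₁ ht₁ hv₁ ha₁ hl₁ hl₁'
    have o4 : (Ex.var 4).Ok L s₁ := show 4 < L.nv by omega
    have e4 : (Ex.var 4).eval s₁ = i := by rw [Ex.eval, hv₁, v4]
    have e44 : (Ex.pair (.var 4) (.var 4)).eval s₁ = i + (n + 1) * i := by
      rw [Ex.pair_eval (by rw [hv₁, v1]), e4]
    refine Tri.put (by omega) (by rw [e44]; exact hL.pair_lt hi.le hi.le)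
      (Ex.pair_ok hL (by rw [hv₁, v1]) o4 o4 (by omega) (by omega)) (show 1 < _ by omega) ?_
    rw [e44]
    refine ⟨?_, ?_, ?_, ?_, ?_, ?_, ?_⟩
    · simp only [pushCost, Ex.cost, Ex.pair] at ht₁ ⊢; omega
    · rw [Store.setA_v, hv₁, v0]
    · rw [Store.setA_v, hv₁, v1]
    · intro a h
      rw [Store.setA_a_of_ne _ _ _ (by omega), ha₁ a (by omega) (by omega)]
      exact ha a h
    · intro a h
      rw [Store.setA_a_of_ne _ _ _ (by omega), ha₁ a (by omega) (by omega)]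
      exact hb a h
    · intro u
      rw [Store.setA_a_of_ne _ _ _ (by decide), Store.setA_a_of_ne _ _ _ (by decide)]
      by_cases hu : (u : ℕ) = i
      · have : u = ⟨i, hi⟩ := Fin.ext hu
        subst this
        simpa using hl₁
      · have hiff : ((u : ℕ) < i + 1) = ((u : ℕ) < i) := by
          apply propext; omega
        simp only [hiff]
        exact hl₁' u (by omega) hu _ (hl u)
    · intro u v
      rw [Store.setA_a_self, ha₁ 13 (by decide) (by decide)]
      by_cases huv : (u : ℕ) = i ∧ (v : ℕ) = i
      · obtain ⟨hu, hv⟩ := huv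
        have : u = v := Fin.ext (by omega)
        rw [hu, hv, Function.update_self, if_pos ⟨this, by omega⟩, Ex.eval]
      · rw [Function.update_of_ne]
        · rw [Store.setV_a, hm u v]
          refine if_congr ?_ rfl rfl
          constructor
          · rintro ⟨rfl, h⟩; exact ⟨rfl, by omega⟩
          · rintro ⟨rfl, h⟩; exact ⟨rfl, by omega⟩
        · intro hh
          exact huv (pair_inj (by omega) (by omega) hh)
  · intro t s' ⟨ht, e0, e1, ha, hb, hl, hm⟩
    rw [Ex.eval, h0] at ht hl hm
    refine hR _ _ (by simp only [Ex.cost]; omega) e0 e1 ha hb ?_ ?_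
    · intro u; simpa using hl u
    · intro u v; rw [hm]; simp [eq_comm]

end WordRAM

/-! ### Degeneracy and induced subgraphs -/

namespace SubgraphCounting

theorem isDegenerate_card {n : ℕ} (G : SimpleGraph (Fin n)) : IsDegenerate G n := by
  intro G' ⟨v, hv⟩
  refine ⟨v, hv, ?_⟩
  simpa using Set.ncard_le_ncard (Set.subset_univ (G'.neighborSet v)) Set.finite_univ

theorem isDegenerate_degeneracy {n : ℕ} (G : SimpleGraph (Fin n)) :
    IsDegenerate G (degeneracy G) :=
  Nat.sInf_mem (s := {d | IsDegenerate G d}) ⟨n, isDegenerate_card G⟩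

/-- Degeneracy is applied to the subgraph induced on `S`. -/
theorem IsDegenerate.exists_neighbors_le {n : ℕ} {G : SimpleGraph (Fin n)} {κ : ℕ}
    (h : IsDegenerate G κ) (S : Set (Fin n)) (hS : S.Nonempty) :
    ∃ v ∈ S, {w | w ∈ S ∧ G.Adj v w}.ncard ≤ κ := by
  obtain ⟨v, hv, hle⟩ := h ((⊤ : G.Subgraph).induce S) hS
  refine ⟨v, hv, le_trans (le_of_eq ?_) hle⟩
  congr 1
  ext w
  simp only [SimpleGraph.Subgraph.mem_neighborSet, SimpleGraph.Subgraph.induce_adj,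
    SimpleGraph.Subgraph.top_adj, Set.mem_ofPred_eq]
  exact ⟨fun h => ⟨hv, h.1, h.2⟩, fun h => ⟨h.2.1, h.2.2⟩⟩

end SubgraphCounting

/-! ### Low out-degree orientations of the input graph -/

namespace WordRAM
open SubgraphCounting

variable {L : Layout} {n : ℕ}

/-- The handshake count; it bounds both the total length of the out-lists and the cost of the
peeling. -/
theorem sum_length_neighborList : ∀ es : List (Fin n × Fin n),
    ∑ u, (neighborList es u).length = 2 * es.length
  | [] => by simp [neighborList]
  | e :: es => by
    have ih := sum_length_neighborList es
    have h : ∀ u, (neighborList (e :: es) u).length =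
        (if u = e.1 then 1 else 0) + (if u = e.2 then 1 else 0) + (neighborList es u).length := by
      intro u
      rw [neighborList, List.flatMap_cons, ← neighborList, List.length_append, List.length_append]
      split_ifs <;> rfl
    simp only [h, Finset.sum_add_distrib, ih, Finset.sum_ite_eq', Finset.mem_univ, if_true,
      List.length_cons]
    omega

section
variable {G : SimpleGraph (Fin n)} {es : List (Fin n × Fin n)}

theorem mem_neighborList_iff (hes : IsEdgeList G es) {u v : Fin n} :
    v ∈ neighborList es u ↔ G.Adj u v := by
  rw [mem_neighborList, hes.2, SimpleGraph.mem_edgeSet]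

theorem ne_of_mem_edgeList (hes : IsEdgeList G es) : ∀ e ∈ es, e.1 ≠ e.2 := by
  intro e he
  have h : s(e.1, e.2) ∈ G.edgeSet := (hes.2 _).1 (List.mem_map_of_mem he)
  exact (G.mem_edgeSet.1 h).ne

theorem neighborLists (hes : IsEdgeList G es) : NeighborLists (neighborList es) where
  nodup _ := nodup_neighborList _ hes.1 (ne_of_mem_edgeList hes)
  symm _ _ h := (mem_neighborList_iff hes).2 ((mem_neighborList_iff hes).1 h).symm
  irrefl _ h := G.irrefl ((mem_neighborList_iff hes).1 h)

/-- The hypothesis says that the subgraph induced on the complement of `D` has minimum degree at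
least `d`; degeneracy supplies a vertex there of degree at most κ. -/
theorem le_of_seenCount_le (hes : IsEdgeList G es) {κ : ℕ} (hκ : IsDegenerate G κ)
    (D : Finset (Fin n)) (d : ℕ) (hD : ∃ w, w ∉ D)
    (h : ∀ w, w ∉ D → seenCount (neighborList es) D w + d ≤ (neighborList es w).length) :
    d ≤ κ := by
  obtain ⟨v, hv, hle⟩ := hκ.exists_neighbors_le {w | w ∉ D} hD
  refine le_trans ?_ hle
  have h1 := h v hv
  have h2 := List.length_eq_countP_add_countP (fun u => decide (u ∈ D)) (l := neighborList es v)
  have h3 : {w | w ∈ {w | w ∉ D} ∧ G.Adj v w} =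
      (((neighborList es v).filter fun w => w ∉ D).toFinset : Set (Fin n)) := by
    ext w
    simp [mem_neighborList_iff hes, and_comm]
  rw [h3, Set.ncard_coe_finset, List.toFinset_card_of_nodup (((neighborLists hes).nodup v).filter _),
    ← List.countP_eq_length_filter]
  rw [seenCount] at h1
  have h5 : (neighborList es v).countP (fun w => decide (w ∉ D)) =
      (neighborList es v).countP (fun a => decide ¬decide (a ∈ D) = true) :=
    List.countP_congr fun x _ => by simp
  omega

/-- Every edge of `G` has exactly one orientation in `out`. -/
structure Orients (G : SimpleGraph (Fin n)) (κ m : ℕ) (out : Fin n → List (Fin n)) : Prop where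
  nodup : ∀ v, (out v).Nodup
  length_le : ∀ v, (out v).length ≤ κ
  sum_le : ∑ v, (out v).length ≤ 2 * m
  adj : ∀ u v, G.Adj u v ↔ v ∈ out u ∨ u ∈ out v
  anti : ∀ u v, v ∈ out u → u ∉ out v

/-- The store at the beginning, for the graph with edge list `es`. -/
structure Loaded (L : Layout) (es : List (Fin n × Fin n)) (s : Store) : Prop where
  v0 : s.v 0 = n
  v1 : s.v 1 = n + 1
  v2 : s.v 2 = es.length
  input : ∀ i < L.B, s.a 0 i = (encode n es).getD i 0
  zero : ∀ a, 1 ≤ a → s.a a = 0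

theorem Tri.prepare (hL : Room L n) {s : Store} (hes : IsEdgeList G es) {κ : ℕ}
    (hκ : IsDegenerate G κ) (hs : Loaded L es s) (hlen : 2 * es.length + 2 ≤ L.B)
    {R : ℕ → Store → Prop}
    (hR : ∀ t s' out, t ≤ 1120 * es.length + 660 * n + 300 * n * (κ + 1) + 12 →
      Orients G κ es.length out → Ready (relLists out) s' → (∀ a, 14 ≤ a → s'.a a = 0) → R t s') :
    Tri L (Cmd.prepare L.nv) s R := by
  have hnb := neighborLists hes
  refine Tri.seq (Tri.adjacency hL hes.1 (ne_of_mem_edgeList hes) hs.v1 hs.v2 hlen hs.input hs.zero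
    ?_)
  intro t₁ s₁ ht₁ e0 e1 e2 hz hl
  have hP : PeelRep (neighborList es) s₁ [] ∅ (seenCount (neighborList es) ∅) fun _ => [] := by
    refine ⟨by rw [e0, hs.v0], by rw [e1, hs.v1], hl, ?_, ?_, ?_, ?_, ?_, ?_, ?_⟩
    · rw [hz 3 (by omega), hz 4 (by omega)]; simp [ListAt]
    · rw [hz 5 (by omega)]; simp
    · rw [hz 6 (by omega)]; simp
    · rw [hz 7 (by omega)]; simp [seenCount]
    · rw [hz 8 (by omega), hz 9 (by omega)]; simp [ListAt]
    · rw [hz 10 (by omega)]; simp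
    · intro a ha; exact hz a (by omega)
  refine Tri.seq (Tri.peel hL hnb hP (le_of_seenCount_le hes hκ) ?_)
  intro t₂ s₂ Q out ht₂ hP₂ hI
  refine Tri.equality hL hP₂.v0 hP₂.v1 hP₂.rest ?_
  intro t₃ s₃ ht₃ f0 f1 hlow hz₃ hl₃ hm₃
  have hpot : potential (neighborList es) Finset.univ = 2 * es.length + n := by
    rw [potential, Finset.sum_add_distrib, sum_length_neighborList]; simp
  have hsub : ∀ v, (out v).length ≤ (neighborList es v).length := fun v =>
    ((hI.outNodup v).subperm (hI.outSub v)).length_le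
  refine hR _ s₃ out (by omega) ⟨hI.outNodup, hI.outLen, ?_, ?_, ?_⟩ ⟨f0, f1, ?_, ?_⟩ hz₃
  -- Out-lists are part of the adjacency lists. The true total is m, but the bound 2m is enough.
  · rw [← sum_length_neighborList]; exact Finset.sum_le_sum fun v _ => hsub v
  · intro u v
    rw [← mem_neighborList_iff hes]
    constructor
    · intro h
      have := hI.orient u v h (Or.inl (Finset.mem_univ _))
      tauto
    · rintro (h | h)
      · exact hI.outSub _ _ h
      · exact hnb.symm _ _ (hI.outSub _ _ h)
  · intro u v h
    exact (hI.orient u v (hI.outSub _ _ h) (Or.inl (Finset.mem_univ _))).1 h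
  · rintro (_ | _) u
    · exact hl₃ u
    · have := hP₂.outs u
      exact this.congr (hlow 8 (by omega)) (hlow 9 (by omega))
  · rintro (_ | _) u v
    · exact hm₃ u v
    · rw [matArr, hlow 10 (by omega)]; exact hP₂.mat u v

end

end WordRAM

namespace WordRAM
open SubgraphCounting

variable {L : Layout} {n k : ℕ}

/-! ## Enumeration of the solutions of a system of constraints -/

/-- The constraint that the value of variable `j` is in the list of the value of variable `i`. -/
structure Con (k : ℕ) where
  i : Fin k
  j : Fin k
  b : Bool

/-- The assignment `x` satisfies the constraint `c`. -/
def Con.Holds (O : Bool → Fin n → List (Fin n)) (x : Fin k → Fin n) (c : Con k) : Prop :=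
  x c.j ∈ O c.b (x c.i)

instance (O : Bool → Fin n → List (Fin n)) (x : Fin k → Fin n) (c : Con k) :
    Decidable (c.Holds O x) := inferInstanceAs (Decidable (_ ∈ _))

/-- The program variable for the vertex variable `j`. -/
def vertexVar (j : Fin k) : ℕ := 20 + 2 * j
/-- The program variable for the position in the list from which `j` is taken. -/
def posVar (j : Fin k) : ℕ := 21 + 2 * j

namespace Cmd

/-- Choose the values of further variables along the constraints in the list. -/
def levels (nv : ℕ) : List (Con k) → Cmd → Cmd
  | [], body => body
  | c :: l, body => loop nv (posVar c.j) (.get (lenArr c.b) (.var (vertexVar c.i)))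
      (seq (set nv (vertexVar c.j)
        (.get (outArr c.b) (.pair (.var (vertexVar c.i)) (.var (posVar c.j)))))
        (levels nv l body))

/-- Execute the body if all constraints in the list hold. -/
def checks (nv : ℕ) : List (Con k) → Cmd → Cmd
  | [], body => body
  | c :: l, body => ifLt nv (.num 0)
      (.get (matArr c.b) (.pair (.var (vertexVar c.i)) (.var (vertexVar c.j))))
      (checks nv l body) skip

end Cmd

/-- The sum of `F` over all choices along the constraints in the list. -/
def levelSum (O : Bool → Fin n → List (Fin n)) :
    List (Con k) → ((Fin k → Fin n) → ℕ) → (Fin k → Fin n) → ℕ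
  | [], F, x => F x
  | c :: l, F, x => ((O c.b (x c.i)).map fun u => levelSum O l F (Function.update x c.j u)).sum

/-- A bound for the time of `Cmd.levels` with a body of time `T`. -/
def levelTime (O : Bool → Fin n → List (Fin n)) (T : ℕ) :
    List (Con k) → (Fin k → Fin n) → ℕ
  | [], _ => T
  | c :: l, x => ((O c.b (x c.i)).map fun u =>
      levelTime O T l (Function.update x c.j u) + 40).sum + 40

/-- The command adds `F idx x` to cell `idx` of array `a` in time `T x`, where `x` is the assignment
stored in the variables in `A`, and changes no other array and only the variables for `S`. -/
def Accum (L : Layout) (s₀ : Store) (a : ℕ) (A S : Finset (Fin k)) (c : Cmd)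
    (T : (Fin k → Fin n) → ℕ) (F : ℕ → (Fin k → Fin n) → ℕ) : Prop :=
  ∀ (s : Store) (x : Fin k → Fin n),
    (∀ r, (∀ j : Fin k, r ≠ vertexVar j ∧ r ≠ posVar j) → s.v r = s₀.v r) →
    (∀ b, b ≠ a → s.a b = s₀.a b) → (∀ i ∈ A, s.v (vertexVar i) = x i) →
    (∀ idx, s.a a idx + F idx x < 2 ^ L.w) →
    Tri L c s fun t s' => t ≤ T x ∧
      (∀ r, (∀ j ∈ S, r ≠ vertexVar j ∧ r ≠ posVar j) → s'.v r = s.v r) ∧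
      s'.a = Function.update s.a a fun idx => s.a a idx + F idx x

theorem outArr_lt (b : Bool) : outArr b < 14 := by cases b <;> decide
theorem lenArr_lt (b : Bool) : lenArr b < 14 := by cases b <;> decide
theorem matArr_lt (b : Bool) : matArr b < 14 := by cases b <;> decide

theorem vertexVar_inj {i j : Fin k} (h : vertexVar i = vertexVar j) : i = j := by
  unfold vertexVar at h; exact Fin.ext (by omega)

theorem vertexVar_ne_posVar (i j : Fin k) : vertexVar i ≠ posVar j := by
  unfold vertexVar posVar; omega

section
variable {O : Bool → Fin n → List (Fin n)} {s₀ : Store} {a : ℕ} {A S : Finset (Fin k)}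
  {body : Cmd} {T : (Fin k → Fin n) → ℕ} {F : ℕ → (Fin k → Fin n) → ℕ}

theorem take_succ_map_sum {α : Type*} (f : α → ℕ) {l : List α} {i : ℕ} (hi : i < l.length) :
    ((l.take (i + 1)).map f).sum = ((l.take i).map f).sum + f l[i] := by
  rw [List.take_add_one, List.getElem?_eq_getElem hi, List.map_append, List.sum_append]
  simp

theorem take_map_sum_le {α : Type*} (f : α → ℕ) (l : List α) (i : ℕ) :
    ((l.take i).map f).sum ≤ (l.map f).sum :=
  ((List.take_sublist i l).map f).sum_le_sum fun _ _ => Nat.zero_le _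

/-- One loop level: after `i` rounds the array has received the contributions of the first `i` list
entries. Since the body changes only the variables for `S`, which is disjoint from `A`, the values
fixed outside the loop survive it. -/
theorem Accum.choose (hL : Room L n) (hk : k ≤ 5) (hO : Ready O s₀) (ha : 14 ≤ a)
    (hOn : ∀ b u, (O b u).length ≤ n)
    {c : Con k} (hi : c.i ∈ A) (hj : c.j ∉ A) (hS : ∀ i ∈ A, i ∉ S)
    (h : Accum L s₀ a (insert c.j A) S body T F) :
    Accum L s₀ a A (insert c.j S)
      (Cmd.loop L.nv (posVar c.j) (.get (lenArr c.b) (.var (vertexVar c.i)))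
        (Cmd.seq (Cmd.set L.nv (vertexVar c.j)
          (.get (outArr c.b) (.pair (.var (vertexVar c.i)) (.var (posVar c.j))))) body))
      (fun x => ((O c.b (x c.i)).map fun u => T (Function.update x c.j u) + 40).sum + 40)
      (fun idx x => ((O c.b (x c.i)).map fun u => F idx (Function.update x c.j u)).sum) := by
  intro s x hv harr hA hlt
  have hK := hL.arrays
  have hnv := hL.vars
  have hvX : ∀ j : Fin k, vertexVar j < L.nv := fun j => by unfold vertexVar; omega
  have hvI : ∀ j : Fin k, posVar j < L.nv := fun j => by unfold posVar; omega
  have low : ∀ r, r < 20 → ∀ j : Fin k, r ≠ vertexVar j ∧ r ≠ posVar j := fun r hr j => by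
    unfold vertexVar posVar; omega
  have hlen : (Ex.get (lenArr c.b) (.var (vertexVar c.i))).eval s = (O c.b (x c.i)).length := by
    have := lenArr_lt c.b
    rw [Ex.eval, Ex.eval, hA _ hi, harr _ (by omega), (hO.outs _ _).1]
  set l := O c.b (x c.i) with hl
  have hij : c.i ≠ c.j := fun h => hj (h ▸ hi)
  refine Tri.loop (fun i t s' => t ≤ ((l.take i).map fun u =>
        T (Function.update x c.j u) + 40).sum ∧
      (∀ r, (∀ j ∈ insert c.j S, r ≠ vertexVar j ∧ r ≠ posVar j) → s'.v r = s.v r) ∧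
      s'.a = Function.update s.a a fun idx => s.a a idx +
        ((l.take i).map fun u => F idx (Function.update x c.j u)).sum)
    (hvI _) ⟨hvX _, by have := lenArr_lt c.b; omega, ?_⟩ ?_ ?_ ?_
  · rw [Ex.eval, hA _ hi]; exact hL.lt_len (x c.i).isLt.le
  · refine ⟨Nat.zero_le _, fun _ _ => rfl, ?_⟩
    simp
  · intro i hil t s' ⟨ht, hv', ha'⟩
    rw [hlen] at hil
    set u := l[i] with hu
    have hvi : (s'.setV (posVar c.j) i).v (vertexVar c.i) = x c.i := by
      rw [Store.setV_v_of_ne _ _ (vertexVar_ne_posVar _ _), hv', hA _ hi]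
      intro j hjS
      refine ⟨fun h => ?_, vertexVar_ne_posVar _ _⟩
      have := vertexVar_inj h
      subst this
      rcases Finset.mem_insert.1 hjS with h1 | h1
      · exact hij h1
      · exact hS _ hi h1
    have hv1 : (s'.setV (posVar c.j) i).v 1 = n + 1 := by
      rw [Store.setV_v_of_ne _ _ (low 1 (by omega) c.j).2, hv' 1 fun j _ => low 1 (by omega) j,
        hv 1 (low 1 (by omega)), hO.v1]
    have hvp : (s'.setV (posVar c.j) i).v (posVar c.j) = i := Store.setV_v_self _ _ _
    have ep : (Ex.pair (.var (vertexVar c.i)) (.var (posVar c.j))).eval (s'.setV (posVar c.j) i) =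
        x c.i + (n + 1) * i := by
      rw [Ex.pair_eval hv1, Ex.eval, Ex.eval, hvi, hvp]
    have hln : l.length ≤ n := hOn c.b (x c.i)
    have harr' : ∀ b, b ≠ a → s'.a b = s₀.a b := fun b hb => by
      rw [ha', Function.update_of_ne hb, harr b hb]
    have eu : (Ex.get (outArr c.b) (.pair (.var (vertexVar c.i)) (.var (posVar c.j)))).eval
        (s'.setV (posVar c.j) i) = u := by
      have := outArr_lt c.b
      rw [Ex.eval, ep, Store.setV_a, harr' _ (by omega), (hO.outs _ _).2 i hil]
    refine Tri.seq (Tri.set (hvX _) ⟨Ex.pair_ok hL hv1 (hvX _) (hvI _) ?_ ?_, ?_, ?_⟩ ?_)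
    · rw [Ex.eval, hvi]; omega
    · rw [Ex.eval, hvp]; omega
    · have := outArr_lt c.b; omega
    · rw [ep]; exact hL.pair_lt (by omega) (by omega)
    rw [eu]
    set s₂ := (s'.setV (posVar c.j) i).setV (vertexVar c.j) u with hs₂
    have hne : ∀ r, r ≠ vertexVar c.j → r ≠ posVar c.j → s₂.v r = s'.v r := fun r h1 h2 => by
      rw [hs₂, Store.setV_v_of_ne _ _ h1, Store.setV_v_of_ne _ _ h2]
    have hcell : ∀ idx, s₂.a a idx = s.a a idx +
        ((l.take i).map fun u => F idx (Function.update x c.j u)).sum := fun idx => by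
      rw [hs₂, Store.setV_a, Store.setV_a, ha', Function.update_self]
    refine (h s₂ (Function.update x c.j u) ?_ harr' ?_ ?_).mono ?_
    · intro r hr
      rw [hne r (hr _).1 (hr _).2, hv' r fun j _ => hr j, hv r hr]
    · intro j hjA
      by_cases hjj : j = c.j
      · subst hjj; rw [hs₂, Store.setV_v_self, Function.update_self]
      · have hjA' : j ∈ A := (Finset.mem_insert.1 hjA).resolve_left hjj
        rw [hne _ (fun h => hjj (vertexVar_inj h)) (vertexVar_ne_posVar _ _), hv',
          Function.update_of_ne hjj, hA _ hjA']
        intro j' hj'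
        refine ⟨fun h => ?_, vertexVar_ne_posVar _ _⟩
        have := vertexVar_inj h
        subst this
        rcases Finset.mem_insert.1 hj' with h1 | h1
        · exact hjj h1
        · exact hS _ hjA' h1
    -- Cells only grow, so a partial sum fits into a word as soon as the complete sum does.
    · intro idx
      rw [hcell, Nat.add_assoc, ← take_succ_map_sum (fun u => F idx (Function.update x c.j u)) hil]
      exact lt_of_le_of_lt (Nat.add_le_add_left (take_map_sum_le _ _ _) _) (hlt idx)
    · intro t₁ s₃ ⟨ht₁, hv₃, ha₃⟩
      refine ⟨?_, ?_, ?_⟩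
      · rw [take_succ_map_sum _ hil]
        change _ ≤ _ + (T (Function.update x c.j u) + 40)
        simp only [Ex.cost, Ex.pair]
        omega
      · intro r hr
        have h1 := hr c.j (Finset.mem_insert_self _ _)
        rw [hv₃ r fun j hj => hr j (Finset.mem_insert_of_mem hj), hne r h1.1 h1.2, hv' r hr]
      · rw [ha₃]
        have : s₂.a = s'.a := rfl
        rw [this, ha', Function.update_idem]
        congr 1
        funext idx
        rw [Function.update_self, take_succ_map_sum _ hil, Nat.add_assoc]
  · intro t s' ⟨ht, hv', ha'⟩
    rw [hlen, List.take_length] at ht ha'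
    refine ⟨?_, hv', ha'⟩
    change _ ≤ (l.map fun u => T (Function.update x c.j u) + 40).sum + 40
    simp only [Ex.cost]
    omega

/-- Each constraint in the list determines a new variable from a variable that is in `A` or has been
determined before. -/
def Grows : Finset (Fin k) → List (Con k) → Prop
  | _, [] => True
  | A, c :: l => c.i ∈ A ∧ c.j ∉ A ∧ Grows (insert c.j A) l

/-- The variables determined by the constraints in the list. -/
def heads (l : List (Con k)) : Finset (Fin k) := (l.map Con.j).toFinset

theorem heads_cons (c : Con k) (l : List (Con k)) : heads (c :: l) = insert c.j (heads l) := by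
  simp [heads]

theorem Grows.notMem_heads : ∀ {l : List (Con k)} {A : Finset (Fin k)}, Grows A l →
    ∀ i ∈ A, i ∉ heads l
  | [], _, _, _, _ => by simp [heads]
  | c :: l, A, h, i, hi => by
    rw [heads_cons, Finset.mem_insert, not_or]
    exact ⟨fun hh => h.2.1 (hh ▸ hi), h.2.2.notMem_heads i (Finset.mem_insert_of_mem hi)⟩

theorem Accum.levels (hL : Room L n) (hk : k ≤ 5) (hO : Ready O s₀) (ha : 14 ≤ a)
    (hOn : ∀ b u, (O b u).length ≤ n) {T : ℕ} :
    ∀ {l : List (Con k)} {A : Finset (Fin k)}, Grows A l →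
      Accum L s₀ a (A ∪ heads l) ∅ body (fun _ => T) F →
      Accum L s₀ a A (heads l) (Cmd.levels L.nv l body) (levelTime O T l)
        (fun idx => levelSum O l (F idx))
  | [], A, _, h => by
    have e : A ∪ heads [] = A := by simp [heads]
    rw [e] at h
    exact h
  | c :: l, A, hg, h => by
    rw [heads_cons]
    refine Accum.choose hL hk hO ha hOn hg.1 hg.2.1
      (fun i hi => hg.2.2.notMem_heads i (Finset.mem_insert_of_mem hi))
      (Accum.levels hL hk hO ha hOn hg.2.2 ?_)
    rw [heads_cons] at h
    rwa [Finset.insert_union, ← Finset.union_insert]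

theorem Accum.source (hL : Room L n) (hk : k ≤ 5) (hO : Ready O s₀) {v : Fin k}
    (h : Accum L s₀ a {v} S body T F) :
    Accum L s₀ a ∅ (insert v S) (Cmd.loop L.nv (vertexVar v) (.var 0) body)
      (fun x => ∑ u, (T (Function.update x v u) + 10) + 10)
      (fun idx x => ∑ u, F idx (Function.update x v u)) := by
  intro s x hv harr _ hlt
  have hK := hL.arrays
  have hnv := hL.vars
  have hvX : ∀ j : Fin k, vertexVar j < L.nv := fun j => by unfold vertexVar; omega
  have low : ∀ r, r < 20 → ∀ j : Fin k, r ≠ vertexVar j ∧ r ≠ posVar j := fun r hr j => by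
    unfold vertexVar posVar; omega
  have h0 : (Ex.var 0).eval s = (List.finRange n).length := by
    rw [Ex.eval, hv 0 (low 0 (by omega)), hO.v0, List.length_finRange]
  have hsum : ∀ f : Fin n → ℕ, ∑ u, f u = ((List.finRange n).map f).sum := fun f => by
    rw [← List.ofFn_eq_map, List.sum_ofFn]
  simp only [hsum] at hlt ⊢
  set l := List.finRange n with hl
  refine Tri.loop (fun i t s' => t ≤ ((l.take i).map fun u =>
        T (Function.update x v u) + 10).sum ∧
      (∀ r, (∀ j ∈ insert v S, r ≠ vertexVar j ∧ r ≠ posVar j) → s'.v r = s.v r) ∧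
      s'.a = Function.update s.a a fun idx => s.a a idx +
        ((l.take i).map fun u => F idx (Function.update x v u)).sum)
    (hvX _) (show 0 < L.nv by omega) ?_ ?_ ?_
  · refine ⟨Nat.zero_le _, fun _ _ => rfl, ?_⟩
    simp
  · intro i hil t s' ⟨ht, hv', ha'⟩
    rw [h0] at hil
    set u := l[i] with hu
    have hui : (u : ℕ) = i := by simp [hu, hl]
    set s₂ := s'.setV (vertexVar v) i with hs₂
    have harr' : ∀ b, b ≠ a → s₂.a b = s₀.a b := fun b hb => by
      rw [hs₂, Store.setV_a, ha', Function.update_of_ne hb, harr b hb]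
    have hcell : ∀ idx, s₂.a a idx = s.a a idx +
        ((l.take i).map fun u => F idx (Function.update x v u)).sum := fun idx => by
      rw [hs₂, Store.setV_a, ha', Function.update_self]
    refine (h s₂ (Function.update x v u) ?_ harr' ?_ ?_).mono ?_
    · intro r hr
      rw [hs₂, Store.setV_v_of_ne _ _ (hr _).1, hv' r fun j _ => hr j, hv r hr]
    · intro j hj
      rw [Finset.mem_singleton] at hj
      subst hj
      rw [hs₂, Store.setV_v_self, Function.update_self, hui]
    · intro idx
      rw [hcell, Nat.add_assoc, ← take_succ_map_sum (fun u => F idx (Function.update x v u)) hil]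
      exact lt_of_le_of_lt (Nat.add_le_add_left (take_map_sum_le _ _ _) _) (hlt idx)
    · intro t₁ s₃ ⟨ht₁, hv₃, ha₃⟩
      refine ⟨?_, ?_, ?_⟩
      · rw [take_succ_map_sum _ hil]
        change _ ≤ _ + (T (Function.update x v u) + 10)
        omega
      · intro r hr
        have h1 := hr v (Finset.mem_insert_self _ _)
        rw [hv₃ r fun j hj => hr j (Finset.mem_insert_of_mem hj), hs₂,
          Store.setV_v_of_ne _ _ h1.1, hv' r hr]
      · rw [ha₃]
        have : s₂.a = s'.a := rfl
        rw [this, ha', Function.update_idem]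
        congr 1
        funext idx
        rw [Function.update_self, take_succ_map_sum _ hil, Nat.add_assoc]
  · intro t s' ⟨ht, hv', ha'⟩
    rw [h0, List.take_length] at ht ha'
    exact ⟨by simp only [Ex.cost]; omega, hv', ha'⟩

/-- A matrix entry is 0 or 1, so each constraint is tested in constant time; a failing one makes the
body contribute nothing. -/
theorem Accum.checks (hL : Room L n) (hk : k ≤ 5) (hO : Ready O s₀) (ha : 14 ≤ a) {T : ℕ}
    (h : Accum L s₀ a A S body (fun _ => T) F) :
    ∀ {cs : List (Con k)}, (∀ c ∈ cs, c.i ∈ A ∧ c.j ∈ A) →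
      Accum L s₀ a A S (Cmd.checks L.nv cs body) (fun _ => T + 20 * cs.length)
        (fun idx x => if ∀ c ∈ cs, c.Holds O x then F idx x else 0)
  | [], _ => by simpa [Cmd.checks] using h
  | c :: cs, hc => by
    intro s x hv harr hA hlt
    have ih := Accum.checks hL hk hO ha h (cs := cs)
      fun c hcs => hc c (List.mem_cons_of_mem _ hcs)
    have hK := hL.arrays
    have hnv := hL.vars
    have hw := hL.word
    have hmat := matArr_lt c.b
    have hvX : ∀ j : Fin k, vertexVar j < L.nv := fun j => by unfold vertexVar; omega
    have low : ∀ r, r < 20 → ∀ j : Fin k, r ≠ vertexVar j ∧ r ≠ posVar j := fun r hr j => by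
      unfold vertexVar posVar; omega
    have hv1 : s.v 1 = n + 1 := by rw [hv 1 (low 1 (by omega)), hO.v1]
    obtain ⟨hi, hj⟩ := hc c List.mem_cons_self
    have ei : (Ex.var (vertexVar c.i)).eval s = x c.i := hA _ hi
    have ej : (Ex.var (vertexVar c.j)).eval s = x c.j := hA _ hj
    have ep : (Ex.pair (.var (vertexVar c.i)) (.var (vertexVar c.j))).eval s =
        x c.i + (n + 1) * x c.j := by rw [Ex.pair_eval hv1, ei, ej]
    have em : (Ex.get (matArr c.b) (.pair (.var (vertexVar c.i)) (.var (vertexVar c.j)))).eval s =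
        if c.Holds O x then 1 else 0 := by
      rw [Ex.eval, ep, harr _ (by omega), hO.mat]; rfl
    have hxi := (x c.i).isLt
    have hxj := (x c.j).isLt
    refine Tri.ifLt (show 0 < _ by omega) ⟨Ex.pair_ok hL hv1 (hvX _) (hvX _) (by omega) (by omega),
      by omega, by rw [ep]; exact hL.pair_lt (by omega) (by omega)⟩ ?_ ?_
    · intro hpos
      rw [em, Ex.eval] at hpos
      have hh : c.Holds O x := by by_contra hn; simp [hn] at hpos
      have hiff : (∀ c' ∈ c :: cs, c'.Holds O x) ↔ ∀ c' ∈ cs, c'.Holds O x := by simp [hh]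
      simp only [hiff] at hlt ⊢
      refine (ih s x hv harr hA hlt).mono ?_
      intro t s' ⟨ht, h1, h2⟩
      refine ⟨?_, h1, h2⟩
      change t ≤ T + 20 * cs.length at ht
      simp only [Ex.cost, Ex.pair, List.length_cons]
      omega
    · intro hpos
      rw [em, Ex.eval] at hpos
      have hh : ¬ c.Holds O x := by intro hn; simp [hn] at hpos
      have hiff : ¬ ∀ c' ∈ c :: cs, c'.Holds O x := by simp [hh]
      simp only [if_neg hiff]
      refine Tri.skip ⟨?_, fun _ _ => rfl, ?_⟩
      · simp only [Ex.cost, Ex.pair, List.length_cons]; omega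
      · simp

end

/-! ## Tables indexed by partial assignments -/

/-- The index of the values of the variables in `S`. -/
def keyOf (n : ℕ) (S : Finset (Fin k)) (x : Fin k → Fin n) : ℕ :=
  Nat.ofDigits (n + 1) ((List.finRange k).map fun i => if i ∈ S then (x i : ℕ) else 0)

/-- The expression for the index of the values of the variables in `S`. -/
def keyEx (S : Finset (Fin k)) : List (Fin k) → Ex
  | [] => .num 0
  | i :: l => .add (if i ∈ S then .var (vertexVar i) else .num 0) (.mul (.var 1) (keyEx S l))

/-- Variables outside `S` are masked by the digit 0, so every key has exactly `k` digits in base `n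
+ 1`, and such expansions of equal length are unique. -/
theorem keyOf_inj {S : Finset (Fin k)} {x y : Fin k → Fin n} :
    keyOf n S x = keyOf n S y ↔ ∀ i ∈ S, x i = y i := by
  constructor
  · intro h i hi
    -- A base above 1 is available because `x i` is an element of `Fin n`.
    have hn : 1 < n + 1 := by have := (x i).isLt; omega
    have h1 := Nat.ofDigits_inj_of_len_eq hn (by simp) (by
      intro d hd
      obtain ⟨j, _, rfl⟩ := List.mem_map.1 hd
      split_ifs
      · have := (x j).isLt; omega
      · omega) (by
      intro d hd
      obtain ⟨j, _, rfl⟩ := List.mem_map.1 hd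
      split_ifs
      · have := (y j).isLt; omega
      · omega) h
    have h2 := List.map_inj_left.1 h1 i (List.mem_finRange i)
    rw [if_pos hi, if_pos hi] at h2
    exact Fin.ext h2
  · intro h
    unfold keyOf
    congr 1
    refine List.map_congr_left fun i _ => ?_
    split_ifs with hi
    · rw [h i hi]
    · rfl

theorem ofDigits_mask_lt (S : Finset (Fin k)) (x : Fin k → Fin n) (l : List (Fin k)) :
    Nat.ofDigits (n + 1) (l.map fun i => if i ∈ S then (x i : ℕ) else 0) < (n + 1) ^ l.length := by
  induction l with
  | nil => simp
  | cons i l ih =>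
    rw [List.map_cons, Nat.ofDigits_cons, List.length_cons, Nat.pow_succ]
    have h1 : (if i ∈ S then (x i : ℕ) else 0) ≤ n := by
      split_ifs
      · exact (x i).isLt.le
      · exact Nat.zero_le _
    have h2 : ((if i ∈ S then (x i : ℕ) else 0 : ℕ) : ℕ) +
        (n + 1) * Nat.ofDigits (n + 1) (l.map fun i => if i ∈ S then (x i : ℕ) else 0) <
        (n + 1) ^ l.length * (n + 1) := by nlinarith
    exact h2

/-- Horner's scheme. Every intermediate value is bounded by a number with at most five digits, so
nothing overflows as long as `(n + 1) ^ 5` fits. -/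
theorem keyEx_spec (hB : (n + 1) ^ 5 ≤ L.B) (hnv : 50 ≤ L.nv) (hk : k ≤ 5)
    {s : Store} (h1 : s.v 1 = n + 1) (S : Finset (Fin k)) {x : Fin k → Fin n}
    (hx : ∀ i ∈ S, s.v (vertexVar i) = x i) : ∀ l : List (Fin k), l.length ≤ 5 →
      (keyEx S l).Ok L s ∧ (keyEx S l).eval s =
        Nat.ofDigits (n + 1) (l.map fun i => if i ∈ S then (x i : ℕ) else 0) ∧
      (keyEx S l).cost ≤ 6 * l.length + 1
  | [], _ => ⟨Nat.two_pow_pos _, by simp [keyEx, Ex.eval], by simp [keyEx, Ex.cost]⟩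
  | i :: l, hl => by
    rw [List.length_cons] at hl
    obtain ⟨ok, ev, co⟩ := keyEx_spec hB hnv hk h1 S hx l (by omega)
    have hlt := L.len_lt
    have hlt1 := ofDigits_mask_lt S x (i :: l)
    have hpow : (n + 1) ^ (i :: l).length ≤ (n + 1) ^ 5 :=
      Nat.pow_le_pow_right (Nat.succ_pos _) (by simpa using hl)
    have hi : (if i ∈ S then Ex.var (vertexVar i) else .num 0).eval s =
        if i ∈ S then (x i : ℕ) else 0 := by
      split_ifs with h
      · exact hx i h
      · rfl
    have e : (keyEx S (i :: l)).eval s =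
        Nat.ofDigits (n + 1) ((i :: l).map fun i => if i ∈ S then (x i : ℕ) else 0) := by
      rw [keyEx, Ex.eval, Ex.eval, Ex.eval, hi, h1, ev, List.map_cons, Nat.ofDigits_cons]
    refine ⟨⟨?_, ⟨show 1 < L.nv by omega, ok, ?_⟩, ?_⟩, e, ?_⟩
    · split_ifs
      · show vertexVar i < L.nv
        unfold vertexVar; omega
      · exact Nat.two_pow_pos _
    · rw [keyEx, Ex.eval] at e
      have : (Ex.mul (.var 1) (keyEx S l)).eval s ≤ Nat.ofDigits (n + 1)
        ((i :: l).map fun i => if i ∈ S then (x i : ℕ) else 0) := by rw [← e]; omega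
      rw [Ex.eval] at this
      omega
    · rw [keyEx, Ex.eval] at e
      omega
    · rw [keyEx, Ex.cost, Ex.cost, Ex.cost, List.length_cons]
      split_ifs <;> simp only [Ex.cost] <;> omega

/-- The product of the entries at the current assignment of the tables in the list; a table is given
by its array and the variables that index it. -/
def prodEx : List (ℕ × Finset (Fin k)) → Ex
  | [] => .num 1
  | p :: l => .mul (.get p.1 (keyEx p.2 (List.finRange k))) (prodEx l)

/-- The value of `prodEx`. -/
def tableProd (s : Store) (l : List (ℕ × Finset (Fin k))) (x : Fin k → Fin n) : ℕ :=
  (l.map fun p => s.a p.1 (keyOf n p.2 x)).prod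

theorem prodEx_spec (hB : (n + 1) ^ 5 ≤ L.B) (hnv : 50 ≤ L.nv) (hk : k ≤ 5)
    {s s₀ : Store} (h1 : s.v 1 = n + 1) {x : Fin k → Fin n} {A : Finset (Fin k)}
    (hx : ∀ i ∈ A, s.v (vertexVar i) = x i) {U : ℕ} (hU : 1 ≤ U) :
    ∀ l : List (ℕ × Finset (Fin k)), (∀ p ∈ l, p.1 < L.K ∧ p.2 ⊆ A ∧ s.a p.1 = s₀.a p.1 ∧
        ∀ x : Fin k → Fin n, s₀.a p.1 (keyOf n p.2 x) ≤ U) → U ^ l.length < 2 ^ L.w →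
      (prodEx l).Ok L s ∧ (prodEx l).eval s = tableProd s₀ l x ∧
      tableProd s₀ l x ≤ U ^ l.length ∧ (prodEx l).cost ≤ 40 * l.length + 1
  | [], _, h => ⟨h, by simp [prodEx, Ex.eval, tableProd], by simp [tableProd],
      by simp [prodEx, Ex.cost]⟩
  | p :: l, hl, h => by
    have hpow : U ^ l.length ≤ U ^ (p :: l).length := Nat.pow_le_pow_right hU (by simp)
    obtain ⟨ok, ev, le, co⟩ := prodEx_spec hB hnv hk h1 hx hU l
      (fun q hq => hl q (List.mem_cons_of_mem _ hq)) (lt_of_le_of_lt hpow h)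
    obtain ⟨hp1, hp2, hp3, hp4⟩ := hl p List.mem_cons_self
    obtain ⟨ok', ev', co'⟩ := keyEx_spec hB hnv hk h1 p.2 (fun i hi => hx i (hp2 hi))
      (List.finRange k) (by simpa using hk)
    rw [← keyOf] at ev'
    have hkey : keyOf n p.2 x < L.B := by
      refine lt_of_lt_of_le (ofDigits_mask_lt p.2 x (List.finRange k)) (le_trans ?_ hB)
      rw [List.length_finRange]
      exact Nat.pow_le_pow_right (Nat.succ_pos _) hk
    have e1 : (Ex.get p.1 (keyEx p.2 (List.finRange k))).eval s = s₀.a p.1 (keyOf n p.2 x) := by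
      rw [Ex.eval, ev', hp3]
    have e : (prodEx (p :: l)).eval s = tableProd s₀ (p :: l) x := by
      rw [prodEx, Ex.eval, e1, ev]; simp [tableProd]
    have hle : tableProd s₀ (p :: l) x ≤ U ^ (p :: l).length := by
      have : tableProd s₀ (p :: l) x = s₀.a p.1 (keyOf n p.2 x) * tableProd s₀ l x := by
        simp [tableProd]
      rw [this, List.length_cons, Nat.pow_succ, Nat.mul_comm]
      exact Nat.mul_le_mul le (hp4 x)
    refine ⟨⟨⟨ok', hp1, by rw [ev']; exact hkey⟩, ok, ?_⟩, e, hle, ?_⟩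
    · rw [prodEx, Ex.eval] at e
      rw [e]; omega
    · rw [prodEx, Ex.cost, Ex.cost, List.length_cons]
      rw [List.length_finRange] at co'
      omega

namespace Cmd

/-- Add the product of the tables `kids` to the entry of table `a` for the variables in `S`. -/
def tally (nv k a : ℕ) (S : Finset (Fin k)) (kids : List (ℕ × Finset (Fin k))) : Cmd :=
  put nv a (keyEx S (List.finRange k)) (.add (.get a (keyEx S (List.finRange k))) (prodEx kids))

/-- Fill table `a`, indexed by the variables in `S`, with the number of solutions of the constraints
`cs`, weighted by the products of the tables `kids`. The solutions are found from the value of `v`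
along the constraints `l`. -/
def table (nv a : ℕ) (v : Fin k) (l cs : List (Con k)) (S : Finset (Fin k))
    (kids : List (ℕ × Finset (Fin k))) : Cmd :=
  loop nv (vertexVar v) (.var 0) (levels nv l (checks nv cs (tally nv k a S kids)))

end Cmd

/-- The tables in `kids` are different from `a`, so their entries are still those of `s₀` even while
`a` is being filled. -/
theorem Accum.tally (hL : Room L n) (hB : (n + 1) ^ 5 ≤ L.B) (hk : k ≤ 5) {s₀ : Store} {a : ℕ}
    (h1 : s₀.v 1 = n + 1) (haK : a < L.K) {S A : Finset (Fin k)} (hS : S ⊆ A)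
    {kids : List (ℕ × Finset (Fin k))} {U : ℕ} (hU : 1 ≤ U)
    (hkids : ∀ p ∈ kids, p.1 < L.K ∧ p.1 ≠ a ∧ p.2 ⊆ A ∧
      ∀ x : Fin k → Fin n, s₀.a p.1 (keyOf n p.2 x) ≤ U) (hUw : U ^ kids.length < 2 ^ L.w) :
    Accum (n := n) L s₀ a A ∅ (Cmd.tally L.nv k a S kids)
      (fun _ => 40 * kids.length + 100)
      (fun idx x => if idx = keyOf n S x then tableProd s₀ kids x else 0) := by
  intro s x hv harr hA hlt
  have hnv := hL.vars
  have hv1 : s.v 1 = n + 1 := by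
    rw [hv 1 fun j => by unfold vertexVar posVar; omega, h1]
  obtain ⟨ok, ev, co⟩ := keyEx_spec hB hnv hk hv1 S (fun i hi => hA i (hS hi))
    (List.finRange k) (by simpa using hk)
  rw [← keyOf] at ev
  rw [List.length_finRange] at co
  obtain ⟨ok', ev', _, co'⟩ := prodEx_spec (s₀ := s₀) hB hnv hk hv1 hA hU kids
    (fun p hp => ⟨(hkids p hp).1, (hkids p hp).2.2.1, harr _ (hkids p hp).2.1, (hkids p hp).2.2.2⟩)
    hUw
  have hkey : keyOf n S x < L.B := by
    refine lt_of_lt_of_le (ofDigits_mask_lt S x (List.finRange k)) (le_trans ?_ hB)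
    rw [List.length_finRange]
    exact Nat.pow_le_pow_right (Nat.succ_pos _) hk
  have hlt' := hlt (keyOf n S x)
  change _ + (if keyOf n S x = keyOf n S x then _ else 0) < _ at hlt'
  rw [if_pos rfl] at hlt'
  have eg : (Ex.get a (keyEx S (List.finRange k))).eval s = s.a a (keyOf n S x) := by
    rw [Ex.eval, ev]
  refine Tri.put haK (by rw [ev]; exact hkey) ok ⟨⟨ok, haK, by rw [ev]; exact hkey⟩, ok', ?_⟩
    ⟨?_, fun _ _ => rfl, ?_⟩
  · rw [eg, ev']; exact hlt'
  · simp only [Ex.cost]; omega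
  · rw [ev, Ex.eval, eg, ev', Store.setA]
    change Function.update s.a a _ = Function.update s.a a _
    refine congrArg _ (funext fun idx => ?_)
    by_cases hidx : idx = keyOf n S x
    · subst hidx; simp
    · simp [hidx]

theorem Accum.table (hL : Room L n) (hB : (n + 1) ^ 5 ≤ L.B) (hk : k ≤ 5)
    {O : Bool → Fin n → List (Fin n)} {s₀ : Store} {a : ℕ}
    (hO : Ready O s₀) (hOn : ∀ b u, (O b u).length ≤ n) (ha : 14 ≤ a) (haK : a < L.K)
    {v : Fin k} {l cs : List (Con k)} {S : Finset (Fin k)} (hl : Grows {v} l)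
    (hS : S ⊆ {v} ∪ heads l) (hcs : ∀ c ∈ cs, c.i ∈ {v} ∪ heads l ∧ c.j ∈ {v} ∪ heads l)
    {kids : List (ℕ × Finset (Fin k))} {U : ℕ} (hU : 1 ≤ U)
    (hkids : ∀ p ∈ kids, p.1 < L.K ∧ p.1 ≠ a ∧ p.2 ⊆ {v} ∪ heads l ∧
      ∀ x : Fin k → Fin n, s₀.a p.1 (keyOf n p.2 x) ≤ U) (hUw : U ^ kids.length < 2 ^ L.w) :
    Accum (n := n) L s₀ a ∅ (insert v (heads l)) (Cmd.table L.nv a v l cs S kids)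
      (fun x => ∑ u, (levelTime O (40 * kids.length + 100 + 20 * cs.length) l
        (Function.update x v u) + 10) + 10)
      (fun idx x => ∑ u, levelSum O l (fun y => if ∀ c ∈ cs, c.Holds O y then
        if idx = keyOf n S y then tableProd s₀ kids y else 0 else 0) (Function.update x v u)) :=
  Accum.source hL hk hO (Accum.levels hL hk hO ha hOn hl (Accum.checks hL hk hO ha
    (Accum.tally hL hB hk hO.v1 haK hS hU hkids hUw) hcs))

end WordRAM

namespace WordRAM

variable {n k : ℕ}

/-! ## Summation over some of the variables -/

/-- The sum of `F` over all assignments that agree with `x` outside `P`. -/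
def sumOff (P : Finset (Fin k)) (F : (Fin k → Fin n) → ℕ) (x : Fin k → Fin n) : ℕ :=
  ∑ y with ∀ i, i ∉ P → y i = x i, F y

theorem sumOff_congr {P : Finset (Fin k)} {F F' : (Fin k → Fin n) → ℕ} {x : Fin k → Fin n}
    (h : ∀ y, (∀ i, i ∉ P → y i = x i) → F y = F' y) : sumOff P F x = sumOff P F' x :=
  Finset.sum_congr rfl fun y hy => h y (Finset.mem_filter.1 hy).2

theorem sumOff_empty (F : (Fin k → Fin n) → ℕ) (x : Fin k → Fin n) : sumOff ∅ F x = F x := by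
  have : (Finset.univ.filter fun y : Fin k → Fin n => ∀ i, i ∉ (∅ : Finset (Fin k)) → y i = x i) =
      {x} := by
    ext y; simp [funext_iff]
  rw [sumOff, this, Finset.sum_singleton]

theorem sumOff_univ (F : (Fin k → Fin n) → ℕ) (x : Fin k → Fin n) :
    sumOff Finset.univ F x = ∑ y, F y := by
  simp [sumOff]

theorem sumOff_insert {P : Finset (Fin k)} {j : Fin k} (hj : j ∉ P) (F : (Fin k → Fin n) → ℕ)
    (x : Fin k → Fin n) :
    sumOff (insert j P) F x = ∑ u, sumOff P F (Function.update x j u) := by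
  rw [sumOff, ← Finset.sum_fiberwise _ (fun y => y j)]
  refine Finset.sum_congr rfl fun u _ => ?_
  rw [sumOff, Finset.filter_filter]
  refine Finset.sum_congr (Finset.filter_congr fun y _ => ?_) fun _ _ => rfl
  constructor
  · rintro ⟨h, rfl⟩ i hi
    by_cases hij : i = j
    · subst hij; simp
    · rw [Function.update_of_ne hij, h i (by simp [hij, hi])]
  · intro h
    refine ⟨fun i hi => ?_, by rw [h j hj, Function.update_self]⟩
    rw [Finset.mem_insert, not_or] at hi
    rw [h i hi.2, Function.update_of_ne hi.1]

theorem sumOff_union {P Q : Finset (Fin k)} (h : Disjoint P Q) (F : (Fin k → Fin n) → ℕ) :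
    ∀ x : Fin k → Fin n, sumOff (P ∪ Q) F x = sumOff P (sumOff Q F) x := by
  induction P using Finset.induction_on with
  | empty => intro x; rw [Finset.empty_union, sumOff_empty]
  | insert j P hj ih =>
    intro x
    rw [Finset.disjoint_insert_left] at h
    rw [Finset.insert_union, sumOff_insert (by simp [hj, h.1]), sumOff_insert hj]
    exact Finset.sum_congr rfl fun u _ => ih h.2 _

theorem sumOff_mul {P : Finset (Fin k)} {A F : (Fin k → Fin n) → ℕ}
    (hA : DependsOn A (Pᶜ : Finset (Fin k))) (x : Fin k → Fin n) :
    sumOff P (fun y => A y * F y) x = A x * sumOff P F x := by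
  rw [sumOff, sumOff, Finset.mul_sum]
  refine Finset.sum_congr rfl fun y hy => ?_
  rw [hA fun i hi => (Finset.mem_filter.1 hy).2 i (by simpa using hi)]

theorem dependsOn_sumOff {P R : Finset (Fin k)} {H : (Fin k → Fin n) → ℕ} (hH : DependsOn H R) :
    DependsOn (sumOff P H) (R \ P : Finset (Fin k)) := by
  intro x y hxy
  refine Finset.sum_nbij' (fun z i => if i ∈ P then z i else y i)
    (fun z i => if i ∈ P then z i else x i) ?_ ?_ ?_ ?_ ?_
  · intro z _
    refine Finset.mem_filter.2 ⟨Finset.mem_univ _, fun i hi => if_neg hi⟩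
  · intro z _
    refine Finset.mem_filter.2 ⟨Finset.mem_univ _, fun i hi => if_neg hi⟩
  · intro z hz
    funext i
    by_cases hi : i ∈ P
    · simp [hi]
    · simp [hi, (Finset.mem_filter.1 hz).2 i hi]
  · intro z hz
    funext i
    by_cases hi : i ∈ P
    · simp [hi]
    · simp [hi, (Finset.mem_filter.1 hz).2 i hi]
  · intro z hz
    refine hH fun i hi => ?_
    by_cases hiP : i ∈ P
    · simp [hiP]
    · rw [if_neg hiP, (Finset.mem_filter.1 hz).2 i hiP]
      exact hxy i (by simpa [hiP] using hi)

/-- Summation over the assignments of `R` with prescribed values on `S`. -/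
theorem sumOff_prescribed {R S : Finset (Fin k)} (hS : S ⊆ R) {H : (Fin k → Fin n) → ℕ}
    (hH : DependsOn H R) (x z : Fin k → Fin n) :
    sumOff R (fun y => if ∀ i ∈ S, z i = y i then H y else 0) x = sumOff (R \ S) H z := by
  rw [sumOff, ← Finset.sum_filter, Finset.filter_filter]
  refine Finset.sum_nbij' (fun y i => if i ∈ R then y i else z i)
    (fun y i => if i ∈ R then y i else x i) ?_ ?_ ?_ ?_ ?_
  · intro y hy
    refine Finset.mem_filter.2 ⟨Finset.mem_univ _, fun i hi => ?_⟩
    have h2 := (Finset.mem_filter.1 hy).2.2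
    by_cases hiR : i ∈ R
    · have hiS : i ∈ S := by by_contra hn; exact hi (Finset.mem_sdiff.2 ⟨hiR, hn⟩)
      simp only [if_pos hiR, h2 i hiS]
    · simp only [if_neg hiR]
  · intro y hy
    have h2 := (Finset.mem_filter.1 hy).2
    refine Finset.mem_filter.2 ⟨Finset.mem_univ _, fun i hi => if_neg hi, fun i hi => ?_⟩
    simp only [if_pos (hS hi), h2 i (by simp [hi] : i ∉ R \ S)]
  · intro y hy
    have h1 := (Finset.mem_filter.1 hy).2.1
    funext i
    by_cases hi : i ∈ R
    · simp [hi]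
    · simp [hi, h1 i hi]
  · intro y hy
    have h1 := (Finset.mem_filter.1 hy).2
    funext i
    by_cases hi : i ∈ R
    · simp [hi]
    · simp [hi, h1 i (by simp [hi])]
  · intro y _
    refine hH fun i hi => ?_
    rw [if_pos (by simpa using hi)]

/-- Distributivity: the private variables `P s'` of one factor do not occur in any other factor, so
the sum of the product splits into the product of the sums. Only the disjointness of `R s` from `P
s'` is needed; the sets `R s` themselves may overlap. -/
theorem sumOff_biUnion {ι : Type*} [DecidableEq ι] (T : Finset ι) (P R : ι → Finset (Fin k))
    (h : ι → (Fin k → Fin n) → ℕ) (hP : ∀ s ∈ T, P s ⊆ R s) (hdep : ∀ s ∈ T, DependsOn (h s) (R s))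
    (hdis : ∀ s ∈ T, ∀ s' ∈ T, s' ≠ s → Disjoint (R s) (P s')) (x : Fin k → Fin n) :
    sumOff (T.biUnion P) (fun y => ∏ s ∈ T, h s y) x = ∏ s ∈ T, sumOff (P s) (h s) x := by
  induction T using Finset.induction_on generalizing x with
  | empty => simp [sumOff_empty]
  | insert s T hs ih =>
    have ih' := ih (fun t ht => hP t (Finset.mem_insert_of_mem ht))
      (fun t ht => hdep t (Finset.mem_insert_of_mem ht))
      (fun t ht t' ht' => hdis t (Finset.mem_insert_of_mem ht) t' (Finset.mem_insert_of_mem ht'))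
    have hne : ∀ t ∈ T, t ≠ s := fun t ht h => hs (h ▸ ht)
    have hd : Disjoint (R s) (T.biUnion P) := by
      rw [Finset.disjoint_biUnion_right]
      exact fun t ht => hdis s (Finset.mem_insert_self _ _) t (Finset.mem_insert_of_mem ht)
        (hne t ht)
    have hsP := hP s (Finset.mem_insert_self _ _)
    rw [Finset.biUnion_insert, sumOff_union (Finset.disjoint_of_subset_left hsP hd),
      Finset.prod_insert hs]
    have e1 : ∀ y, sumOff (T.biUnion P) (fun y => ∏ t ∈ insert s T, h t y) y =
        h s y * ∏ t ∈ T, sumOff (P t) (h t) y := by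
      intro y
      simp only [Finset.prod_insert hs]
      rw [sumOff_mul, ih']
      intro a b hab
      refine hdep s (Finset.mem_insert_self _ _) fun i hi => hab i ?_
      have := Finset.disjoint_left.1 hd (by simpa using hi)
      simpa using this
    rw [sumOff_congr fun y _ => e1 y]
    have e2 : ∀ y, h s y * ∏ t ∈ T, sumOff (P t) (h t) y =
        (∏ t ∈ T, sumOff (P t) (h t) y) * h s y := fun y => Nat.mul_comm _ _
    rw [sumOff_congr fun y _ => e2 y, sumOff_mul, Nat.mul_comm]
    intro a b hab
    refine Finset.prod_congr rfl fun t ht => ?_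
    refine dependsOn_sumOff (hdep t (Finset.mem_insert_of_mem ht)) fun i hi => hab i ?_
    have h1 := hdis t (Finset.mem_insert_of_mem ht) s (Finset.mem_insert_self _ _) (hne t ht).symm
    have h2 : i ∈ R t := by
      have : i ∈ R t \ P t := by simpa using hi
      exact (Finset.mem_sdiff.1 this).1
    have := Finset.disjoint_left.1 h1 h2
    simpa using this

/-- Confining each new variable to its list loses nothing, because `F` vanishes wherever a
constraint of `l` fails; as the lists have no repetitions, nothing is counted twice. -/
theorem levelSum_eq_sumOff {O : Bool → Fin n → List (Fin n)} (hO : ∀ b u, (O b u).Nodup) :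
    ∀ {l : List (Con k)} {A : Finset (Fin k)} (_ : Grows A l) {F : (Fin k → Fin n) → ℕ}
      (_ : ∀ y, F y ≠ 0 → ∀ c ∈ l, c.Holds O y) (x : Fin k → Fin n),
      levelSum O l F x = sumOff (heads l) F x
  | [], _, _, F, _, x => by
    rw [levelSum, show heads ([] : List (Con k)) = ∅ from rfl, sumOff_empty]
  | c :: l, A, hg, F, hF, x => by
    have ih := levelSum_eq_sumOff hO hg.2.2 (F := F)
      fun y hy c' hc' => hF y hy c' (List.mem_cons_of_mem _ hc')
    have hnot := hg.2.2.notMem_heads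
    rw [levelSum, heads_cons, sumOff_insert (hnot _ (Finset.mem_insert_self _ _))]
    simp only [ih]
    rw [← List.sum_toFinset _ (hO _ _)]
    refine Finset.sum_subset (Finset.subset_univ _) fun u _ hu => ?_
    refine Finset.sum_eq_zero fun y hy => ?_
    by_contra hne
    have h1 := hF y hne c List.mem_cons_self
    have h2 := (Finset.mem_filter.1 hy).2
    -- Neither end of `c` is summed over any more: `c.i` keeps its value from `x` and `c.j` has the
    -- value `u`, so the constraint says that `u` is in the list.
    have hij : c.i ≠ c.j := fun h => hg.2.1 (h ▸ hg.1)
    rw [Con.Holds, h2 _ (hnot _ (Finset.mem_insert_of_mem hg.1)),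
      h2 _ (hnot _ (Finset.mem_insert_self _ _)), Function.update_self,
      Function.update_of_ne hij] at h1
    exact hu (List.mem_toFinset.2 h1)

theorem sum_levelSum_eq_sumOff {O : Bool → Fin n → List (Fin n)} (hO : ∀ b u, (O b u).Nodup)
    {l : List (Con k)} {v : Fin k} (hg : Grows {v} l) {F : (Fin k → Fin n) → ℕ}
    (hF : ∀ y, F y ≠ 0 → ∀ c ∈ l, c.Holds O y) (x : Fin k → Fin n) :
    ∑ u, levelSum O l F (Function.update x v u) = sumOff (insert v (heads l)) F x := by
  rw [sumOff_insert (hg.notMem_heads _ (Finset.mem_singleton_self v))]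
  exact Finset.sum_congr rfl fun u _ => levelSum_eq_sumOff hO hg hF _

/-! ## Reachability along constraints -/

/-- There is a constraint from `i` to `j`. -/
def Link (cs : List (Con k)) (i j : Fin k) : Prop := ∃ c ∈ cs, c.i = i ∧ c.j = j

open Classical in
/-- The variables that can be reached from `s` along the constraints. -/
noncomputable def reach (cs : List (Con k)) (s : Fin k) : Finset (Fin k) :=
  Finset.univ.filter fun v => Relation.ReflTransGen (Link cs) s v

theorem mem_reach {cs : List (Con k)} {s v : Fin k} :
    v ∈ reach cs s ↔ Relation.ReflTransGen (Link cs) s v := by simp [reach]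

theorem self_mem_reach (cs : List (Con k)) (s : Fin k) : s ∈ reach cs s :=
  mem_reach.2 .refl

theorem reach_trans {cs : List (Con k)} {s u v : Fin k} (h : u ∈ reach cs s) (h' : v ∈ reach cs u) :
    v ∈ reach cs s := mem_reach.2 ((mem_reach.1 h).trans (mem_reach.1 h'))

theorem reach_con {cs : List (Con k)} {s : Fin k} {c : Con k} (hc : c ∈ cs) (h : c.i ∈ reach cs s) :
    c.j ∈ reach cs s := mem_reach.2 ((mem_reach.1 h).tail ⟨c, hc, rfl, rfl⟩)

theorem Grows.append : ∀ {l : List (Con k)} {A : Finset (Fin k)} {c : Con k}, Grows A l →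
    c.i ∈ A ∪ heads l → c.j ∉ A ∪ heads l → Grows A (l ++ [c])
  | [], A, c, _, hi, hj => by
    rw [show heads ([] : List (Con k)) = ∅ from rfl, Finset.union_empty] at hi hj
    exact ⟨hi, hj, trivial⟩
  | c' :: l, A, c, h, hi, hj => by
    rw [heads_cons, Finset.union_insert, ← Finset.insert_union] at hi hj
    exact ⟨h.1, h.2.1, h.2.2.append hi hj⟩

theorem Grows.card_le : ∀ {l : List (Con k)} {A : Finset (Fin k)}, Grows A l →
    A.card + l.length ≤ k
  | [], A, _ => by simpa using A.card_le_univ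
  | c :: l, A, h => by
    have := h.2.2.card_le
    rw [Finset.card_insert_of_notMem h.2.1] at this
    rw [List.length_cons]; omega

theorem heads_append (l : List (Con k)) (c : Con k) : heads (l ++ [c]) = insert c.j (heads l) := by
  ext; simp [heads]

/-- A spanning tree is grown greedily: if the variables found so far are not all that `s` reaches,
then some constraint leaves them. -/
theorem exists_grows (cs : List (Con k)) (s : Fin k) :
    ∃ l : List (Con k), Grows {s} l ∧ (∀ c ∈ l, c ∈ cs ∧ c.i ∈ reach cs s) ∧
      insert s (heads l) = reach cs s := by
  have main : ∀ m : ℕ, ∃ l : List (Con k), Grows {s} l ∧ (∀ c ∈ l, c ∈ cs ∧ c.i ∈ reach cs s) ∧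
      insert s (heads l) ⊆ reach cs s ∧ (m ≤ l.length ∨ insert s (heads l) = reach cs s) := by
    intro m
    induction m with
    | zero =>
      refine ⟨[], trivial, by simp, ?_, Or.inl le_rfl⟩
      intro v hv
      have : v = s := by simpa [heads] using hv
      exact this ▸ self_mem_reach cs s
    | succ m ih =>
      obtain ⟨l, h1, h2, h3, h4⟩ := ih
      by_cases heq : insert s (heads l) = reach cs s
      · exact ⟨l, h1, h2, h3, Or.inr heq⟩
      have hm := h4.resolve_right heq
      have hex : ∃ c ∈ cs, c.i ∈ insert s (heads l) ∧ c.j ∉ insert s (heads l) := by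
        by_contra hno
        push Not at hno
        refine heq (Finset.Subset.antisymm h3 fun v hv => ?_)
        have hv' := mem_reach.1 hv
        induction hv' with
        | refl => exact Finset.mem_insert_self _ _
        | tail h hl ih' =>
          obtain ⟨c, hc, rfl, rfl⟩ := hl
          exact hno c hc (ih' (mem_reach.2 h))
      obtain ⟨c, hc, hi, hj⟩ := hex
      refine ⟨l ++ [c], h1.append (by simpa using hi) (by simpa using hj), ?_, ?_, Or.inl ?_⟩
      · intro c' hc'
        rcases List.mem_append.1 hc' with h | h
        · exact h2 c' h
        · rw [List.mem_singleton] at h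
          subst h
          exact ⟨hc, h3 hi⟩
      · rw [heads_append, Finset.insert_comm]
        exact Finset.insert_subset (reach_con hc (h3 hi)) h3
      · simpa using hm
  obtain ⟨l, h1, h2, _, h4⟩ := main k
  -- A tree with `k` constraints would have `k + 1` variables.
  refine ⟨l, h1, h2, h4.resolve_left fun h => ?_⟩
  have := h1.card_le
  rw [Finset.card_singleton] at this
  omega

/-- The minimal variables, one from each class: `s` is only reached from variables that it reaches,
and it is the least of these. -/
def IsSource (cs : List (Con k)) (s : Fin k) : Prop := ∀ u, s ∈ reach cs u → u ∈ reach cs s ∧ s ≤ u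

open Classical in
/-- The finite set of sources. -/
noncomputable def sources (cs : List (Con k)) : Finset (Fin k) :=
  Finset.univ.filter (IsSource cs)

theorem mem_sources {cs : List (Con k)} {s : Fin k} : s ∈ sources cs ↔ IsSource cs s := by
  simp [sources]

theorem IsSource.eq_of_mem {cs : List (Con k)} {s s' : Fin k} (hs : IsSource cs s)
    (hs' : IsSource cs s') (h : s ∈ reach cs s') : s = s' :=
  le_antisymm (hs s' h).2 (hs' s (hs s' h).1).2

/-- A variable with fewest predecessors among those that reach `v` is reached only from its own
strongly connected class; the least member of the class is the source. -/
theorem exists_source (cs : List (Con k)) (v : Fin k) : ∃ s ∈ sources cs, v ∈ reach cs s := by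
  classical
  -- a variable that reaches `v` and is reached from as few variables as possible
  let below : Fin k → Finset (Fin k) := fun u => Finset.univ.filter fun w => u ∈ reach cs w
  obtain ⟨u, hu, hmin⟩ := Finset.exists_min_image
    (Finset.univ.filter fun u => v ∈ reach cs u) (fun u => (below u).card)
    ⟨v, by simp [self_mem_reach]⟩
  have hu' : v ∈ reach cs u := (Finset.mem_filter.1 hu).2
  have hminimal : ∀ w, u ∈ reach cs w → w ∈ reach cs u := by
    intro w hw
    have h1 := hmin w (Finset.mem_filter.2 ⟨Finset.mem_univ _, reach_trans hw hu'⟩)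
    have h2 : below w ⊆ below u := fun z hz =>
      Finset.mem_filter.2 ⟨Finset.mem_univ _, reach_trans (Finset.mem_filter.1 hz).2 hw⟩
    have h3 := Finset.eq_of_subset_of_card_le h2 h1
    have h4 : u ∈ below w := by
      rw [h3]; exact Finset.mem_filter.2 ⟨Finset.mem_univ _, self_mem_reach cs u⟩
    exact (Finset.mem_filter.1 h4).2
  obtain ⟨s, hs, hsmin⟩ := Finset.exists_min_image
    (Finset.univ.filter fun w => u ∈ reach cs w) id ⟨u, by simp [self_mem_reach]⟩
  have hs' : u ∈ reach cs s := (Finset.mem_filter.1 hs).2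
  refine ⟨s, mem_sources.2 fun w hw => ⟨?_, ?_⟩, reach_trans hs' hu'⟩
  · exact reach_trans hs' (hminimal w (reach_trans hw hs'))
  · exact hsmin w (Finset.mem_filter.2 ⟨Finset.mem_univ _, reach_trans hw hs'⟩)

/-- The constraints connect all variables. -/
def LinkConnected (cs : List (Con k)) : Prop :=
  ∀ A : Finset (Fin k), A.Nonempty → (∀ c ∈ cs, c.i ∈ A ↔ c.j ∈ A) → A = Finset.univ

/-- A system of constraints on at most five variables has a source such that everything that is
reached from two other sources is reached from it. -/
theorem exists_root (hk : k ≤ 5) (hk0 : 0 < k) {cs : List (Con k)} (hconn : LinkConnected cs) :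
    ∃ r ∈ sources cs, ∀ s ∈ sources cs, s ≠ r → ∀ s' ∈ sources cs, s' ≠ s →
      reach cs s ∩ reach cs s' ⊆ reach cs r := by
  classical
  set N : Finset (Fin k) := (sources cs)ᶜ with hN
  have hne : (sources cs).Nonempty := by
    obtain ⟨s, hs, _⟩ := exists_source cs ⟨0, hk0⟩
    exact ⟨s, hs⟩
  have hcard : N.card + (sources cs).card = k := by
    rw [hN, Finset.card_compl, Fintype.card_fin]
    have := (sources cs).card_le_univ
    rw [Fintype.card_fin] at this
    omega
  -- A source that is reached from another source equals it, so what two distinct sources both reach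
  -- is not a source.
  have hint : ∀ s ∈ sources cs, ∀ s' ∈ sources cs, s' ≠ s → ∀ v ∈ reach cs s, v ∈ reach cs s' →
      v ∈ N := by
    intro s hs s' hs' hss v hv hv'
    rw [hN, Finset.mem_compl]
    intro hvs
    have h1 := (mem_sources.1 hvs).eq_of_mem (mem_sources.1 hs) hv
    have h2 := (mem_sources.1 hvs).eq_of_mem (mem_sources.1 hs') hv'
    exact hss (h2.symm.trans h1)
  -- The root is a source that reaches as many non-sources as possible. Suppose that two other
  -- sources `s`, `s'` both reach some `v` that `r` does not reach.
  obtain ⟨r, hr, hmax⟩ := Finset.exists_max_image (sources cs)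
    (fun s => (reach cs s ∩ N).card) hne
  refine ⟨r, hr, fun s hs hsr s' hs' hss v hv => ?_⟩
  obtain ⟨hv1, hv2⟩ := Finset.mem_inter.1 hv
  by_cases hs'r : s' = r
  · exact hs'r ▸ hv2
  by_contra hvr
  have hvN := hint s hs s' hs' hss v hv1 hv2
  -- Here `k ≤ 5` enters: three sources leave at most two non-sources. One is `v`; by maximality `r`
  -- reaches one as well, necessarily a different one, `u`.
  have h3 : 3 ≤ (sources cs).card := by
    have : ({r, s, s'} : Finset (Fin k)) ⊆ sources cs := by
      intro t ht
      simp only [Finset.mem_insert, Finset.mem_singleton] at ht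
      rcases ht with rfl | rfl | rfl <;> assumption
    refine le_trans (le_of_eq ?_) (Finset.card_le_card this)
    rw [Finset.card_eq_three.2 ⟨r, s, s', fun h => hsr h.symm, fun h => hs'r h.symm,
      fun h => hss h.symm, rfl⟩]
  have hN2 : N.card ≤ 2 := by omega
  have hpos : 1 ≤ (reach cs s ∩ N).card :=
    Finset.card_pos.2 ⟨v, Finset.mem_inter.2 ⟨hv1, hvN⟩⟩
  have hrpos : 1 ≤ (reach cs r ∩ N).card := hpos.trans (hmax s hs)
  obtain ⟨u, hu⟩ := Finset.card_pos.1 hrpos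
  obtain ⟨hur, huN⟩ := Finset.mem_inter.1 hu
  have huv : u ≠ v := fun h => hvr (h ▸ hur)
  have hNeq : N = {u, v} := by
    refine (Finset.eq_of_subset_of_card_le (fun w hw => ?_) ?_).symm
    · rcases Finset.mem_insert.1 hw with rfl | hw
      · exact huN
      · rw [Finset.mem_singleton] at hw; exact hw ▸ hvN
    · rw [Finset.card_pair huv]; exact hN2
  -- A source that reaches both non-sources would beat `r`, which misses `v`.
  have hle1 : ∀ t ∈ sources cs, u ∈ reach cs t → v ∉ reach cs t := by
    intro t ht hut hvt
    have h1 := hmax t ht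
    have h2 : reach cs t ∩ N = N := by
      rw [Finset.inter_eq_right, hNeq]
      intro w hw
      rcases Finset.mem_insert.1 hw with rfl | hw
      · exact hut
      · rw [Finset.mem_singleton] at hw; exact hw ▸ hvt
    have h3 : reach cs r ∩ N ⊂ N := by
      refine (Finset.ssubset_iff_of_subset Finset.inter_subset_right).2 ⟨v, hvN, fun h => ?_⟩
      exact hvr (Finset.mem_inter.1 h).1
    have h4 := Finset.card_lt_card h3
    rw [h2] at h1
    omega
  -- the variables reached from a source that reaches `u` form a component
  set A : Finset (Fin k) := Finset.univ.filter fun w => ∃ t ∈ sources cs, w ∈ reach cs t ∧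
    u ∈ reach cs t with hA
  have hAu : A = Finset.univ := by
    refine hconn A ⟨u, ?_⟩ fun c hc => ?_
    · exact Finset.mem_filter.2 ⟨Finset.mem_univ _, r, hr, hur, hur⟩
    simp only [hA, Finset.mem_filter, Finset.mem_univ, true_and]
    constructor
    · rintro ⟨t, ht, h1, h2⟩
      exact ⟨t, ht, reach_con hc h1, h2⟩
    -- Closure against the direction of a constraint: a different source of `c.i` shares `c.j` with
    -- `t`, so `c.j` is a non-source; it is not `v`, which `t` does not reach, hence it is `u`.
    · rintro ⟨t, ht, h1, h2⟩
      obtain ⟨t', ht', h3⟩ := exists_source cs c.i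
      refine ⟨t', ht', h3, ?_⟩
      have h4 := reach_con hc h3
      by_cases htt : t' = t
      · exact htt ▸ h2
      · have h5 := hint t ht t' ht' htt c.j h1 h4
        rw [hNeq, Finset.mem_insert, Finset.mem_singleton] at h5
        rcases h5 with h5 | h5
        · exact h5 ▸ h4
        · exact absurd (h5 ▸ h1) (hle1 t ht h2)
  have hvA : v ∈ A := hAu ▸ Finset.mem_univ v
  obtain ⟨t, ht, h1, h2⟩ := (Finset.mem_filter.1 hvA).2
  exact hle1 t ht h2 h1

end WordRAM

namespace WordRAM

variable {L : Layout} {n k : ℕ}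

/-! ## Counting the solutions of a system of constraints -/

/-- The number of solutions of the constraints `cs`. -/
def solutions (O : Bool → Fin n → List (Fin n)) (cs : List (Con k)) : ℕ :=
  ∑ y : Fin k → Fin n, if ∀ c ∈ cs, c.Holds O y then 1 else 0

/-- Whether the constraints `cs` hold, as a number. -/
def indicator (O : Bool → Fin n → List (Fin n)) (cs : List (Con k)) (y : Fin k → Fin n) : ℕ :=
  if ∀ c ∈ cs, c.Holds O y then 1 else 0

theorem indicator_le_one (O : Bool → Fin n → List (Fin n)) (cs : List (Con k))
    (y : Fin k → Fin n) : indicator O cs y ≤ 1 := by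
  unfold indicator; split_ifs <;> omega

theorem dependsOn_indicator (O : Bool → Fin n → List (Fin n)) {cs : List (Con k)}
    {R : Finset (Fin k)} (h : ∀ c ∈ cs, c.i ∈ R ∧ c.j ∈ R) : DependsOn (indicator O cs) R := by
  intro x y hxy
  unfold indicator
  refine if_congr (forall₂_congr fun c hc => ?_) rfl rfl
  rw [Con.Holds, Con.Holds, hxy _ (by simpa using (h c hc).1), hxy _ (by simpa using (h c hc).2)]

open Classical in
/-- The constraints between the variables that are reached from `s`. -/
noncomputable def reachCons (cs : List (Con k)) (s : Fin k) : List (Con k) :=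
  cs.filter fun c => c.i ∈ reach cs s

theorem mem_reachCons {cs : List (Con k)} {s : Fin k} {c : Con k} :
    c ∈ reachCons cs s ↔ c ∈ cs ∧ c.i ∈ reach cs s := by simp [reachCons]

theorem mem_reach_of_mem_reachCons {cs : List (Con k)} {s : Fin k} :
    ∀ c ∈ reachCons cs s, c.i ∈ reach cs s ∧ c.j ∈ reach cs s := fun _ hc =>
  ⟨(mem_reachCons.1 hc).2, reach_con (mem_reachCons.1 hc).1 (mem_reachCons.1 hc).2⟩

theorem sumOff_le (P : Finset (Fin k)) {F : (Fin k → Fin n) → ℕ} {U : ℕ} (hF : ∀ y, F y ≤ U)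
    (x : Fin k → Fin n) : sumOff P F x ≤ n ^ k * U := by
  refine (Finset.sum_le_card_nsmul _ _ U fun y _ => hF y).trans ?_
  rw [smul_eq_mul]
  refine Nat.mul_le_mul_right _ ((Finset.card_le_univ _).trans ?_)
  simp

/-- The number of solutions is computed from the root and tables for the other sources. -/
theorem sumOff_root_eq_solutions (O : Bool → Fin n → List (Fin n)) (cs : List (Con k)) (r : Fin k)
    (hr : r ∈ sources cs) (hroot : ∀ s ∈ sources cs, s ≠ r → ∀ s' ∈ sources cs, s' ≠ s →
      reach cs s ∩ reach cs s' ⊆ reach cs r) (x : Fin k → Fin n) :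
    sumOff (reach cs r) (fun y => indicator O (reachCons cs r) y *
      ∏ s ∈ (sources cs).erase r, sumOff (reach cs s \ (reach cs s ∩ reach cs r))
        (indicator O (reachCons cs s)) y) x = solutions O cs := by
  set P : Fin k → Finset (Fin k) := fun s => reach cs s \ (reach cs s ∩ reach cs r) with hP
  set T := (sources cs).erase r with hT
  have hPr : ∀ s, Disjoint (reach cs r) (P s) := by
    intro s
    rw [Finset.disjoint_left]
    intro i hi hi'
    simp only [hP, Finset.mem_sdiff, Finset.mem_inter, not_and] at hi'
    exact hi'.2 hi'.1 hi
  have hdR : Disjoint (reach cs r) (T.biUnion P) := by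
    rw [Finset.disjoint_biUnion_right]; exact fun s _ => hPr s
  have huniv : reach cs r ∪ T.biUnion P = Finset.univ := by
    rw [Finset.eq_univ_iff_forall]
    intro v
    obtain ⟨s, hs, hv⟩ := exists_source cs v
    by_cases hvr : v ∈ reach cs r
    · exact Finset.mem_union_left _ hvr
    · have hsr : s ≠ r := fun h => hvr (h ▸ hv)
      refine Finset.mem_union_right _ (Finset.mem_biUnion.2 ⟨s, Finset.mem_erase.2 ⟨hsr, hs⟩, ?_⟩)
      simp [hP, hv, hvr]
  -- The root property says that reaches of distinct non-root sources meet only inside the reach of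
  -- `r`, so the variables outside it are private to one source.
  have key : ∀ y, sumOff (T.biUnion P) (fun y => ∏ s ∈ T, indicator O (reachCons cs s) y) y =
      ∏ s ∈ T, sumOff (P s) (indicator O (reachCons cs s)) y := by
    intro y
    refine sumOff_biUnion T P (reach cs) _ (fun s _ => Finset.sdiff_subset)
      (fun s _ => dependsOn_indicator O mem_reach_of_mem_reachCons) ?_ y
    intro s hs s' hs' hss
    rw [Finset.disjoint_left]
    intro i hi hi'
    have h1 := hroot s (Finset.mem_erase.1 hs).2 (Finset.mem_erase.1 hs).1 s'
      (Finset.mem_erase.1 hs').2 hss (Finset.mem_inter.2 ⟨hi, (Finset.mem_sdiff.1 hi').1⟩)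
    exact Finset.disjoint_left.1 (hPr s') h1 hi'
  -- Every constraint starts in the reach of some source. It may belong to several of the sublists,
  -- which is harmless, since a product of indicators is insensitive to repetition.
  have hprod : ∀ y, (if ∀ c ∈ cs, c.Holds O y then 1 else 0) =
      indicator O (reachCons cs r) y * ∏ s ∈ T, indicator O (reachCons cs s) y := by
    intro y
    rw [hT, Finset.mul_prod_erase _ (fun s => indicator O (reachCons cs s) y) hr]
    by_cases h : ∀ c ∈ cs, c.Holds O y
    · rw [if_pos h, Finset.prod_eq_one]
      intro s _
      rw [indicator, if_pos fun c hc => h c (mem_reachCons.1 hc).1]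
    · rw [if_neg h]
      push Not at h
      obtain ⟨c, hc, hn⟩ := h
      obtain ⟨s, hs, hi⟩ := exists_source cs c.i
      rw [Finset.prod_eq_zero hs]
      rw [indicator, if_neg]
      exact fun hh => hn (hh c (mem_reachCons.2 ⟨hc, hi⟩))
  have e1 : ∀ y, indicator O (reachCons cs r) y *
      ∏ s ∈ T, sumOff (P s) (indicator O (reachCons cs s)) y =
      sumOff (T.biUnion P) (fun y => if ∀ c ∈ cs, c.Holds O y then 1 else 0) y := by
    intro y
    rw [← key, ← sumOff_mul]
    · exact sumOff_congr fun z _ => (hprod z).symm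
    · intro a b hab
      refine dependsOn_indicator O mem_reach_of_mem_reachCons fun i hi => hab i ?_
      have := Finset.disjoint_left.1 hdR (by simpa using hi)
      simpa using this
  rw [sumOff_congr fun y _ => e1 y, ← sumOff_union hdR, huniv, sumOff_univ, solutions]

/-! ## Time bounds for enumerations -/

theorem sum_map_le_of_forall {α : Type*} (l : List α) (f : α → ℕ) {c : ℕ} (h : ∀ a ∈ l, f a ≤ c) :
    (l.map f).sum ≤ l.length * c := by
  simpa using List.sum_le_card_nsmul (l.map f) c (by simpa using h)

/-- One power of κ per level. The 80 per level covers the 40 for each round and the 40 for the loop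
itself. -/
theorem levelTime_le {O : Bool → Fin n → List (Fin n)} {κ : ℕ} (hκ : 1 ≤ κ)
    (hO : ∀ b u, (O b u).length ≤ κ) (T : ℕ) : ∀ (l : List (Con k)) (x : Fin k → Fin n),
    levelTime O T l x ≤ (T + 80 * l.length) * κ ^ l.length
  | [], x => by simp [levelTime]
  | c :: l, x => by
    rw [levelTime]
    have h1 := sum_map_le_of_forall (O c.b (x c.i))
      (fun u => levelTime O T l (Function.update x c.j u) + 40)
      (c := (T + 80 * l.length) * κ ^ l.length + 40)
      fun u _ => Nat.add_le_add_right (levelTime_le hκ hO T l _) _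
    have h2 := Nat.mul_le_mul_right ((T + 80 * l.length) * κ ^ l.length + 40) (hO c.b (x c.i))
    have h3 : κ ≤ κ ^ (l.length + 1) := Nat.le_self_pow (by omega) κ
    rw [List.length_cons]
    have h4 : (T + 80 * (l.length + 1)) * κ ^ (l.length + 1) =
        κ * ((T + 80 * l.length) * κ ^ l.length) + 80 * κ ^ (l.length + 1) := by ring
    rw [h4]
    nlinarith

/-- The source and the first tree constraint are estimated together: the lengths of the lists of all
vertices sum to at most 2m, instead of nκ. This applies to either relation, since the equality lists
have total length n ≤ 2m. A tree on at most `k` variables leaves at most `k - 2` further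
constraints. -/
theorem sum_levelTime_le {O : Bool → Fin n → List (Fin n)} {κ m : ℕ} (hκ : 1 ≤ κ) (hm : 1 ≤ m)
    (hO : ∀ b u, (O b u).length ≤ κ) (hsum : ∀ b, ∑ u, (O b u).length ≤ 2 * m) (hn : n ≤ 2 * m)
    (T : ℕ) {l : List (Con k)} {v : Fin k} (hl : Grows {v} l) (x : Fin k → Fin n) :
    ∑ u, (levelTime O T l (Function.update x v u) + 10) + 10 ≤
      (2 * T + 160 * k + 300) * (m * κ ^ (k - 2)) := by
  have hlen := hl.card_le
  rw [Finset.card_singleton] at hlen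
  have hpow : 1 ≤ κ ^ (k - 2) := Nat.one_le_pow _ _ hκ
  set p := κ ^ (k - 2) with hp
  have hmp : m ≤ m * p := Nat.le_mul_of_pos_right _ hpow
  cases l with
  | nil =>
    simp only [levelTime, Finset.sum_const, Finset.card_univ, Fintype.card_fin, smul_eq_mul]
    have h1 : n * (T + 10) ≤ 2 * m * (T + 10) := Nat.mul_le_mul_right _ hn
    have h2 : 2 * m * (T + 10) + 10 ≤ (2 * T + 160 * k + 300) * m := by nlinarith
    exact (Nat.add_le_add_right h1 _).trans (h2.trans (Nat.mul_le_mul_left _ hmp))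
  | cons c l =>
    have hcv : c.i = v := Finset.mem_singleton.1 hl.1
    rw [List.length_cons] at hlen
    have hpl : κ ^ l.length ≤ p := Nat.pow_le_pow_right hκ (by omega)
    set q := (T + 80 * k) * p + 40 with hq
    have h1 : ∀ u, levelTime O T (c :: l) (Function.update x v u) + 10 ≤
        (O c.b u).length * q + 50 := by
      intro u
      rw [levelTime, hcv, Function.update_self]
      have := sum_map_le_of_forall (O c.b u)
        (fun u' => levelTime O T l (Function.update (Function.update x v u) c.j u') + 40) (c := q)
        fun u' _ => by
          refine Nat.add_le_add_right ((levelTime_le hκ hO T l _).trans ?_) _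
          exact Nat.mul_le_mul (by omega) hpl
      omega
    have h2 := Finset.sum_le_sum fun u (_ : u ∈ Finset.univ) => h1 u
    have h6 : ∑ u, ((O c.b u).length * q + 50) = (∑ u, (O c.b u).length) * q + n * 50 := by
      rw [Finset.sum_add_distrib, ← Finset.sum_mul]; simp
    rw [h6] at h2
    have h3 : (∑ u, (O c.b u).length) * q ≤ 2 * m * q := Nat.mul_le_mul_right _ (hsum c.b)
    have h4 : 2 * m * q = (2 * T + 160 * k) * (m * p) + 80 * m := by rw [hq]; ring
    have h5 : (2 * T + 160 * k + 300) * (m * p) =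
        (2 * T + 160 * k) * (m * p) + 300 * (m * p) := by ring
    omega

/-! ## The program for a system of constraints -/

theorem Ready.congr {O : Bool → Fin n → List (Fin n)} {s s' : Store} (h : Ready O s)
    (hv : ∀ r, r < 20 → s'.v r = s.v r) (ha : ∀ b, b < 14 → s'.a b = s.a b) : Ready O s' := by
  refine ⟨by rw [hv 0 (by omega), h.v0], by rw [hv 1 (by omega), h.v1], fun b u => ?_,
    fun b u v => ?_⟩
  · exact (h.outs b u).congr (ha _ (outArr_lt b)) (ha _ (lenArr_lt b))
  · rw [ha _ (matArr_lt b)]; exact h.mat b u v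

/-- The stored relations are given by short lists. -/
structure Bounded (O : Bool → Fin n → List (Fin n)) (κ m : ℕ) : Prop where
  nodup : ∀ b u, (O b u).Nodup
  length_le : ∀ b u, (O b u).length ≤ κ
  sum_le : ∀ b, ∑ u, (O b u).length ≤ 2 * m
  card_le : n ≤ 2 * m
  one_le : 1 ≤ κ
  one_le' : 1 ≤ m

/-- The layout has room for tables. -/
structure Space (L : Layout) (n : ℕ) : Prop extends Room L n where
  len : (n + 1) ^ 5 ≤ L.B
  values : (n + 1) ^ 30 < 2 ^ L.w

theorem Bounded.length_le_card {O : Bool → Fin n → List (Fin n)} {κ m : ℕ} (h : Bounded O κ m)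
    (b : Bool) (u : Fin n) : (O b u).length ≤ n := by
  simpa using (h.nodup b u).length_le_card

/-- The cell with key `z` collects exactly the assignments that agree with `z` on `S`, so it holds
the sum over the variables in `R \ S`. All other accumulated cells are bounded in the same way,
which rules out overflow. -/
theorem Tri.table (hL : Space L n) (hk : k ≤ 5) {O : Bool → Fin n → List (Fin n)}
    {κ m : ℕ} (hOb : Bounded O κ m) {s : Store} {a : ℕ} (hO : Ready O s) (ha : 14 ≤ a)
    (haK : a < L.K) (hz : s.a a = 0) {v : Fin k} {l cs : List (Con k)} {R S : Finset (Fin k)}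
    (hl : Grows {v} l) (hR : insert v (heads l) = R) (hS : S ⊆ R) (hlcs : ∀ c ∈ l, c ∈ cs)
    (hcs : ∀ c ∈ cs, c.i ∈ R ∧ c.j ∈ R) {kids : List (ℕ × Finset (Fin k))} (hlen : kids.length ≤ 5)
    (hkids : ∀ p ∈ kids, p.1 < L.K ∧ p.1 ≠ a ∧ p.2 ⊆ R ∧
      ∀ x : Fin k → Fin n, s.a p.1 (keyOf n p.2 x) ≤ (n + 1) ^ 5) (x : Fin k → Fin n)
    {Q : ℕ → Store → Prop}
    (hQ : ∀ t s', t ≤ (20 * (cs.length + 4 * kids.length) + 160 * k + 600 + 20 * cs.length) *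
        (m * κ ^ (k - 2)) →
      (∀ r, (∀ j : Fin k, r ≠ vertexVar j ∧ r ≠ posVar j) → s'.v r = s.v r) →
      (∀ b, b ≠ a → s'.a b = s.a b) →
      (∀ z : Fin k → Fin n, s'.a a (keyOf n S z) =
        sumOff (R \ S) (fun y => indicator O cs y * tableProd s kids y) z) → Q t s') :
    Tri L (Cmd.table L.nv a v l cs S kids) s Q := by
  have hun : {v} ∪ heads l = R := by rw [← hR]; rfl
  set U := (n + 1) ^ 5 with hU
  have hUpos : 1 ≤ U := Nat.one_le_pow _ _ (Nat.succ_pos n)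
  -- At most five table factors of size at most `(n + 1) ^ 5`, and at most `(n + 1) ^ 5`
  -- assignments: this is the exponent 30 in `Space`.
  have hU6 : U ^ 6 < 2 ^ L.w := by
    have : U ^ 6 = (n + 1) ^ 30 := by rw [hU, ← pow_mul]
    rw [this]; exact hL.values
  have hUw : U ^ (kids.length + 1) < 2 ^ L.w :=
    lt_of_le_of_lt (Nat.pow_le_pow_right hUpos (by omega)) hU6
  have hUw' : U ^ kids.length < 2 ^ L.w :=
    lt_of_le_of_lt (Nat.pow_le_pow_right hUpos (by omega)) hUw
  have hW : ∀ y : Fin k → Fin n, tableProd s kids y ≤ U ^ kids.length := by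
    intro y
    refine (List.prod_le_pow_card _ U ?_).trans (by simp)
    intro d hd
    obtain ⟨p, hp, rfl⟩ := List.mem_map.1 hd
    exact (hkids p hp).2.2.2 y
  have hF : ∀ idx (x : Fin k → Fin n), (∑ u, levelSum O l (fun y => if ∀ c ∈ cs, c.Holds O y then
        if idx = keyOf n S y then tableProd s kids y else 0 else 0) (Function.update x v u)) =
      sumOff R (fun y => if ∀ c ∈ cs, c.Holds O y then
        if idx = keyOf n S y then tableProd s kids y else 0 else 0) x := by
    intro idx x
    rw [sum_levelSum_eq_sumOff hOb.nodup hl, hR]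
    intro y hy c hc
    by_contra hn
    exact hy (if_neg fun h => hn (h c (hlcs c hc)))
  have hacc := Accum.table hL.toRoom hL.len hk hO hOb.length_le_card ha haK (S := S) (cs := cs)
    (kids := kids) hl (by rw [hun]; exact hS) (by rw [hun]; exact hcs) hUpos
    (by rw [hun]; exact hkids) hUw'
  have h := hacc s x (fun _ _ => rfl) (fun _ _ => rfl) (by simp) ?_
  · refine h.mono ?_
    intro t s' ⟨ht, hv', ha'⟩
    refine hQ t s' (ht.trans ?_) (fun r hr => hv' r fun j _ => hr j) ?_ ?_
    · refine (sum_levelTime_le hOb.one_le hOb.one_le' hOb.length_le hOb.sum_le hOb.card_le _ hl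
        x).trans (Nat.mul_le_mul_right _ ?_)
      omega
    · intro b hb; rw [ha', Function.update_of_ne hb]
    · intro z
      rw [ha', Function.update_self, hz]
      beta_reduce
      rw [hF, Pi.zero_apply, Nat.zero_add]
      have hdep : DependsOn (fun y => indicator O cs y * tableProd s kids y) R := by
        intro y y' hy
        have h1 := dependsOn_indicator O hcs hy
        have h2 : tableProd s kids y = tableProd s kids y' := by
          unfold tableProd
          congr 1
          refine List.map_congr_left fun p hp => ?_
          congr 1
          exact keyOf_inj.2 fun i hi => hy i (by simpa using (hkids p hp).2.2.1 hi)
        simp only [h1, h2]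
      rw [← sumOff_prescribed hS hdep x z]
      refine sumOff_congr fun y _ => ?_
      simp only [indicator, keyOf_inj]
      split_ifs <;> simp_all
  · intro idx
    rw [hz]
    beta_reduce
    rw [hF, Pi.zero_apply, Nat.zero_add]
    refine lt_of_le_of_lt (sumOff_le R (U := U ^ kids.length) (fun y => ?_) x) ?_
    · split_ifs
      · exact hW y
      · exact Nat.zero_le _
      · exact Nat.zero_le _
    · refine lt_of_le_of_lt ?_ hUw
      rw [Nat.pow_succ, Nat.mul_comm]
      refine Nat.mul_le_mul_left _ ?_
      exact (Nat.pow_le_pow_left (Nat.le_succ n) k).trans (Nat.pow_le_pow_right (Nat.succ_pos n) hk)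

/-- A spanning tree of the variables reached from `s`. -/
noncomputable def reachTree (cs : List (Con k)) (s : Fin k) : List (Con k) :=
  (exists_grows cs s).choose

namespace Cmd

/-- The table of the source `s` for the root `r`, in the array `base + s`. -/
noncomputable def sideTable (nv base : ℕ) (cs : List (Con k)) (r s : Fin k) : Cmd :=
  table nv (base + s) s (reachTree cs s) (reachCons cs s) (reach cs s ∩ reach cs r) []

/-- Tables for a list of sources, followed by another command. -/
noncomputable def sideTables (nv base : ℕ) (cs : List (Con k)) (r : Fin k) :
    List (Fin k) → Cmd → Cmd
  | [], c => c
  | s :: l, c => seq (sideTable nv base cs r s) (sideTables nv base cs r l c)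

/-- Count the solutions of `cs`; the result is the first entry of array `base + k`. -/
noncomputable def count (nv base : ℕ) (cs : List (Con k)) (r : Fin k) : Cmd :=
  sideTables nv base cs r ((sources cs).erase r).toList
    (table nv (base + k) r (reachTree cs r) (reachCons cs r) ∅
      (((sources cs).erase r).toList.map fun s : Fin k => (base + (s : ℕ), reach cs s ∩ reach cs r)))

end Cmd

/-- Each source has its own array and its table uses no other table, so the tables can be filled in
any order without disturbing each other. -/
theorem Tri.sideTables (hL : Space L n) (hk : k ≤ 5) {O : Bool → Fin n → List (Fin n)}
    {κ m : ℕ} (hOb : Bounded O κ m) {base : ℕ} (hbase : 14 ≤ base) (hbK : base + k < L.K)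
    (cs : List (Con k)) (r : Fin k) (x : Fin k → Fin n) {c : Cmd} :
    ∀ (l : List (Fin k)) (s : Store) (Q : ℕ → Store → Prop), l.Nodup → Ready O s →
      (∀ v ∈ l, s.a (base + v) = 0) →
      (∀ t s', t ≤ l.length * ((40 * cs.length + 160 * k + 600) * (m * κ ^ (k - 2))) →
        (∀ r, (∀ j : Fin k, r ≠ vertexVar j ∧ r ≠ posVar j) → s'.v r = s.v r) →
        (∀ b, (∀ v ∈ l, b ≠ base + v) → s'.a b = s.a b) →
        (∀ v ∈ l, ∀ z : Fin k → Fin n, s'.a (base + v) (keyOf n (reach cs v ∩ reach cs r) z) =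
          sumOff (reach cs v \ (reach cs v ∩ reach cs r)) (indicator O (reachCons cs v)) z) →
        Tri L c s' fun t' s'' => Q (t + t') s'') →
      Tri L (Cmd.sideTables L.nv base cs r l c) s Q
  | [], s, Q, _, _, _, h => by
    refine (h 0 s (Nat.zero_le _) (fun _ _ => rfl) (fun _ _ => rfl) (by simp)).mono ?_
    intro t s' hq
    rwa [Nat.zero_add] at hq
  | v :: l, s, Q, hnd, hO, hz, h => by
    rw [List.nodup_cons] at hnd
    have hvk := v.isLt
    obtain ⟨g1, g2, g3⟩ := (exists_grows cs v).choose_spec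
    refine Tri.seq (Tri.table hL hk hOb hO (by omega) (by omega) (hz v List.mem_cons_self) g1 g3
      Finset.inter_subset_left (fun c hc => mem_reachCons.2 (g2 c hc)) mem_reach_of_mem_reachCons
      (Nat.zero_le _) (by simp) x ?_)
    intro t₁ s₁ ht₁ hv₁ ha₁ hk₁
    have hlen : (reachCons cs v).length ≤ cs.length := List.length_filter_le _ _
    refine Tri.sideTables hL hk hOb hbase hbK cs r x l s₁ _ hnd.2
      (hO.congr (fun q hq => hv₁ q fun j => by unfold vertexVar posVar; omega)
        fun b hb => ha₁ b (by omega)) ?_ ?_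
    · intro v' hv'
      rw [ha₁, hz v' (List.mem_cons_of_mem _ hv')]
      intro he
      have : v' = v := Fin.ext (by omega)
      exact hnd.1 (this ▸ hv')
    · intro t₂ s₂ ht₂ hv₂ ha₂ hk₂
      refine (h (t₁ + t₂) s₂ ?_ ?_ ?_ ?_).mono ?_
      · rw [List.length_cons, Nat.succ_mul]
        have : t₁ ≤ (40 * cs.length + 160 * k + 600) * (m * κ ^ (k - 2)) :=
          ht₁.trans (Nat.mul_le_mul_right _ (by simp only [List.length_nil]; omega))
        omega
      · intro q hq; rw [hv₂ q hq, hv₁ q hq]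
      · intro b hb
        rw [ha₂ b fun v' hv' => hb v' (List.mem_cons_of_mem _ hv'), ha₁ b (hb v List.mem_cons_self)]
      · intro v' hv' z
        rcases List.mem_cons.1 hv' with rfl | hv'
        · rw [ha₂, hk₁]
          · simp [tableProd]
          · intro v'' hv'' he
            have : v' = v'' := Fin.ext (by omega)
            exact hnd.1 (this ▸ hv'')
        · exact hk₂ v' hv' z
      · intro t' s' hq
        rwa [Nat.add_assoc] at hq

theorem keyOf_empty (x : Fin k → Fin n) : keyOf n ∅ x = 0 := by
  have : ∀ l : List (Fin k), Nat.ofDigits (n + 1)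
      (l.map fun i => if i ∈ (∅ : Finset (Fin k)) then (x i : ℕ) else 0) = 0 := by
    intro l
    induction l with
    | nil => simp
    | cons i l ih => rw [List.map_cons, Nat.ofDigits_cons, ih]; simp
  exact this _

theorem solutions_le (O : Bool → Fin n → List (Fin n)) (cs : List (Con k)) :
    solutions O cs ≤ n ^ k := by
  have h : solutions O cs ≤ ∑ _y : Fin k → Fin n, 1 := Finset.sum_le_sum fun y _ =>
    indicator_le_one O cs y
  simpa using h

/-- There are fewer than `k ≤ 5` side tables, and each of them, like the final sum over the root's
reach, is within the bound for one enumeration. Side table entries are numbers of assignments, so at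
most `(n + 1) ^ 5`. -/
theorem Tri.count (hL : Space L n) (hk : k ≤ 5) {O : Bool → Fin n → List (Fin n)}
    {κ m : ℕ} (hOb : Bounded O κ m) {base : ℕ} (hbase : 14 ≤ base) (hbK : base + k < L.K)
    (cs : List (Con k)) {r : Fin k} (hr : r ∈ sources cs)
    (hroot : ∀ s ∈ sources cs, s ≠ r → ∀ s' ∈ sources cs, s' ≠ s →
      reach cs s ∩ reach cs s' ⊆ reach cs r) (x : Fin k → Fin n) {s : Store} (hO : Ready O s)
    (hz : ∀ b, base ≤ b → b ≤ base + k → s.a b = 0) {Q : ℕ → Store → Prop}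
    (hQ : ∀ t s', t ≤ (240 * cs.length + 960 * k + 4200) * (m * κ ^ (k - 2)) →
      (∀ r, (∀ j : Fin k, r ≠ vertexVar j ∧ r ≠ posVar j) → s'.v r = s.v r) →
      (∀ b, b < base ∨ base + k < b → s'.a b = s.a b) → s'.a (base + k) 0 = solutions O cs →
      Q t s') :
    Tri L (Cmd.count L.nv base cs r) s Q := by
  set l := ((sources cs).erase r).toList with hl
  have hlen : l.length ≤ 5 := by
    rw [hl, Finset.length_toList]
    refine ((sources cs).erase r).card_le_univ.trans ?_
    rw [Fintype.card_fin]; exact hk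
  refine Tri.sideTables hL hk hOb hbase hbK cs r x l s Q (Finset.nodup_toList _) hO
    (fun v _ => hz _ (by omega) (by omega)) ?_
  intro t₁ s₁ ht₁ hv₁ ha₁ hk₁
  obtain ⟨g1, g2, g3⟩ := (exists_grows cs r).choose_spec
  have hne : ∀ v ∈ l, base + k ≠ base + (v : ℕ) := fun v _ => by omega
  refine Tri.table hL hk hOb (hO.congr (fun q hq => hv₁ q fun j => by unfold vertexVar posVar; omega)
    fun b hb => ha₁ b fun v _ => by omega) (by omega) hbK
    (by rw [ha₁ _ hne, hz _ (by omega) le_rfl]) g1 g3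
    (Finset.empty_subset _) (fun c hc => mem_reachCons.2 (g2 c hc)) mem_reach_of_mem_reachCons
    (by rw [List.length_map]; exact hlen) ?_ x ?_
  · intro p hp
    obtain ⟨v, hv, rfl⟩ := List.mem_map.1 hp
    have hvk := v.isLt
    refine ⟨by show base + (v : ℕ) < L.K; omega, by show base + (v : ℕ) ≠ base + k; omega,
      Finset.inter_subset_right, fun z => ?_⟩
    show s₁.a (base + v) _ ≤ _
    rw [hk₁ v hv]
    refine (sumOff_le _ (indicator_le_one O _) z).trans ?_
    rw [Nat.mul_one]
    exact (Nat.pow_le_pow_left (Nat.le_succ n) k).trans (Nat.pow_le_pow_right (Nat.succ_pos n) hk)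
  · intro t₂ s₂ ht₂ hv₂ ha₂ hk₂
    refine hQ _ s₂ ?_ (fun q hq => by rw [hv₂ q hq, hv₁ q hq]) ?_ ?_
    · have hlen' : (reachCons cs r).length ≤ cs.length := List.length_filter_le _ _
      rw [List.length_map] at ht₂
      set M := m * κ ^ (k - 2)
      have h1 : t₁ ≤ 5 * ((40 * cs.length + 160 * k + 600) * M) :=
        ht₁.trans (Nat.mul_le_mul_right _ hlen)
      have h2 : t₂ ≤ (40 * cs.length + 160 * k + 1000) * M :=
        ht₂.trans (Nat.mul_le_mul_right _ (by
          have : ((sources cs).erase r).toList.length ≤ 5 := hlen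
          omega))
      calc t₁ + t₂ ≤ 5 * ((40 * cs.length + 160 * k + 600) * M) +
            (40 * cs.length + 160 * k + 1000) * M := Nat.add_le_add h1 h2
        _ = (240 * cs.length + 960 * k + 4000) * M := by ring
        _ ≤ _ := Nat.mul_le_mul_right _ (by omega)
    · intro b hb
      rw [ha₂ b (by omega), ha₁ b fun v _ => by have := v.isLt; omega]
    -- The table of the root is indexed by no variable, so its single cell, with key 0, holds the
    -- whole sum.
    · have h := hk₂ x
      rw [keyOf_empty, Finset.sdiff_empty] at h
      rw [h, ← sumOff_root_eq_solutions O cs r hr hroot x]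
      refine sumOff_congr fun y _ => ?_
      congr 1
      rw [tableProd, List.map_map, ← Finset.prod_map_toList]
      refine congrArg List.prod (List.map_congr_left fun v hv => ?_)
      exact hk₁ v hv y

end WordRAM

/-! ## Labelled and unlabelled copies -/

namespace SimpleGraph

variable {V W : Type*} {G : SimpleGraph V} {H : SimpleGraph W}

theorem Copy.exists_iso_of_toSubgraph_eq (f : Copy H G) {G' : G.Subgraph} (h : f.toSubgraph = G') :
    ∃ e : H ≃g G'.coe, ∀ x, (e x : V) = f x := by
  subst h
  exact ⟨f.isoToSubgraph, fun x => rfl⟩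

theorem Copy.toSubgraph_comp_iso (f : Copy H G) (σ : H ≃g H) :
    (f.comp σ.toCopy).toSubgraph = f.toSubgraph := by
  ext u v
  · simp only [Subgraph.map_verts, Subgraph.verts_top, Set.image_univ, Set.mem_range]
    constructor
    · rintro ⟨x, rfl⟩; exact ⟨σ x, rfl⟩
    · rintro ⟨x, rfl⟩
      refine ⟨σ.symm x, ?_⟩
      show f (σ (σ.symm x)) = f x
      rw [RelIso.apply_symm_apply]
  · simp only [Subgraph.map_adj, Relation.Map, Subgraph.top_adj]
    constructor
    · rintro ⟨x, y, h, rfl, rfl⟩; exact ⟨σ x, σ y, σ.map_rel_iff.2 h, rfl, rfl⟩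
    · rintro ⟨x, y, h, rfl, rfl⟩
      refine ⟨σ.symm x, σ.symm y, σ.symm.map_rel_iff.2 h, ?_, ?_⟩
      · show f (σ (σ.symm x)) = f x
        rw [RelIso.apply_symm_apply]
      · show f (σ (σ.symm y)) = f y
        rw [RelIso.apply_symm_apply]

/-- Automorphisms of `H` act on embeddings without changing the image, and two embeddings with the
same image differ by exactly one automorphism; so every fibre of `Copy.toSubgraph` has |Aut H|
elements. -/
theorem copyCount_mul_card_iso [Fintype V] [Fintype W] (G : SimpleGraph V) (H : SimpleGraph W) :
    G.copyCount H * Nat.card (H ≃g H) = G.labelledCopyCount H := by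
  classical
  rw [copyCount_eq_card_image_copyToSubgraph, labelledCopyCount, ← Finset.card_univ,
    Finset.card_eq_sum_card_image (Copy.toSubgraph (A := H) (B := G)) Finset.univ,
    Finset.sum_const_nat]
  intro G' hG'
  obtain ⟨f, -, rfl⟩ := Finset.mem_image.1 hG'
  have : Finite (H ≃g H) := Finite.of_injective (fun σ => (σ : W → W)) DFunLike.coe_injective
  have := Fintype.ofFinite (H ≃g H)
  rw [Nat.card_eq_fintype_card, ← Finset.card_univ]
  symm
  refine Finset.card_bij (fun σ _ => f.comp σ.toCopy) ?_ ?_ ?_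
  · intro σ _
    rw [Finset.mem_filter]
    exact ⟨Finset.mem_univ _, f.toSubgraph_comp_iso σ⟩
  · intro σ _ τ _ h
    refine RelIso.ext fun x => f.injective ?_
    exact DFunLike.congr_fun h x
  · intro g hg
    obtain ⟨e, he⟩ := g.exists_iso_of_toSubgraph_eq (Finset.mem_filter.1 hg).2
    obtain ⟨e₀, he₀⟩ := f.exists_iso_of_toSubgraph_eq rfl
    refine ⟨e.trans e₀.symm, Finset.mem_univ _, Copy.ext fun x => ?_⟩
    show f (e₀.symm (e x)) = g x
    rw [← he₀, RelIso.apply_symm_apply, he]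

end SimpleGraph

namespace WordRAM

variable {n k : ℕ}

/-! ## Expanding injective homomorphisms into systems of constraints -/

open Classical in
/-- The signed systems of constraints that express that each of the given pairs of vertices of
`H` is mapped to an edge, if it is an edge, and to distinct vertices. The sign `true` is `-1`. -/
noncomputable def expand (H : SimpleGraph (Fin k)) :
    List (Fin k × Fin k) → List (Bool × List (Con k))
  | [] => [(false, [])]
  | p :: ps => (expand H ps).flatMap fun e =>
      if H.Adj p.1 p.2 then [(e.1, ⟨p.1, p.2, true⟩ :: e.2), (e.1, ⟨p.2, p.1, true⟩ :: e.2)]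
      else [e, (!e.1, ⟨p.1, p.2, false⟩ :: e.2)]

/-- The signed number of systems that are satisfied by `y`. -/
def signedSum (O : Bool → Fin n → List (Fin n)) (E : List (Bool × List (Con k)))
    (y : Fin k → Fin n) : ℤ :=
  (E.map fun e => (if e.1 then -1 else 1) * (indicator O e.2 y : ℤ)).sum

/-- All pairs of vertices. -/
def vertexPairs (k : ℕ) : List (Fin k × Fin k) :=
  ((List.finRange k).product (List.finRange k)).filter fun p => p.1 < p.2

theorem mem_vertexPairs {p : Fin k × Fin k} : p ∈ vertexPairs k ↔ p.1 < p.2 := by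
  simp [vertexPairs, List.product]

/-- What `expand` expresses about one pair. -/
def PairGood (G : SimpleGraph (Fin n)) (H : SimpleGraph (Fin k)) (y : Fin k → Fin n)
    (p : Fin k × Fin k) : Prop :=
  y p.1 ≠ y p.2 ∧ (H.Adj p.1 p.2 → G.Adj (y p.1) (y p.2))

theorem indicator_cons (O : Bool → Fin n → List (Fin n)) (c : Con k) (cs : List (Con k))
    (y : Fin k → Fin n) :
    indicator O (c :: cs) y = (if c.Holds O y then 1 else 0) * indicator O cs y := by
  simp only [indicator, List.forall_mem_cons]
  split_ifs <;> simp_all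

-- Each pair multiplies the sum by its own indicator: for an edge of `H` exactly one of the two
-- directions is present when the images are adjacent, and otherwise neither; for a non-edge the
-- indicator of distinctness is one minus that of equality.
open Classical in
theorem signedSum_expand {G : SimpleGraph (Fin n)} {κ m : ℕ} {out : Fin n → List (Fin n)}
    (ho : Orients G κ m out) (H : SimpleGraph (Fin k)) (y : Fin k → Fin n) :
    ∀ ps : List (Fin k × Fin k), signedSum (relLists out) (expand H ps) y =
      if ∀ p ∈ ps, PairGood G H y p then 1 else 0
  | [] => by simp [expand, signedSum, indicator]
  | p :: ps => by
    have ih := signedSum_expand ho H y ps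
    have h : signedSum (relLists out) (expand H (p :: ps)) y =
        (if PairGood G H y p then 1 else 0) * signedSum (relLists out) (expand H ps) y := by
      rw [expand, signedSum, signedSum]
      generalize expand H ps = E
      induction E with
      | nil => simp
      | cons e E ihE =>
        rw [List.flatMap_cons, List.map_append, List.sum_append, ihE, List.map_cons, List.sum_cons,
          mul_add]
        congr 1
        by_cases hp : H.Adj p.1 p.2
        · rw [if_pos hp]
          simp only [List.map_cons, List.map_nil, List.sum_cons, List.sum_nil, indicator_cons,
            Con.Holds, relLists]
          have h1 := ho.adj (y p.1) (y p.2)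
          have h2 := ho.anti (y p.1) (y p.2)
          -- Adjacent vertices are distinct, so an edge of `H` needs no separate condition for
          -- injectivity.
          have h3 : PairGood G H y p ↔ G.Adj (y p.1) (y p.2) :=
            ⟨fun h => h.2 hp, fun h => ⟨h.ne, fun _ => h⟩⟩
          rw [if_congr h3 rfl rfl]
          by_cases a : y p.2 ∈ out (y p.1)
          · have b := h2 a
            simp [a, b, h1]
          · by_cases b : y p.1 ∈ out (y p.2)
            · simp [a, b, h1]
            · simp [a, b, h1]
        · rw [if_neg hp]
          simp only [List.map_cons, List.map_nil, List.sum_cons, List.sum_nil, indicator_cons,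
            Con.Holds, relLists, List.mem_singleton]
          have h3 : PairGood G H y p ↔ y p.1 ≠ y p.2 := ⟨fun h => h.1, fun h => ⟨h, fun h' => (hp h').elim⟩⟩
          rw [if_congr h3 rfl rfl]
          by_cases a : y p.1 = y p.2
          · cases e.1 <;> simp [a]
          · have a' : ¬ y p.2 = y p.1 := fun h => a h.symm
            simp [a, a']
    rw [h, ih]
    simp only [List.forall_mem_cons]
    split_ifs <;> simp_all

/-- The number of solutions of the systems with a given sign. -/
def signedTotal (O : Bool → Fin n → List (Fin n)) (b : Bool) (E : List (Bool × List (Con k))) : ℕ :=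
  (E.map fun e => if e.1 = b then solutions O e.2 else 0).sum

theorem sum_signedSum (O : Bool → Fin n → List (Fin n)) (E : List (Bool × List (Con k))) :
    ∑ y, signedSum O E y = (signedTotal O false E : ℤ) - signedTotal O true E := by
  induction E with
  | nil => simp [signedSum, signedTotal]
  | cons e E ih =>
    have h1 : ∀ y, signedSum O (e :: E) y =
        (if e.1 then -1 else 1) * (indicator O e.2 y : ℤ) + signedSum O E y := fun y => by
      simp [signedSum]
    have h2 : ∀ b, signedTotal O b (e :: E) =
        (if e.1 = b then solutions O e.2 else 0) + signedTotal O b E := fun b => by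
      simp [signedTotal]
    have h3 : ∑ y, (indicator O e.2 y : ℤ) = solutions O e.2 := by
      rw [solutions]; push_cast; exact Finset.sum_congr rfl fun y _ => by simp [indicator]
    simp only [h1, h2, Finset.sum_add_distrib, ← Finset.mul_sum, h3, ih]
    cases e.1 <;> simp <;> ring

theorem forall_pairGood_iff {G : SimpleGraph (Fin n)} {H : SimpleGraph (Fin k)}
    {y : Fin k → Fin n} : (∀ p ∈ vertexPairs k, PairGood G H y p) ↔
      Function.Injective y ∧ ∀ i j, H.Adj i j → G.Adj (y i) (y j) := by
  simp only [mem_vertexPairs]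
  constructor
  · intro h
    refine ⟨fun i j hij => ?_, fun i j hij => ?_⟩
    · by_contra hne
      rcases lt_or_gt_of_ne hne with hl | hl
      · exact (h (i, j) hl).1 hij
      · exact (h (j, i) hl).1 hij.symm
    · rcases lt_or_gt_of_ne hij.ne with hl | hl
      · exact (h (i, j) hl).2 hij
      · exact ((h (j, i) hl).2 hij.symm).symm
  · rintro ⟨h, h'⟩ p hp
    exact ⟨fun he => hp.ne (h he), h' _ _⟩

theorem card_filter_eq_labelledCopyCount {G : SimpleGraph (Fin n)} {H : SimpleGraph (Fin k)}
    {P : (Fin k → Fin n) → Prop} [DecidablePred P]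
    (hP : ∀ y, P y ↔ Function.Injective y ∧ ∀ i j, H.Adj i j → G.Adj (y i) (y j)) :
    (Finset.univ.filter P).card = G.labelledCopyCount H := by
  rw [SimpleGraph.labelledCopyCount, ← Fintype.card_subtype]
  refine @Fintype.card_congr _ _ _ (_) ?_
  exact
    { toFun := fun y => ⟨⟨y.1, fun {i j} h => ((hP y.1).1 y.2).2 i j h⟩, ((hP y.1).1 y.2).1⟩
      invFun := fun f => ⟨f, (hP _).2 ⟨f.injective, fun i j h => f.toHom.map_adj h⟩⟩
      left_inv := fun _ => rfl
      right_inv := fun _ => rfl }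

/-- Stated as a sum of natural numbers; it also shows that the subtraction in the program does not
go below zero. -/
theorem signedTotal_expand {G : SimpleGraph (Fin n)} {κ m : ℕ} {out : Fin n → List (Fin n)}
    (ho : Orients G κ m out) (H : SimpleGraph (Fin k)) :
    signedTotal (relLists out) false (expand H (vertexPairs k)) =
      signedTotal (relLists out) true (expand H (vertexPairs k)) + G.labelledCopyCount H := by
  classical
  have h := sum_signedSum (relLists out) (expand H (vertexPairs k))
  simp only [signedSum_expand ho] at h
  rw [Finset.sum_boole, card_filter_eq_labelledCopyCount fun y => forall_pairGood_iff] at h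
  omega

theorem exists_con_of_mem_expand {H : SimpleGraph (Fin k)} : ∀ {ps : List (Fin k × Fin k)}
    {e : Bool × List (Con k)}, e ∈ expand H ps → ∀ p ∈ ps, H.Adj p.1 p.2 →
      ∃ c ∈ e.2, (c.i = p.1 ∧ c.j = p.2) ∨ (c.i = p.2 ∧ c.j = p.1)
  | [], _, _, p, hp, _ => absurd hp List.not_mem_nil
  | q :: ps, e, he, p, hp, hadj => by
    rw [expand, List.mem_flatMap] at he
    obtain ⟨e', he', hee⟩ := he
    rcases List.mem_cons.1 hp with rfl | hp
    · rw [if_pos hadj] at hee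
      simp only [List.mem_cons, List.not_mem_nil, or_false] at hee
      rcases hee with rfl | rfl
      · exact ⟨_, List.mem_cons_self, Or.inl ⟨rfl, rfl⟩⟩
      · exact ⟨_, List.mem_cons_self, Or.inr ⟨rfl, rfl⟩⟩
    · obtain ⟨c, hc, h⟩ := exists_con_of_mem_expand he' p hp hadj
      have : c ∈ e.2 := by
        split_ifs at hee <;> simp only [List.mem_cons, List.not_mem_nil, or_false] at hee <;>
          rcases hee with rfl | rfl <;> simp [hc]
      exact ⟨c, this, h⟩

/-- Every edge of `H` leaves a constraint in one of its two directions in every system, so a set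
that is closed under the constraints is a union of components of `H`. -/
theorem linkConnected_of_mem_expand {H : SimpleGraph (Fin k)} (hH : H.Connected)
    {e : Bool × List (Con k)} (he : e ∈ expand H (vertexPairs k)) : LinkConnected e.2 := by
  intro A ⟨a, ha⟩ hA
  have hstep : ∀ i j, H.Adj i j → i ∈ A → j ∈ A := by
    intro i j hij hi
    obtain ⟨c, hc, h⟩ : ∃ c ∈ e.2, (c.i = i ∧ c.j = j) ∨ (c.i = j ∧ c.j = i) := by
      rcases lt_or_gt_of_ne hij.ne with hl | hl
      · exact exists_con_of_mem_expand he (i, j) (mem_vertexPairs.2 hl) hij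
      · obtain ⟨c, hc, h⟩ := exists_con_of_mem_expand he (j, i) (mem_vertexPairs.2 hl) hij.symm
        exact ⟨c, hc, h.symm⟩
    have := hA c hc
    rcases h with ⟨rfl, rfl⟩ | ⟨rfl, rfl⟩
    · exact this.1 hi
    · exact this.2 hi
  rw [Finset.eq_univ_iff_forall]
  intro b
  obtain ⟨p⟩ := hH.preconnected a b
  induction p with
  | nil => exact ha
  | cons h _ ih => exact ih (hstep _ _ h ha)

end WordRAM

namespace WordRAM

variable {L : Layout} {n k : ℕ}

/-! ## The program for a list of patterns -/

/-- The variables for the totals of the systems with a given sign. -/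
def totalVar (b : Bool) : ℕ := if b then 41 else 40

/-- The root `r` is suitable for `Cmd.count`. -/
def IsRoot (cs : List (Con k)) (r : Fin k) : Prop :=
  r ∈ sources cs ∧ ∀ s ∈ sources cs, s ≠ r → ∀ s' ∈ sources cs, s' ≠ s →
    reach cs s ∩ reach cs s' ⊆ reach cs r

namespace Cmd

/-- Add the numbers of solutions of the systems to the variables for the totals. -/
noncomputable def totals (nv : ℕ) (root : List (Con k) → Fin k) :
    ℕ → List (Bool × List (Con k)) → Cmd
  | _, [] => skip
  | base, e :: E => seq (count nv base e.2 (root e.2))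
      (seq (set nv (totalVar e.1) (.add (.var (totalVar e.1)) (.get (base + k) (.num 0))))
        (totals nv root (base + (k + 1)) E))

/-- Count the copies of the patterns; the results are in the variables from `x` on. -/
noncomputable def patterns (nv : ℕ) (root : List (Con k) → Fin k) :
    ℕ → ℕ → List (SimpleGraph (Fin k)) → Cmd
  | _, _, [] => skip
  | base, x, H :: Hs => seq (set nv 40 (.num 0)) (seq (set nv 41 (.num 0))
      (seq (totals nv root base (expand H (vertexPairs k)))
        (seq (set nv x (.div (.sub (.var 40) (.var 41)) (.num (Nat.card (H ≃g H)))))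
          (patterns nv root (base + (k + 1) * (expand H (vertexPairs k)).length) (x + 1) Hs))))

end Cmd

/-- The time bound for `Cmd.totals`, up to a factor that depends on the graph. -/
def totalsTime (E : List (Bool × List (Con k))) : ℕ :=
  (E.map fun e => 240 * e.2.length + 960 * k + 4210).sum

/-- Every system works in a fresh block of `k + 1` arrays that still holds zeros, so no time is
spent on clearing tables. A system has at most `n ^ k` solutions, which bounds the totals. -/
theorem Tri.totals (hL : Space L n) (hk : k ≤ 5) {O : Bool → Fin n → List (Fin n)}
    {κ m : ℕ} (hOb : Bounded O κ m) (root : List (Con k) → Fin k) (x : Fin k → Fin n) :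
    ∀ (E : List (Bool × List (Con k))) (base : ℕ) (s : Store), 14 ≤ base →
      base + (k + 1) * E.length ≤ L.K → (∀ e ∈ E, IsRoot e.2 (root e.2)) → Ready O s →
      (∀ b, base ≤ b → s.a b = 0) →
      (∀ b, s.v (totalVar b) + E.length * n ^ k < 2 ^ L.w) →
      Tri L (Cmd.totals L.nv root base E) s fun t s' =>
        t ≤ totalsTime E * (m * κ ^ (k - 2)) ∧ Ready O s' ∧
        (∀ r, 50 ≤ r → s'.v r = s.v r) ∧
        (∀ b, base + (k + 1) * E.length ≤ b → s'.a b = 0) ∧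
        ∀ b, s'.v (totalVar b) = s.v (totalVar b) + signedTotal O b E
  | [], base, s, _, _, _, hO, hz, _ => Tri.skip
    ⟨Nat.zero_le _, hO, fun _ _ => rfl, fun b hb => hz b hb, fun b => by simp [signedTotal]⟩
  | e :: E, base, s, hb, hK, hroot, hO, hz, hw => by
    have hvars := hL.vars
    have hM : 1 ≤ m * κ ^ (k - 2) := Nat.mul_pos hOb.one_le' (Nat.one_le_pow _ _ hOb.one_le)
    have htv : ∀ b, 40 ≤ totalVar b ∧ totalVar b ≤ 41 := fun b => by cases b <;> simp [totalVar]
    have hlen : base + (k + 1) + (k + 1) * E.length = base + (k + 1) * (e :: E).length := by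
      rw [List.length_cons]; ring
    obtain ⟨hr, hr'⟩ := hroot e List.mem_cons_self
    refine Tri.seq (Tri.count hL hk hOb hb (by omega) e.2 hr hr' x hO
      (fun b h _ => hz b h) ?_)
    intro t₁ s₁ ht₁ hv₁ ha₁ hc₁
    have hv₁' : ∀ r, r < 20 ∨ 30 ≤ r → s₁.v r = s.v r := fun r h => hv₁ r fun j => by
      have := j.isLt
      unfold vertexVar posVar; omega
    have hsol := solutions_le O e.2
    have hw' : ∀ b, s.v (totalVar b) + (n ^ k + E.length * n ^ k) < 2 ^ L.w := fun b => by
      have h := hw b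
      rw [List.length_cons, Nat.succ_mul] at h
      omega
    have hB : 0 < L.B := lt_of_lt_of_le (Nat.pow_pos (Nat.succ_pos n)) hL.len
    have hval : Ex.eval s₁ (.add (.var (totalVar e.1)) (.get (base + k) (.num 0))) =
        s.v (totalVar e.1) + solutions O e.2 := by
      simp only [Ex.eval, hc₁, hv₁' _ (Or.inr (le_trans (by omega) (htv e.1).1))]
    refine Tri.seq (Tri.set (by have := htv e.1; omega) ?_ ?_)
    · refine ⟨?_, ⟨?_, ?_, hB⟩, ?_⟩
      · show totalVar e.1 < L.nv
        have := htv e.1; omega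
      · show 0 < 2 ^ L.w
        exact Nat.pow_pos (by omega)
      · omega
      · have h := hw' e.1
        have h2 : Ex.eval s₁ (.var (totalVar e.1)) + Ex.eval s₁ (.get (base + k) (.num 0)) =
          s.v (totalVar e.1) + solutions O e.2 := hval
        omega
    · rw [hval]
      set s₂ := s₁.setV (totalVar e.1) (s.v (totalVar e.1) + solutions O e.2) with hs₂
      have hv₂ : ∀ r, r ≠ totalVar e.1 → r < 20 ∨ 30 ≤ r → s₂.v r = s.v r := fun r h h' => by
        rw [hs₂, Store.setV_v_of_ne _ _ h, hv₁' r h']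
      have htot : ∀ b, s₂.v (totalVar b) =
          s.v (totalVar b) + if e.1 = b then solutions O e.2 else 0 := by
        intro b
        by_cases h : e.1 = b
        · subst h
          rw [hs₂, Store.setV_v_self, if_pos rfl]
        · rw [hv₂ _ _ (Or.inr (le_trans (by omega) (htv b).1)), if_neg h, Nat.add_zero]
          intro h'
          revert h h'
          cases e.1 <;> cases b <;> simp [totalVar]
      refine (Tri.totals hL hk hOb root x E (base + (k + 1)) s₂ (by omega) (by omega)
        (fun e' he' => hroot e' (List.mem_cons_of_mem _ he')) ?_ ?_ ?_).mono ?_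
      · refine hO.congr (fun r h => hv₂ r (by have := htv e.1; omega) (Or.inl h)) fun b h => ?_
        rw [hs₂, Store.setV_a]
        exact ha₁ b (by omega)
      · intro b h
        rw [hs₂, Store.setV_a, ha₁ b (by omega), hz b (by omega)]
      · intro b
        rw [htot]
        have h := hw' b
        split_ifs <;> omega
      · rintro t₃ s₃ ⟨ht₃, hO₃, hv₃, ha₃, htot₃⟩
        refine ⟨?_, hO₃, ?_, ?_, ?_⟩
        · have h1 : totalsTime (e :: E) = 240 * e.2.length + 960 * k + 4210 + totalsTime E := by
            simp [totalsTime]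
          have h2 : totalsTime (e :: E) * (m * κ ^ (k - 2)) =
              (240 * e.2.length + 960 * k + 4200) * (m * κ ^ (k - 2)) + 10 * (m * κ ^ (k - 2)) +
                totalsTime E * (m * κ ^ (k - 2)) := by rw [h1]; ring
          simp only [Ex.cost]
          omega
        · intro r h
          rw [hv₃ r h, hv₂ r (by have := htv e.1; omega) (Or.inr (by omega))]
        · intro b h; exact ha₃ b (by omega)
        · intro b
          rw [htot₃, htot]
          simp only [signedTotal, List.map_cons, List.sum_cons, Nat.add_assoc]

/-- The number of arrays for the tables of a list of patterns. -/
noncomputable def tableArrays (Hs : List (SimpleGraph (Fin k))) : ℕ :=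
  (Hs.map fun H => (k + 1) * (expand H (vertexPairs k)).length).sum

/-- The time bound for `Cmd.patterns`, up to a factor that depends on the graph. -/
noncomputable def patternsTime (Hs : List (SimpleGraph (Fin k))) : ℕ :=
  (Hs.map fun H => totalsTime (expand H (vertexPairs k)) + 20).sum

/-- The difference of the totals is the number of labelled copies, and the division by |Aut H| is
exact. The number |Aut H| is a constant in the program text. Results sit in variables from 50 on,
out of reach of the enumerations. -/
theorem Tri.patterns (hL : Space L n) (hk : k ≤ 5) {G : SimpleGraph (Fin n)} {κ' m' : ℕ}
    {out : Fin n → List (Fin n)} (ho : Orients G κ' m' out) {κ m : ℕ}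
    (hOb : Bounded (relLists out) κ m) (root : List (Con k) → Fin k) (x : Fin k → Fin n) :
    ∀ (Hs : List (SimpleGraph (Fin k))) (base r : ℕ) (s : Store), 14 ≤ base →
      base + tableArrays Hs ≤ L.K → 50 ≤ r → r + Hs.length ≤ L.nv →
      (∀ H ∈ Hs, (∀ e ∈ expand H (vertexPairs k), IsRoot e.2 (root e.2)) ∧
        Nat.card (H ≃g H) < 2 ^ L.w ∧ 0 < Nat.card (H ≃g H) ∧
        (expand H (vertexPairs k)).length * n ^ k < 2 ^ L.w) →
      Ready (relLists out) s → (∀ b, base ≤ b → s.a b = 0) →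
      Tri L (Cmd.patterns L.nv root base r Hs) s fun t s' =>
        t ≤ patternsTime Hs * (m * κ ^ (k - 2)) ∧ (∀ q, 50 ≤ q → q < r → s'.v q = s.v q) ∧
        ∀ i : Fin Hs.length, s'.v (r + i) = G.copyCount (Hs.get i)
  | [], base, r, s, _, _, _, _, _, _, _ => Tri.skip
    ⟨Nat.zero_le _, fun _ _ _ => rfl, fun i => absurd i.isLt (by simp)⟩
  | H :: Hs, base, r, s, hb, hK, hr, hnv, hH, hO, hz => by
    have hvars := hL.vars
    have hM : 1 ≤ m * κ ^ (k - 2) := Nat.mul_pos hOb.one_le' (Nat.one_le_pow _ _ hOb.one_le)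
    obtain ⟨hroot, haut, haut0, hw⟩ := hH H List.mem_cons_self
    set E := expand H (vertexPairs k) with hE
    have hlen : base + (k + 1) * E.length + tableArrays Hs = base + tableArrays (H :: Hs) := by
      simp only [tableArrays, List.map_cons, List.sum_cons, hE]; omega
    rw [List.length_cons] at hnv
    refine Tri.seq (Tri.set (by omega) (show 0 < 2 ^ L.w from Nat.pow_pos (by omega)) ?_)
    refine Tri.seq (Tri.set (by omega) (show 0 < 2 ^ L.w from Nat.pow_pos (by omega)) ?_)
    set s₁ := (s.setV 40 (Ex.eval s (.num 0))).setV 41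
      (Ex.eval (s.setV 40 (Ex.eval s (.num 0))) (.num 0)) with hs₁
    have hv₁ : ∀ q, q ≠ 40 → q ≠ 41 → s₁.v q = s.v q := fun q h h' => by
      rw [hs₁, Store.setV_v_of_ne _ _ h', Store.setV_v_of_ne _ _ h]
    have htot : ∀ b, s₁.v (totalVar b) = 0 := by
      rintro (_ | _)
      · show s₁.v 40 = 0
        rw [hs₁, Store.setV_v_of_ne _ _ (by omega), Store.setV_v_self, Ex.eval]
      · show s₁.v 41 = 0
        rw [hs₁, Store.setV_v_self, Ex.eval]
    refine Tri.seq ((Tri.totals hL hk hOb root x E base s₁ hb (by omega) hroot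
      (hO.congr (fun q h => hv₁ q (by omega) (by omega)) fun _ _ => rfl) hz
      (fun b => by rw [htot, Nat.zero_add]; exact hw)).mono ?_)
    rintro t₂ s₂ ⟨ht₂, hO₂, hv₂, ha₂, htot₂⟩
    have h40 : s₂.v 40 = signedTotal (relLists out) false E := by
      have := htot₂ false
      rwa [htot, Nat.zero_add] at this
    have h41 : s₂.v 41 = signedTotal (relLists out) true E := by
      have := htot₂ true
      rwa [htot, Nat.zero_add] at this
    have hcount := signedTotal_expand ho H
    rw [← hE, ← SimpleGraph.copyCount_mul_card_iso] at hcount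
    refine Tri.seq (Tri.set (by omega) ⟨⟨show 40 < L.nv by omega, show 41 < L.nv by omega, ?_⟩,
      haut⟩ ?_)
    · show s₂.v 41 ≤ s₂.v 40
      omega
    · have hval : Ex.eval s₂ (.div (.sub (.var 40) (.var 41)) (.num (Nat.card (H ≃g H)))) =
          G.copyCount H := by
        simp only [Ex.eval]
        rw [h40, h41, hcount, Nat.add_sub_cancel_left, Nat.mul_div_cancel _ haut0]
      rw [hval]
      refine (Tri.patterns hL hk ho hOb root x Hs (base + (k + 1) * E.length) (r + 1) _ (by omega)
        (by omega) (by omega) (by omega) (fun H' h' => hH H' (List.mem_cons_of_mem _ h'))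
        (hO₂.congr (fun q h => Store.setV_v_of_ne _ _ (by omega)) fun _ _ => rfl) ha₂).mono ?_
      rintro t₃ s₃ ⟨ht₃, hv₃, hres⟩
      refine ⟨?_, ?_, ?_⟩
      · have h1 : patternsTime (H :: Hs) = totalsTime E + 20 + patternsTime Hs := by
          simp [patternsTime, hE]
        have h2 : patternsTime (H :: Hs) * (m * κ ^ (k - 2)) =
            totalsTime E * (m * κ ^ (k - 2)) + 20 * (m * κ ^ (k - 2)) +
              patternsTime Hs * (m * κ ^ (k - 2)) := by rw [h1]; ring
        simp only [Ex.cost]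
        omega
      · intro q h h'
        rw [hv₃ q h (by omega), Store.setV_v_of_ne _ _ (by omega), hv₂ q h,
          hv₁ q (by omega) (by omega)]
      · intro ⟨i, hi⟩
        cases i with
        | zero =>
          show s₃.v (r + 0) = _
          rw [Nat.add_zero, hv₃ r hr (by omega), Store.setV_v_self]
          rfl
        | succ i =>
          rw [List.length_cons] at hi
          have := hres ⟨i, by omega⟩
          show s₃.v (r + (i + 1)) = _
          rw [show r + (i + 1) = r + 1 + i by omega]
          exact this

end WordRAM

namespace WordRAM
open SubgraphCounting

variable {L : Layout} {n k : ℕ}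

/-! ## Complete programs -/

/-- On the given input, program `P` halts after at most `T` steps and leaves `out` in memory,
whatever the random words are. -/
def Computes (w : ℕ) (P : Program) (input out : List ℕ) (T : ℕ) : Prop :=
  ∃ t ≤ T, ∃ (ρ : ℕ → BitVec w) (μ : BitVec w → BitVec w),
    Steps P (fun _ => 0) (init w P input).mem t ρ μ ∧
      ∀ i : Fin out.length, (μ (BitVec.ofNat w i)).toNat = out.get i

theorem run_of_steps {w t : ℕ} {P : Program} {input : List ℕ} {ρ : ℕ → BitVec w}
    {μ : BitVec w → BitVec w} (h : Steps P (fun _ => 0) (init w P input).mem t ρ μ) (ω : Tape w) :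
    run ω P input t = ⟨[], ρ, μ, 0⟩ := by
  have := h ω [] 0
  rwa [List.append_nil] at this

theorem Computes.outputs {w : ℕ} {P : Program} {input out : List ℕ} {T : ℕ}
    (h : Computes w P input out T) (ω : Tape w) : Outputs ω P input out := by
  obtain ⟨t, -, ρ, μ, hs, ho⟩ := h
  refine ⟨t, ?_, fun i => ?_⟩ <;> rw [run_of_steps hs ω]
  exact ho i

/-- The running time is bounded by the same constant for every tape, and the tape measure is a
probability measure. -/
theorem Computes.expectedTime_le {w : ℕ} {P : Program} {input out : List ℕ} {T : ℕ}
    (h : Computes w P input out T) : expectedTime w P input ≤ T := by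
  obtain ⟨t, ht, ρ, μ, hs, -⟩ := h
  have h1 : ∀ ω : Tape w, runTime ω P input ≤ t := fun ω =>
    iInf₂_le t (by rw [run_of_steps hs ω])
  have : IsProbabilityMeasure (tapeMeasure w) := by
    have : ∀ _ : ℕ, IsProbabilityMeasure (PMF.uniformOfFintype (Fin (2 ^ w))).toMeasure :=
      fun _ => PMF.toMeasure.isProbabilityMeasure _
    unfold tapeMeasure
    infer_instance
  calc expectedTime w P input ≤ ∫⁻ _, (t : ℝ≥0∞) ∂tapeMeasure w := lintegral_mono h1
    _ = t := by simp
    _ ≤ T := by exact_mod_cast ht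

/-- Write the values of registers to the memory cells from `i` on, using the register `tmp`. -/
def writeRegs (tmp : ℕ) : ℕ → List ℕ → Program
  | _, [] => []
  | i, r :: rs => .const tmp i :: .store tmp r :: writeRegs tmp (i + 1) rs

/-- The counts are kept in registers, so overwriting the memory from address 0 destroys nothing that
is still needed; `tmp` holds the addresses and must not be one of the registers to be written. -/
theorem steps_writeRegs {w tmp : ℕ} : ∀ (rs : List ℕ) (i : ℕ) (ρ : ℕ → BitVec w)
    (μ : BitVec w → BitVec w), i + rs.length ≤ 2 ^ w → tmp ∉ rs →
    ∃ ρ' μ', Steps (writeRegs tmp i rs) ρ μ (2 * rs.length) ρ' μ' ∧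
      (∀ j < i, μ' (BitVec.ofNat w j) = μ (BitVec.ofNat w j)) ∧
      ∀ j (h : j < rs.length), μ' (BitVec.ofNat w (i + j)) = ρ rs[j]
  | [], i, ρ, μ, _, _ => ⟨ρ, μ, Steps.nil, fun _ _ => rfl, fun j h => absurd h (by simp)⟩
  | r :: rs, i, ρ, μ, hi, ht => by
    rw [List.length_cons] at hi
    rw [List.mem_cons, not_or] at ht
    obtain ⟨ρ', μ', h1, h2, h3⟩ := steps_writeRegs rs (i + 1)
      (Function.update ρ tmp (BitVec.ofNat w i))
      (Function.update μ (BitVec.ofNat w i) (ρ r)) (by omega) ht.2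
    refine ⟨ρ', μ', ?_, ?_, ?_⟩
    · have e := (Steps.store (ρ := Function.update ρ tmp (BitVec.ofNat w i)) (μ := μ) tmp r).cons
        (Q := writeRegs tmp (i + 1) rs) (ρ'' := ρ') (μ'' := μ') (t' := 2 * rs.length) (by
          rw [Function.update_self, Function.update_of_ne (Ne.symm ht.1)]; exact h1)
      have e' := (Steps.const (ρ := ρ) (μ := μ) tmp i).cons e
      rw [List.length_cons, show 2 * (rs.length + 1) = 1 + (1 + 2 * rs.length) by omega]
      exact e'
    · intro j hj
      rw [h2 j (by omega), Function.update_of_ne]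
      intro he
      have := congrArg BitVec.toNat he
      rw [BitVec.toNat_ofNat, BitVec.toNat_ofNat, Nat.mod_eq_of_lt (by omega),
        Nat.mod_eq_of_lt (by omega)] at this
      omega
    · intro j hj
      cases j with
      | zero =>
        rw [Nat.add_zero, h2 i (by omega), Function.update_self]
        rfl
      | succ j =>
        rw [List.length_cons] at hj
        have := h3 j (by omega)
        rw [Function.update_of_ne] at this
        · rw [show i + (j + 1) = i + 1 + j by omega, this]
          rfl
        · intro he
          exact ht.2 (he ▸ List.getElem_mem _)

/-- A program that outputs `len` copies of one of the numbers of the input. -/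
def copyInput (i len : ℕ) : Program :=
  .const 0 i :: .load 0 0 :: writeRegs 1 0 (List.replicate len 0)

theorem computes_copyInput {w : ℕ} {i : ℕ} {input out : List ℕ} (hi : i < 2 ^ w)
    (hv : input.getD i 0 < 2 ^ w) (hlen : out.length ≤ 2 ^ w) (hout : ∀ o ∈ out, o = input.getD i 0) :
    Computes w (copyInput i out.length) input out (2 * out.length + 2) := by
  set μ := (init w (copyInput i out.length) input).mem with hμ
  obtain ⟨ρ', μ', h1, -, h3⟩ := steps_writeRegs (w := w) (tmp := 1) (List.replicate out.length 0) 0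
    (Function.update (Function.update (fun _ : ℕ => (0 : BitVec w)) 0 (BitVec.ofNat w i)) 0
      (μ (Function.update (fun _ : ℕ => (0 : BitVec w)) 0 (BitVec.ofNat w i) 0))) μ (by simpa using hlen)
      (by simp [List.mem_replicate])
  rw [List.length_replicate] at h1
  refine ⟨_, le_rfl, ρ', μ', ?_, ?_⟩
  · have e := (Steps.const (ρ := fun _ => 0) (μ := μ) 0 i).cons ((Steps.load _ _).cons h1)
    rw [show 2 * out.length + 2 = 1 + (1 + 2 * out.length) by omega]
    exact e
  · intro j
    have := h3 j (by simp)
    rw [Nat.zero_add] at this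
    rw [this, List.getElem_replicate, Function.update_self, Function.update_self, hμ]
    simp only [init, BitVec.toNat_ofNat]
    rw [Nat.mod_eq_of_lt hi, Nat.mod_eq_of_lt hv]
    exact (hout _ (List.get_mem _ _)).symm

theorem two_mul_length_le {G : SimpleGraph (Fin n)} {es : List (Fin n × Fin n)}
    (hes : IsEdgeList G es) : 2 * es.length ≤ n * n := by
  rw [← sum_length_neighborList]
  refine (Finset.sum_le_card_nsmul _ _ n fun u _ => ?_).trans (by simp)
  simpa using ((neighborLists hes).nodup u).length_le_card

theorem length_encode (es : List (Fin n × Fin n)) : (encode n es).length = 2 * es.length + 2 := by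
  simp [encode, List.length_flatMap]; ring

theorem getD_encode_lt (es : List (Fin n × Fin n)) {N : ℕ} (hn : n < N) (hm : es.length < N)
    (i : ℕ) : (encode n es).getD i 0 < N := by
  rcases lt_or_ge i (encode n es).length with h | h
  · rw [List.getD_eq_getElem _ _ h]
    have hmem := List.getElem_mem h
    revert hmem
    generalize (encode n es)[i] = a
    intro hmem
    simp only [encode, List.mem_cons, List.mem_flatMap, List.not_mem_nil, or_false] at hmem
    rcases hmem with rfl | rfl | ⟨e, -, rfl | rfl⟩
    · exact hn
    · exact hm
    · exact e.1.isLt.trans hn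
    · exact e.2.isLt.trans hn
  · rw [List.getD_eq_default _ _ h]; omega

/-- Read the numbers of vertices and edges and compute the length of the arrays. -/
def prelude (nv : ℕ) : Program :=
  [.const 0 0, .load 0 0, .const 1 1, .arith .add 1 0 1, .const 2 1, .load 2 2,
    .arith .mul nv 1 1, .arith .mul nv nv nv, .arith .mul nv nv 1]

/-- The array length is computed as `((n + 1) ^ 2) ^ 2 * (n + 1)`. The input fits into array 0, and
all memory behind it is zero, which provides the empty arrays for free. -/
theorem steps_prelude (hnv : 3 ≤ L.nv) (hB : L.B = (n + 1) ^ 5) {es : List (Fin n × Fin n)}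
    {P : Program} (hlen : 2 * es.length + 2 ≤ L.B) :
    ∃ ρ s, Steps (prelude L.nv) (fun _ => 0) (init L.w P (encode n es)).mem 9 ρ
      (init L.w P (encode n es)).mem ∧ Rep L s ρ (init L.w P (encode n es)).mem ∧
      Loaded L es s := by
  have hBw := L.len_lt
  have h1w := L.one_lt
  have hnB : n + 1 ≤ L.B := hB ▸ Nat.le_self_pow (by omega) _
  set input := encode n es with hin
  set μ := (init L.w P input).mem with hμ
  have hget : ∀ i, input.getD i 0 < 2 ^ L.w := getD_encode_lt es (by omega) (by omega)
  have hmem : ∀ i, i < 2 ^ L.w → (μ (BitVec.ofNat L.w i)).toNat = input.getD i 0 := by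
    intro i hi
    simp only [hμ, init, BitVec.toNat_ofNat]
    rw [Nat.mod_eq_of_lt hi, Nat.mod_eq_of_lt (hget i)]
  let s : Store := ⟨fun r => if r = 0 then n else if r = 1 then n + 1 else
    if r = 2 then es.length else 0, fun a i => input.getD (a * L.B + i) 0⟩
  refine ⟨_, s, (Steps.const _ _).cons ((Steps.load _ _).cons ((Steps.const _ _).cons
    ((Steps.arith _ _ _ _).cons ((Steps.const _ _).cons ((Steps.load _ _).cons
      ((Steps.arith _ _ _ _).cons ((Steps.arith _ _ _ _).cons (Steps.arith _ _ _ _)))))))),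
    ⟨?_, ?_, ?_⟩, ⟨rfl, rfl, rfl, ?_, ?_⟩⟩
  · intro r hr
    have h0 := hmem 0 (by omega)
    have h1 := hmem 1 h1w
    simp only [Function.update_apply, hr.ne, if_false, Op.eval, s]
    by_cases r2 : r = 2
    · subst r2
      simpa [hin, encode] using h1
    by_cases r1 : r = 1
    · subst r1
      simp only [OfNat.ofNat_ne_zero, OfNat.one_ne_ofNat, if_true, if_false, zero_ne_one,
        one_ne_zero, BitVec.toNat_add, h0, BitVec.toNat_ofNat, Nat.mod_eq_of_lt h1w]
      exact Nat.mod_eq_of_lt (by simpa [hin, encode] using (by omega : n + 1 < 2 ^ L.w))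
    by_cases r0 : r = 0
    · subst r0
      simpa [hin, encode] using h0
    · simp [r2, r1, r0]
  · have h0 : (μ (BitVec.ofNat L.w 0)).toNat = n := hmem 0 (by omega)
    have n0 : L.nv ≠ 0 := by omega
    have n1 : (1 : ℕ) ≠ L.nv := by omega
    have n2 : (2 : ℕ) ≠ L.nv := by omega
    have hp : ((n + 1) * (n + 1)) * ((n + 1) * (n + 1)) * (n + 1) = L.B := by rw [hB]; ring
    simp only [Function.update_apply, if_true, n1, if_false, Op.eval, OfNat.ofNat_ne_zero,
      OfNat.one_ne_ofNat, zero_ne_one, one_ne_zero, BitVec.toNat_mul, BitVec.toNat_add, h0,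
      BitVec.toNat_ofNat, Nat.mul_mod_mod, Nat.mod_mul_mod, Nat.mod_eq_of_lt h1w,
      Nat.mod_eq_of_lt (show n + 1 < 2 ^ L.w by omega)]
    rw [hp, Nat.mod_eq_of_lt hBw]
  · intro a ha i hi
    exact hmem _ (L.address_lt ha hi)
  · intro i hi
    show input.getD (0 * L.B + i) 0 = _
    rw [Nat.zero_mul, Nat.zero_add]
  · intro a ha
    funext i
    show input.getD (a * L.B + i) 0 = 0
    have : L.B ≤ a * L.B := Nat.le_mul_of_pos_left _ ha
    refine List.getD_eq_default _ _ ?_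
    rw [hin, length_encode]
    omega

end WordRAM

/-! ### Word length, trivial cases and assembly of the program -/

namespace WordRAM
open SubgraphCounting

variable {n k : ℕ}

theorem length_eq_ncard_edgeSet {G : SimpleGraph (Fin n)} {es : List (Fin n × Fin n)}
    (hes : IsEdgeList G es) : es.length = G.edgeSet.ncard := by
  classical
  have h : G.edgeSet = ((es.map fun p => s(p.1, p.2)).toFinset : Set (Sym2 (Fin n))) := by
    ext e
    rw [← hes.2]
    simp
  rw [h, Set.ncard_coe_finset, List.toFinset_card_of_nodup hes.1, List.length_map]

theorem one_le_degeneracy {G : SimpleGraph (Fin n)} {u v : Fin n} (h : G.Adj u v) :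
    1 ≤ degeneracy G := by
  by_contra h0
  have hd := isDegenerate_degeneracy G
  rw [show degeneracy G = 0 by omega] at hd
  obtain ⟨a, ha, hle⟩ := hd.exists_neighbors_le {u, v} ⟨u, by simp⟩
  have h1 := (Set.ncard_eq_zero (Set.toFinite _)).1 (Nat.le_zero.1 hle)
  rcases ha with rfl | ha
  · have : v ∈ {w | w ∈ ({a, v} : Set (Fin n)) ∧ G.Adj a w} := ⟨by simp, h⟩
    rw [h1] at this
    exact this
  · rw [Set.mem_singleton_iff] at ha
    subst ha
    have : u ∈ {w | w ∈ ({u, a} : Set (Fin n)) ∧ G.Adj a w} := ⟨by simp, h.symm⟩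
    rw [h1] at this
    exact this

theorem degeneracy_of_length_eq_zero {G : SimpleGraph (Fin n)} {es : List (Fin n × Fin n)}
    (hes : IsEdgeList G es) (h : es.length = 0) : degeneracy G = 0 := by
  refine Nat.le_zero.1 (Nat.sInf_le (s := {d | IsDegenerate G d}) fun G' ⟨v, hv⟩ => ⟨v, hv, ?_⟩)
  have hn : G'.neighborSet v = ∅ := by
    rw [Set.eq_empty_iff_forall_notMem]
    intro w hw
    have := (mem_neighborList_iff hes).2 (G'.adj_sub hw)
    rw [List.length_eq_zero_iff.1 h] at this
    simp [neighborList] at this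
  simp [hn]

/-- From `A < 2 ^ A` and `n + 1 ≤ 2 ^ n.size`: a word of `A + 30 * n.size` bits suffices. This fixes
the constant `c` in the word length convention. -/
theorem mul_pow_lt_two_pow (A : ℕ) {w : ℕ} (hn : 1 ≤ n) (hw : (A + 31) * n.size ≤ w) :
    A * (n + 1) ^ 30 < 2 ^ w := by
  have h1 : n + 1 ≤ 2 ^ n.size := Nat.lt_size_self n
  have h2 : 1 ≤ n.size := Nat.size_pos.2 hn
  calc A * (n + 1) ^ 30 ≤ A * (2 ^ n.size) ^ 30 :=
        Nat.mul_le_mul_left _ (Nat.pow_le_pow_left h1 _)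
    _ < 2 ^ A * (2 ^ n.size) ^ 30 :=
        Nat.mul_lt_mul_of_pos_right Nat.lt_two_pow_self (by positivity)
    _ = 2 ^ (A + 30 * n.size) := by rw [← pow_mul, ← pow_add, Nat.mul_comm 30]
    _ ≤ 2 ^ w := Nat.pow_le_pow_right (by omega) (by nlinarith)

/-- The maxima with 1 accommodate the equality lists, of length 1, and the graph without edges. -/
theorem Orients.bounded {G : SimpleGraph (Fin n)} {κ m : ℕ} {out : Fin n → List (Fin n)}
    (ho : Orients G κ m out) (hn : n ≤ 2 * max 1 m) :
    Bounded (relLists out) (max 1 κ) (max 1 m) where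
  nodup
    | true, u => ho.nodup u
    | false, u => List.nodup_singleton u
  length_le
    | true, u => (ho.length_le u).trans (le_max_right _ _)
    | false, u => le_max_left _ _
  sum_le
    | true => ho.sum_le.trans (Nat.mul_le_mul_left _ (le_max_right _ _))
    | false => by simpa [relLists] using hn
  card_le := hn
  one_le := le_max_left _ _
  one_le' := le_max_left _ _

/-- The complete program for a list of patterns. -/
noncomputable def countProgram (nv : ℕ) (root : List (Con k) → Fin k)
    (Hs : List (SimpleGraph (Fin k))) : Program :=
  prelude nv ++ (Cmd.seq (Cmd.prepare nv) (Cmd.patterns nv root 14 50 Hs) (nv + 1) ++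
    writeRegs (nv + 1) 0 (List.range' 50 Hs.length))

theorem card_iso_pos (H : SimpleGraph (Fin k)) : 0 < Nat.card (H ≃g H) := by
  have : Finite (H ≃g H) :=
    Finite.of_injective (fun σ => (σ : Fin k → Fin k)) DFunLike.coe_injective
  have : Nonempty (H ≃g H) := ⟨SimpleGraph.Iso.refl⟩
  exact Nat.card_pos

/-- The condition `3 ≤ k` lets the preparation time, of order mκ, be absorbed in mκ^(k−2). -/
theorem exists_program_of_three_le (hk3 : 3 ≤ k) (hk : k ≤ 5) (Hs : List (SimpleGraph (Fin k)))
    (hHs : ∀ H ∈ Hs, H.Connected) :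
    ∃ (P : Program) (c C : ℕ), ∀ (n : ℕ) (G : SimpleGraph (Fin n)) (es : List (Fin n × Fin n))
      (w : ℕ), G.Connected → IsEdgeList G es → c * n.size ≤ w →
      Computes w P (encode n es) (Hs.map fun H => G.copyCount H)
        (C * (max 1 es.length * max 1 (degeneracy G) ^ (k - 2))) := by
  classical
  -- The root depends only on the system of constraints, so it is fixed when the program is written
  -- and nothing is searched for at run time.
  have hroot : ∀ cs : List (Con k), ∃ r : Fin k, LinkConnected cs → IsRoot cs r := by
    intro cs
    by_cases h : LinkConnected cs
    · obtain ⟨r, hr⟩ := exists_root hk (by omega) h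
      exact ⟨r, fun _ => hr⟩
    · exact ⟨⟨0, by omega⟩, fun h' => absurd h' h⟩
  choose root hroot using hroot
  set D := (Hs.map fun H => (expand H (vertexPairs k)).length + Nat.card (H ≃g H)).sum with hD
  -- One number that dominates all constants depending on the patterns; every overflow condition
  -- below is then an instance of `hlt`.
  set A := 30 + tableArrays Hs + Hs.length + D with hA
  refine ⟨countProgram (50 + Hs.length) root Hs, A + 31, 4000 + patternsTime Hs + 2 * Hs.length,
    fun n G es w hG hes hw => ?_⟩
  have hn : 1 ≤ n := Fin.pos_iff_nonempty.2 hG.nonempty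
  have hA2 := mul_pow_lt_two_pow A hn hw
  have hpow : ∀ j ≤ 30, (n + 1) ^ j ≤ (n + 1) ^ 30 := fun j hj =>
    Nat.pow_le_pow_right (Nat.succ_pos n) hj
  have h30 : 1 ≤ (n + 1) ^ 30 := Nat.one_le_pow _ _ (Nat.succ_pos n)
  have hlt : ∀ a ≤ A, ∀ j ≤ 30, a * (n + 1) ^ j < 2 ^ w := fun a ha j hj =>
    lt_of_le_of_lt (Nat.mul_le_mul ha (hpow j hj)) hA2
  have hlt' : ∀ a ≤ A, a < 2 ^ w := fun a ha => by simpa using hlt a ha 0 (by omega)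
  let L : Layout := ⟨w, 50 + Hs.length, (n + 1) ^ 5, 14 + tableArrays Hs,
    (hlt _ (by omega) 5 (by omega)).le, by simpa using hlt 1 (by omega) 5 (by omega),
    hlt' _ (by omega)⟩
  have hsq : (n + 1) * (n + 1) ≤ (n + 1) ^ 5 := by
    rw [← sq]; exact Nat.pow_le_pow_right (Nat.succ_pos n) (by omega)
  have hL : Space L n := ⟨⟨hsq, Nat.le_add_right _ _, Nat.le_add_right _ _, (hlt' 16 (by omega)).le⟩,
    le_rfl, by simpa using hlt 1 (by omega) 30 le_rfl⟩
  have hlen : 2 * es.length + 2 ≤ (n + 1) ^ 5 := by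
    have := two_mul_length_le hes
    nlinarith
  obtain ⟨ρ₀, s₀, e₀, r₀, l₀⟩ := steps_prelude (L := L) (n := n) (es := es)
    (P := countProgram (50 + Hs.length) root Hs) (show 3 ≤ 50 + Hs.length by omega) rfl hlen
  -- Connectedness of `G` enters the time bound here: terms in n are absorbed by terms in m.
  have hnm : n ≤ es.length + 1 := by
    have := hG.card_vert_le_card_edgeSet_add_one
    rw [Nat.card_eq_fintype_card, Fintype.card_fin] at this
    rw [length_eq_ncard_edgeSet hes]
    exact this
  have hn2 : n ≤ 2 * max 1 es.length := by omega
  set κ := degeneracy G with hκ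
  set M := max 1 es.length * max 1 κ ^ (k - 2) with hM
  have hpat : ∀ H ∈ Hs, (∀ e ∈ expand H (vertexPairs k), IsRoot e.2 (root e.2)) ∧
      Nat.card (H ≃g H) < 2 ^ L.w ∧ 0 < Nat.card (H ≃g H) ∧
      (expand H (vertexPairs k)).length * n ^ k < 2 ^ L.w := by
    intro H hH
    have hmem : (expand H (vertexPairs k)).length + Nat.card (H ≃g H) ≤ D :=
      List.le_sum_of_mem (List.mem_map_of_mem hH)
    refine ⟨fun e he => hroot _ (linkConnected_of_mem_expand (hHs H hH) he), hlt' _ (by omega),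
      card_iso_pos H, ?_⟩
    exact lt_of_le_of_lt (Nat.mul_le_mul_left _ (Nat.pow_le_pow_left (Nat.le_succ n) k))
      (hlt _ (by omega) k (by omega))
  have htri : Tri L (Cmd.seq (Cmd.prepare L.nv) (Cmd.patterns L.nv root 14 50 Hs)) s₀ fun t s =>
      t ≤ (3990 + patternsTime Hs) * M ∧
        ∀ i : Fin Hs.length, s.v (50 + i) = G.copyCount (Hs.get i) := by
    refine Tri.seq (Tri.prepare hL.toRoom hes (isDegenerate_degeneracy G) l₀ hlen ?_)
    intro t s out ht ho hR hz
    refine (Tri.patterns hL hk ho (ho.bounded hn2) root (fun _ => ⟨0, hn⟩) Hs 14 50 s le_rfl le_rfl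
      le_rfl le_rfl hpat hR hz).mono ?_
    rintro t' s' ⟨ht', -, hv⟩
    refine ⟨?_, hv⟩
    rw [Nat.add_mul]
    refine Nat.add_le_add (ht.trans ?_) ht'
    have h1 : 1 ≤ max 1 κ := le_max_left _ _
    have h2 : 1 ≤ max 1 es.length := le_max_left _ _
    have h3 : max 1 es.length * max 1 κ ≤ M :=
      Nat.mul_le_mul_left _ (Nat.le_self_pow (by omega) _)
    have h4 : es.length ≤ max 1 es.length := le_max_right _ _
    have h5 : κ + 1 ≤ 2 * max 1 κ := by omega
    have h6 : n * (κ + 1) ≤ 2 * max 1 es.length * (2 * max 1 κ) := Nat.mul_le_mul hn2 h5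
    have h7 : max 1 es.length ≤ max 1 es.length * max 1 κ := Nat.le_mul_of_pos_right _ h1
    have h8 : 300 * n * (κ + 1) = 300 * (n * (κ + 1)) := by ring
    have h9 : 2 * max 1 es.length * (2 * max 1 κ) = 4 * (max 1 es.length * max 1 κ) := by ring
    rw [h8]
    rw [h9] at h6
    omega
  obtain ⟨t, s, ρ₁, μ₁, e₁, -, r₁, ht, hv⟩ := htri (L.nv + 1) (Nat.lt_succ_self _) _ _ r₀
  obtain ⟨ρ₂, μ₂, e₂, -, hout⟩ := steps_writeRegs (w := w) (tmp := L.nv + 1)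
    (List.range' 50 Hs.length) 0 ρ₁ μ₁
    (by rw [List.length_range', Nat.zero_add]; exact (hlt' _ (by omega)).le)
    (by
      rw [List.mem_range'_1]
      show ¬ (50 ≤ 50 + Hs.length + 1 ∧ 50 + Hs.length + 1 < 50 + Hs.length)
      omega)
  refine ⟨_, ?_, ρ₂, μ₂, e₀.append (e₁.append e₂), fun i => ?_⟩
  · rw [List.length_range']
    have hM1 : 1 ≤ M := Nat.mul_pos (by omega) (Nat.one_le_pow _ _ (by omega))
    have h1 : (4000 + patternsTime Hs + 2 * Hs.length) * M =
        (3990 + patternsTime Hs) * M + 10 * M + 2 * Hs.length * M := by ring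
    have h2 : 2 * Hs.length ≤ 2 * Hs.length * M := Nat.le_mul_of_pos_right _ hM1
    omega
  · have hi : (i : ℕ) < Hs.length := by simpa using i.isLt
    have h := hout i (by simpa using hi)
    rw [Nat.zero_add, List.getElem_range'] at h
    rw [h, Nat.one_mul, r₁.var _ (show 50 + (i : ℕ) < 50 + Hs.length by omega)]
    have := hv ⟨i, hi⟩
    simpa using this

theorem copyCount_fin_one (G : SimpleGraph (Fin n)) (H : SimpleGraph (Fin 1)) :
    G.copyCount H = n := by
  have h := G.copyCount_mul_card_iso H
  have h1 : Nat.card (H ≃g H) = 1 := by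
    have : Subsingleton (H ≃g H) := ⟨fun σ τ => RelIso.ext fun x => Subsingleton.elim _ _⟩
    have : Nonempty (H ≃g H) := ⟨SimpleGraph.Iso.refl⟩
    exact Nat.card_of_subsingleton SimpleGraph.Iso.refl
  have h2 := card_filter_eq_labelledCopyCount (G := G) (H := H) (P := fun _ => True) fun y =>
    ⟨fun _ => ⟨Function.injective_of_subsingleton y, fun i j hij =>
      absurd (Subsingleton.elim i j) hij.ne⟩, fun _ => trivial⟩
  rw [h1, mul_one, ← h2] at h
  simpa using h

/-- The pattern is a single edge with two automorphisms, and its labelled copies are counted by the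
handshake identity. -/
theorem copyCount_fin_two {G : SimpleGraph (Fin n)} {es : List (Fin n × Fin n)}
    (hes : IsEdgeList G es) {H : SimpleGraph (Fin 2)} (hH : H.Connected) :
    G.copyCount H = es.length := by
  classical
  have hadj : ∀ i j : Fin 2, H.Adj i j ↔ i ≠ j := by
    have h01 : H.Adj 0 1 := by
      obtain ⟨v, hv⟩ := hH.preconnected.exists_adj_of_nontrivial 0
      have : v = 1 := by
        have := hv.ne
        omega
      exact this ▸ hv
    intro i j
    refine ⟨fun h => h.ne, fun h => ?_⟩
    fin_cases i <;> fin_cases j <;> first | exact absurd rfl h | exact h01 | exact h01.symm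
  have h := G.copyCount_mul_card_iso H
  have h1 : Nat.card (H ≃g H) = 2 := by
    rw [Nat.card_congr (β := Equiv.Perm (Fin 2))
      ⟨fun σ => σ.toEquiv, fun e => ⟨e, by simp [hadj]⟩, fun _ => rfl, fun _ => rfl⟩]
    rw [Nat.card_perm, Nat.card_eq_fintype_card, Fintype.card_fin, Nat.factorial_two]
  have h2 := card_filter_eq_labelledCopyCount (G := G) (H := H)
    (P := fun y => G.Adj (y 0) (y 1)) fun y => by
      constructor
      · intro h
        constructor
        · intro i j hij
          fin_cases i <;> fin_cases j <;> first | rfl | exact absurd hij h.ne | exact absurd hij.symm h.ne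
        · intro i j hij
          have := (hadj i j).1 hij
          fin_cases i <;> fin_cases j <;> first | exact absurd rfl this | exact h | exact h.symm
      · exact fun h => h.2 0 1 ((hadj _ _).2 (by simp))
  have h3 : (Finset.univ.filter fun y : Fin 2 → Fin n => G.Adj (y 0) (y 1)).card =
      2 * es.length := by
    rw [← sum_length_neighborList, Finset.card_filter,
      ← (finTwoArrowEquiv (Fin n)).symm.sum_comp, Fintype.sum_prod_type]
    refine Finset.sum_congr rfl fun u _ => ?_
    rw [← List.toFinset_card_of_nodup ((neighborLists hes).nodup u), ← Finset.card_filter]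
    congr 1
    ext v
    simp [mem_neighborList_iff hes]
  rw [h1, ← h2, h3] at h
  omega

/-- The counts are n for one vertex and m for two, and both stand at the start of the input, so
constant time suffices. -/
theorem exists_program_of_le_two (hk1 : 1 ≤ k) (hk : k ≤ 2) (Hs : List (SimpleGraph (Fin k)))
    (hHs : ∀ H ∈ Hs, H.Connected) :
    ∃ (P : Program) (c C : ℕ), ∀ (n : ℕ) (G : SimpleGraph (Fin n)) (es : List (Fin n × Fin n))
      (w : ℕ), G.Connected → IsEdgeList G es → c * n.size ≤ w →
      Computes w P (encode n es) (Hs.map fun H => G.copyCount H) C := by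
  have hsmall : ∃ i, i ≤ 1 ∧ ∀ (n : ℕ) (G : SimpleGraph (Fin n)) (es : List (Fin n × Fin n)),
      IsEdgeList G es → ∀ H ∈ Hs, G.copyCount H = (encode n es).getD i 0 := by
    obtain rfl | rfl : k = 1 ∨ k = 2 := by omega
    · exact ⟨0, by omega, fun n G es hes H hH => copyCount_fin_one G H⟩
    · exact ⟨1, le_rfl, fun n G es hes H hH => copyCount_fin_two hes (hHs H hH)⟩
  obtain ⟨i, hi, hcount⟩ := hsmall
  refine ⟨copyInput i Hs.length, Hs.length + 2 + 31, 2 * Hs.length + 2,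
    fun n G es w hG hes hw => ?_⟩
  have hn : 1 ≤ n := Fin.pos_iff_nonempty.2 hG.nonempty
  have hw2 := mul_pow_lt_two_pow (Hs.length + 2) hn hw
  have h1 : 1 ≤ (n + 1) ^ 30 := Nat.one_le_pow _ _ (Nat.succ_pos n)
  have h2 : (n + 1) ^ 2 ≤ (n + 1) ^ 30 := Nat.pow_le_pow_right (Nat.succ_pos n) (by omega)
  have h3 : Hs.length + 2 ≤ (Hs.length + 2) * (n + 1) ^ 30 := Nat.le_mul_of_pos_right _ h1
  have h4 : (n + 1) ^ 30 ≤ (Hs.length + 2) * (n + 1) ^ 30 := Nat.le_mul_of_pos_left _ (by omega)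
  have h5 := two_mul_length_le hes
  have h6 : (n + 1) ^ 2 = n * n + 2 * n + 1 := by ring
  have := computes_copyInput (w := w) (i := i) (input := encode n es)
    (out := Hs.map fun H => G.copyCount H) (by omega)
    (getD_encode_lt es (by nlinarith) (by omega) i) (by rw [List.length_map]; omega)
    (by
      intro o ho
      obtain ⟨H, hH, rfl⟩ := List.mem_map.1 ho
      exact hcount n G es hes H hH)
  rwa [List.length_map] at this

end WordRAM

/-! ### From step counts to the asymptotic bounds -/

namespace SubgraphCounting
open WordRAM

/-- The cost in natural numbers is at most the cost in real numbers. -/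
theorem cost_le {n k : ℕ} {G : SimpleGraph (Fin n)} {es : List (Fin n × Fin n)}
    (hes : IsEdgeList G es) :
    ((max 1 es.length * max 1 (degeneracy G) ^ (k - 2) : ℕ) : ℝ) ≤
      max 1 ((G.edgeSet.ncard : ℝ) * (degeneracy G : ℝ) ^ (k - 2)) := by
  rw [← length_eq_ncard_edgeSet hes]
  -- Without edges m and κ vanish and both sides are 1; with an edge both are at least 1 and the
  -- inner maxima disappear.
  rcases Nat.eq_zero_or_pos es.length with h | h
  · rw [degeneracy_of_length_eq_zero hes h, h]
    simp
  · obtain ⟨e, he⟩ := List.exists_mem_of_length_pos h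
    have hd : 1 ≤ degeneracy G := one_le_degeneracy (u := e.1) (v := e.2)
      (G.mem_edgeSet.1 ((hes.2 _).1 (List.mem_map_of_mem he)))
    rw [max_eq_right hd, max_eq_right (Nat.succ_le_of_lt h)]
    push_cast
    exact le_max_right _ _

theorem exists_solves_of_computes {k : ℕ} {Hs : List (SimpleGraph (Fin k))} {P : Program} {c C : ℕ}
    {U : ∀ n, SimpleGraph (Fin n) → List (Fin n × Fin n) → ℕ} {T : ℕ → ℕ → ℝ}
    (h : ∀ (n : ℕ) (G : SimpleGraph (Fin n)) (es : List (Fin n × Fin n)) (w : ℕ),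
      G.Connected → IsEdgeList G es → c * n.size ≤ w →
      Computes w P (encode n es) (Hs.map fun H => G.copyCount H) (C * U n G es))
    (hU : ∀ n G es, IsEdgeList G es → (U n G es : ℝ) ≤ T G.edgeSet.ncard (degeneracy G)) :
    ∃ (P : Program) (c : ℕ), Solves P c Hs ∧ ∃ C : ℝ, 0 ≤ C ∧
      RunsInExpectedTime P c Set.univ fun m κ => C * T m κ := by
  refine ⟨P, c, ?_, C, Nat.cast_nonneg C, ?_⟩
  · intro n G es w hG hes hw
    exact Filter.Eventually.of_forall fun ω => (h n G es w hG hes hw).outputs ω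
  · intro n G es w hG hes hw _
    refine (h n G es w hG hes hw).expectedTime_le.trans ?_
    rw [← ENNReal.ofReal_natCast]
    refine ENNReal.ofReal_le_ofReal ?_
    rw [Nat.cast_mul]
    exact mul_le_mul_of_nonneg_left (hU n G es hes) (Nat.cast_nonneg C)

/-- The exponent is an integer because it is −1 for `k = 1`. For `k ≤ 2` the time is constant, so
the maximum with 1 alone suffices. -/
theorem exists_solves {k : ℕ} (hk1 : 1 ≤ k) (hk : k ≤ 5) (Hs : List (SimpleGraph (Fin k)))
    (hHs : ∀ H ∈ Hs, H.Connected) :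
    ∃ (P : Program) (c : ℕ), Solves P c Hs ∧ ∃ C : ℝ, 0 ≤ C ∧
      RunsInExpectedTime P c Set.univ
        fun m κ => C * max 1 ((m : ℝ) * (κ : ℝ) ^ ((k : ℤ) - 2)) := by
  by_cases hk3 : 3 ≤ k
  · obtain ⟨P, c, C, h⟩ := exists_program_of_three_le hk3 hk Hs hHs
    refine exists_solves_of_computes h fun n G es hes => ?_
    -- For `k ≥ 3` natural subtraction agrees with integer subtraction.
    rw [show (k : ℤ) - 2 = ((k - 2 : ℕ) : ℤ) by omega]
    simp only [zpow_natCast]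
    exact cost_le hes
  · obtain ⟨P, c, C, h⟩ := exists_program_of_le_two hk1 (by omega) Hs hHs
    exact exists_solves_of_computes (C := C) (U := fun _ _ _ => 1) (by simpa using h)
      fun n G es hes => by simp

theorem RunsInExpectedTime.mono {P : Program} {c : ℕ} {D D' : Set ℕ} {T T' : ℕ → ℕ → ℝ}
    (h : RunsInExpectedTime P c D T) (hD : D' ⊆ D) (hT : ∀ m, ∀ κ ∈ D', T m κ ≤ T' m κ) :
    RunsInExpectedTime P c D' T' := fun n G es w hG hes hw hκ =>
  (h n G es w hG hes hw (hD hκ)).trans (ENNReal.ofReal_le_ofReal (hT _ _ hκ))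

end SubgraphCounting

theorem mainTheorem1 :
    (∀ H : SimpleGraph (Fin 5), H.Connected →
      ∃ (P : WordRAM.Program) (c : ℕ), SubgraphCounting.Solves P c [H] ∧
        ∃ C : ℝ, SubgraphCounting.RunsInExpectedTime P c Set.univ
          (fun m κ => C * max 1 ((m : ℝ) * (κ : ℝ) ^ 3))) ∧
    (∀ k : ℕ, 1 ≤ k → k ≤ 5 →
      ∀ Hs : List (SimpleGraph (Fin k)), SubgraphCounting.IsPatternList Hs →
      ∃ (P : WordRAM.Program) (c : ℕ), SubgraphCounting.Solves P c Hs ∧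
        (∃ C : ℝ, SubgraphCounting.RunsInExpectedTime P c Set.univ
          (fun m κ => C * max 1 ((m : ℝ) * (κ : ℝ) ^ ((k : ℤ) - 2)))) ∧
        ∀ d : ℕ, ∃ C : ℝ, SubgraphCounting.RunsInExpectedTime P c (Set.Iic d)
          (fun m _ => C * max 1 (m : ℝ))) := by
  constructor
  · intro H hH
    obtain ⟨P, c, hP, C, -, hC⟩ := SubgraphCounting.exists_solves (k := 5) (by omega) le_rfl [H]
      (by simpa using hH)
    refine ⟨P, c, hP, C, hC.mono le_rfl fun m κ _ => le_of_eq ?_⟩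
    have h3 : ((5 : ℕ) : ℤ) - 2 = ((3 : ℕ) : ℤ) := by norm_num
    rw [h3, zpow_natCast]
  · intro k hk1 hk Hs hHs
    obtain ⟨P, c, hP, C, hC0, hC⟩ := SubgraphCounting.exists_solves hk1 hk Hs hHs.1
    -- The exponent is at most 3, so the power of κ is at most `max 1 (d ^ 3)` for every κ ≤ d,
    -- uniformly in `k`.
    refine ⟨P, c, hP, ⟨C, hC⟩, fun d => ⟨C * max 1 ((d : ℝ) ^ 3), ?_⟩⟩
    refine hC.mono (Set.subset_univ _) fun m κ hκ => ?_
    rw [mul_assoc]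
    refine mul_le_mul_of_nonneg_left ?_ hC0
    have hpow : (κ : ℝ) ^ ((k : ℤ) - 2) ≤ max 1 ((d : ℝ) ^ 3) := by
      rcases Nat.eq_zero_or_pos κ with rfl | h
      -- For κ = 0 the power is 0 or 1, also with a negative exponent, where it is 0 by convention.
      · exact le_trans (by rw [Nat.cast_zero, zero_zpow_eq]; split_ifs <;> norm_num) (le_max_left _ _)
      · have h1 : (1 : ℝ) ≤ κ := by exact_mod_cast h
        have h2 : (κ : ℝ) ≤ d := by exact_mod_cast hκ
        calc (κ : ℝ) ^ ((k : ℤ) - 2) ≤ (κ : ℝ) ^ (3 : ℤ) := zpow_le_zpow_right₀ h1 (by omega)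
          _ = (κ : ℝ) ^ 3 := by norm_cast
          _ ≤ (d : ℝ) ^ 3 := pow_le_pow_left₀ (by linarith) h2 3
          _ ≤ _ := le_max_right _ _
    have hd : (1 : ℝ) ≤ max 1 ((d : ℝ) ^ 3) := le_max_left _ _
    have hm : (1 : ℝ) ≤ max 1 (m : ℝ) := le_max_left _ _
    refine max_le (by nlinarith) ?_
    rw [mul_comm]
    exact mul_le_mul hpow (le_max_right _ _) (Nat.cast_nonneg m) (by linarith)
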